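/- Let $g\ge 0$ and $n>0$ be integers and let $\mathbb K$ be an algebraically closed field with $\operatorname{char}\mathbb K\ne 2$. Let $\varphi\in\mathbb K$ be a primitive $m$-th root of unity ($m\geq 1$) and let $m_1,\dots,m_n\in\mathbb N$ be such that $$\prod_{j\in J}\varphi^{m_j}\neq\prod_{l\in L}\varphi^{m_l}\quad\text{for all disjoint } J,L\subseteq\{1,\dots,n\}\text{ not both empty},\qquad \varphi^{2m_i}\ne1\quad(1\le i\le n).$$ Let $\mathrm{Sp}(2n,\mathbb K)=\{A\mid A^tJA=J\}$ with $J=\begin{pmatrix}0&I_n\\-I_n&0\end{pmatrix}$, let $\xi=\mathrm{diag}(\varphi^{m_1},\dots,\varphi^{m_n},\varphi^{-m_1},\dots,\varphi^{-m_n})$, and let $T=\{\mathrm{diag}(\lambda_1,\dots,\lambda_n,\lambda_1^{-1},\dots,\lambda_n^{-1})\mid\lambda_i\in\mathbb K^\times\}$. The torus $T$ acts by simultaneous conjugation, $h\cdot X=h^{-1}Xh$, on the affine variety $$\mathcal U_n^\xi=\Big\{(A_1,B_1,\dots,A_g,B_g)\in\mathrm{Sp}(2n,\mathbb K)^{2g}\;\Big|\;\prod_{i=1}^g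 A_iB_iA_i^{-1}B_i^{-1}=\xi\Big\}.$$ Write $T_X$ for the stabiliser of $X$ in $T$, $\boldsymbol\mu_2^n=\{h\in T\mid h^2=1\}$ and $\boldsymbol Z=\{\pm I_{2n}\}$. For a subgroup $\boldsymbol Z\le H\le\boldsymbol\mu_2^n$ let $\mathcal U_{n,H}^\xi=\{X\in\mathcal U_n^\xi\mid H\subseteq T_X\}$, a closed $T$-stable subvariety, and put $$\mathcal M_n^\xi=\operatorname{Spec}\big(\mathbb K[\mathcal U_n^\xi]^T\big),\qquad \mathcal M_{n,H}^\xi=\operatorname{Spec}\big(\mathbb K[\mathcal U_{n,H}^\xi]^T\big).$$ Then: 1. $T_X\le\boldsymbol\mu_2^n$ for every $X\in\mathcal U_n^\xi$. 2. For every subgroup $\boldsymbol Z\le H\le\boldsymbol\mu_2^n$, the morphism $\mathcal U_{n,H}^\xi\to\mathcal M_{n,H}^\xi$ induced by the inclusion of the invariants is a geometric quotient for the action of $T$, that is, a good quotient (an affine, surjective, $T$-invariant morphism $\pi$ such that $\mathcal O(W)\to\mathcal O(\pi^{-1}(W))^T$ is an isomorphism for every open $W$, and such that images of closed $T$-stable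 subsets are closed and images of disjoint closed $T$-stable subsets are disjoint) for which the preimage of each point is a single $T$-orbit (points being closed points). 3. Each connected component and each irreducible component of $\mathcal M_n^\xi$ has dimension $(2g-1)n(2n+1)-n$. If $g\ge1$, then $\mathcal M_n^\xi$ is non-empty and has this dimension. (For $g=0$ it is empty.) -/

import Mathlib

universe u

namespace SpCharVar

open CategoryTheory AlgebraicGeometry

noncomputable section

/-! ### The symplectic group, its diagonal torus and some subgroups -/

/-- `Sp(2n, K)`, the group of matrices `A` with `Aᵗ J A = J` (equivalently `A J Aᵗ = J`). -/
abbrev Sp (n : ℕ) (K : Type u) [Field K] : Type u := Matrix.symplecticGroup (Fin n) K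

variable {n g : ℕ} {K : Type u} [Field K]

/-- The matrix `diag(l₁, …, lₙ, l₁⁻¹, …, lₙ⁻¹)` as an element of `Sp(2n, K)`. -/
def diagSp : (Fin n → Kˣ) →* Sp n K where
  toFun l := ⟨Matrix.diagonal
      (Sum.elim (fun i => (l i : K)) (fun i => ((l i)⁻¹ : Kˣ))), by
    rw [SymplecticGroup.mem_iff, Matrix.J, Matrix.diagonal_transpose]
    ext i j
    rcases i with i | i <;> rcases j with j | j <;>
      simp [Matrix.mul_diagonal, Matrix.diagonal_mul, Matrix.one_apply] <;>
      split_ifs with h <;> simp [h]⟩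
  map_one' := by
    apply Subtype.ext
    ext i j
    rcases i with i | i <;> rcases j with j | j <;>
      simp [Matrix.diagonal_apply, Matrix.one_apply]
  map_mul' l k := by
    apply Subtype.ext
    change Matrix.diagonal _ = Matrix.diagonal _ * Matrix.diagonal _
    rw [Matrix.diagonal_mul_diagonal]
    congr 1
    ext i
    rcases i with i | i <;> simp [mul_comm]

variable (n K) in
/-- The maximal torus `T` of `Sp(2n, K)` consisting of the matrices
`diag(l₁, …, lₙ, l₁⁻¹, …, lₙ⁻¹)`. -/
def torus : Subgroup (Sp n K) := (diagSp (n := n) (K := K)).range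

theorem torus_comm (s t : torus n K) : s * t = t * s := by
  obtain ⟨_, l, rfl⟩ := s
  obtain ⟨_, k, rfl⟩ := t
  apply Subtype.ext
  change diagSp l * diagSp k = diagSp k * diagSp l
  rw [← map_mul, ← map_mul, mul_comm]

variable (n K) in
/-- `μ₂ⁿ`, the subgroup of the involutions (`h ^ 2 = 1`) of the torus. -/
def mu2 : Subgroup (torus n K) where
  carrier := {h | h ^ 2 = 1}
  one_mem' := one_pow 2
  mul_mem' {a b} ha hb := by
    have h : (a * b) ^ 2 = a ^ 2 * b ^ 2 := (show Commute a b from torus_comm a b).mul_pow 2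
    rw [Set.mem_ofPred_eq] at *
    rw [h, ha, hb, one_mul]
  inv_mem' {a} ha := by
    rw [Set.mem_ofPred_eq] at *
    rw [inv_pow, ha, inv_one]

variable (n K) in
/-- The subgroup `Z = {± I}` of the torus (the centre of `Sp(2n, K)`). -/
def centre : Subgroup (torus n K) where
  carrier := {h | (h.1 : Matrix (Fin n ⊕ Fin n) (Fin n ⊕ Fin n) K) = 1 ∨
    (h.1 : Matrix (Fin n ⊕ Fin n) (Fin n ⊕ Fin n) K) = -1}
  one_mem' := Or.inl rfl
  mul_mem' {a b} ha hb := by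
    have h : ((a * b).1 : Matrix (Fin n ⊕ Fin n) (Fin n ⊕ Fin n) K) = a.1 * b.1 := rfl
    rw [Set.mem_ofPred_eq, h]
    rcases ha with ha | ha <;> rcases hb with hb | hb <;> simp [ha, hb]
  inv_mem' {a} ha := by
    have h : ((a⁻¹ * a).1 : Matrix (Fin n ⊕ Fin n) (Fin n ⊕ Fin n) K) = 1 := by
      rw [inv_mul_cancel]; rfl
    have h' : ((a⁻¹ * a).1 : Matrix (Fin n ⊕ Fin n) (Fin n ⊕ Fin n) K) = a⁻¹.1 * a.1 := rfl
    rw [h'] at h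
    rcases ha with ha | ha
    · left; rw [ha, mul_one] at h; exact h
    · right; rw [ha, mul_neg, mul_one] at h; exact neg_eq_iff_eq_neg.mp h

/-! ### The representation varieties and the action of the torus -/

/-- A tuple `(A₁, B₁, …, A_g, B_g)` of elements of `Sp(2n, K)`. -/
@[ext]
structure SpTuple (g n : ℕ) (K : Type u) [Field K] : Type u where
  A : Fin g → Sp n K
  B : Fin g → Sp n K

/-- The action `h • (A₁, B₁, …) = (h⁻¹ A₁ h, h⁻¹ B₁ h, …)` of the (commutative) torus. -/
instance : MulAction (torus n K) (SpTuple g n K) where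
  smul h X := ⟨fun i => (h : Sp n K)⁻¹ * X.A i * h, fun i => (h : Sp n K)⁻¹ * X.B i * h⟩
  one_smul X := by
    apply SpTuple.ext <;> funext i
    · change (1 : Sp n K)⁻¹ * X.A i * 1 = X.A i
      simp
    · change (1 : Sp n K)⁻¹ * X.B i * 1 = X.B i
      simp
  mul_smul s t X := by
    rw [torus_comm s t]
    apply SpTuple.ext <;> funext i
    · change ((t : Sp n K) * s)⁻¹ * X.A i * (t * s) = (s : Sp n K)⁻¹ * ((t : Sp n K)⁻¹ * X.A i * t) * s
      group
    · change ((t : Sp n K) * s)⁻¹ * X.B i * (t * s) = (s : Sp n K)⁻¹ * ((t : Sp n K)⁻¹ * X.B i * t) * s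
      group

theorem smul_A (h : torus n K) (X : SpTuple g n K) (i : Fin g) :
    (h • X).A i = (h : Sp n K)⁻¹ * X.A i * h := rfl

theorem smul_B (h : torus n K) (X : SpTuple g n K) (i : Fin g) :
    (h • X).B i = (h : Sp n K)⁻¹ * X.B i * h := rfl

/-- The map `μ(A₁, B₁, …, A_g, B_g) = [A₁ : B₁] ⋯ [A_g : B_g]`, where
`[A : B] = A B A⁻¹ B⁻¹`. -/
def commProd (X : SpTuple g n K) : Sp n K :=
  (List.ofFn fun i => X.A i * X.B i * (X.A i)⁻¹ * (X.B i)⁻¹).prod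

theorem prod_comm_conj {G : Type*} [Group G] (h : G) (A B : Fin g → G) :
    (List.ofFn fun i => (h⁻¹ * A i * h) * (h⁻¹ * B i * h) * (h⁻¹ * A i * h)⁻¹ *
      (h⁻¹ * B i * h)⁻¹).prod =
    h⁻¹ * (List.ofFn fun i => A i * B i * (A i)⁻¹ * (B i)⁻¹).prod * h := by
  have key : ∀ x : G, h⁻¹ * x * h = MulAut.conj h⁻¹ x := by
    intro x; simp
  simp only [key]
  rw [map_list_prod, List.map_ofFn]
  congr 2
  funext i
  simp only [Function.comp, map_mul, map_inv]

theorem commProd_smul (h : torus n K) (X : SpTuple g n K) :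
    commProd (h • X) = (h : Sp n K)⁻¹ * commProd X * h :=
  prod_comm_conj (h : Sp n K) X.A X.B

/-- `U_n^ξ`: the tuples `X` with `μ(X) = ξ`, for `ξ = diag(a₁, …, aₙ, a₁⁻¹, …, aₙ⁻¹)`,
as a set which is stable under `T`. -/
def U (g : ℕ) (a : Fin n → Kˣ) : SubMulAction (torus n K) (SpTuple g n K) where
  carrier := {X | commProd X = diagSp a}
  smul_mem' h X hX := by
    rw [Set.mem_ofPred_eq] at *
    rw [commProd_smul, hX]
    have := congrArg Subtype.val (torus_comm ⟨diagSp a, a, rfl⟩ h)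
    change diagSp a * (h : Sp n K) = h * diagSp a at this
    rw [mul_assoc, this, inv_mul_cancel_left]

/-- `U_{n,H}^ξ`: the tuples `X` in `U_n^ξ` whose stabiliser `T_X` contains `H`. -/
def UH (g : ℕ) (a : Fin n → Kˣ) (H : Subgroup (torus n K)) :
    SubMulAction (torus n K) (SpTuple g n K) where
  carrier := {X | X ∈ U g a ∧ H ≤ MulAction.stabilizer (torus n K) X}
  smul_mem' h X hX := by
    refine ⟨(U g a).smul_mem h hX.1, fun k hk => ?_⟩
    have := hX.2 hk
    rw [MulAction.mem_stabilizer_iff] at this ⊢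
    rw [← mul_smul, torus_comm, mul_smul, this]

/-! ### Coordinate rings and quotients by the torus

The varieties at hand are closed subvarieties of the affine space of `2g`-tuples of matrices,
with their reduced structure, so their coordinate rings are the rings of those functions which
are given by polynomials in the matrix entries. -/

/-- The matrix entries, as functions on a set `V` of tuples. -/
def entries (V : Set (SpTuple g n K)) : Set (V → K) :=
  {f | ∃ i p q, f = fun X : V => ((X : SpTuple g n K).A i).1 p q} ∪
  {f | ∃ i p q, f = fun X : V => ((X : SpTuple g n K).B i).1 p q}

/-- The coordinate ring `K[V]`: the functions on `V` given by polynomials with coefficients in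
`K` in the entries of the matrices `A₁, B₁, …, A_g, B_g`. -/
def coordRing (V : Set (SpTuple g n K)) : Subalgebra K (V → K) :=
  Algebra.adjoin K (entries V)

variable (V : SubMulAction (torus n K) (SpTuple g n K))

/-- Precomposition of a function with the action of an element of the torus. -/
def precomp (h : torus n K) : (V → K) →ₐ[K] (V → K) where
  toFun f X := f (h • X)
  map_one' := rfl
  map_mul' _ _ := rfl
  map_zero' := rfl
  map_add' _ _ := rfl
  commutes' _ := rfl

theorem entry_conj_mem {R : Type*} (S : Subalgebra K (R → K)) (h : Sp n K) (M : R → Sp n K)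
    (hM : ∀ p q, (fun X => (M X).1 p q) ∈ S) (p q) :
    (fun X => (h⁻¹ * M X * h).1 p q) ∈ S := by
  have : (fun X => (h⁻¹ * M X * h).1 p q) =
      ∑ s, ∑ r, ((h⁻¹).1 p r * h.1 s q) • (fun X => (M X).1 r s) := by
    funext X
    change (((h⁻¹).1 * (M X).1) * h.1) p q = _
    simp only [Matrix.mul_apply, Finset.sum_apply, Pi.smul_apply, smul_eq_mul, Finset.sum_mul]
    refine Finset.sum_congr rfl fun s _ => Finset.sum_congr rfl fun r _ => by ring
  rw [this]
  exact Subalgebra.sum_mem _ fun s _ => Subalgebra.sum_mem _ fun r _ => S.smul_mem (hM r s) _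

theorem precomp_mem (h : torus n K) {f : V → K} (hf : f ∈ coordRing (V : Set (SpTuple g n K))) :
    precomp V h f ∈ coordRing (V : Set (SpTuple g n K)) := by
  have : coordRing (V : Set (SpTuple g n K)) ≤
      (coordRing (V : Set (SpTuple g n K))).comap (precomp V h) := by
    refine Algebra.adjoin_le ?_
    rintro f (⟨i, p, q, rfl⟩ | ⟨i, p, q, rfl⟩)
    · exact entry_conj_mem _ (h : Sp n K) (fun X : V => (X : SpTuple g n K).A i)
        (fun p q => Algebra.subset_adjoin (Or.inl ⟨i, p, q, rfl⟩)) p q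
    · exact entry_conj_mem _ (h : Sp n K) (fun X : V => (X : SpTuple g n K).B i)
        (fun p q => Algebra.subset_adjoin (Or.inr ⟨i, p, q, rfl⟩)) p q
  exact this hf

/-- The action `(h • f)(X) = f(h⁻¹ • X)` of the torus on the coordinate ring of `V`. -/
instance : MulSemiringAction (torus n K) (coordRing (V : Set (SpTuple g n K))) where
  smul h f := ⟨precomp V h⁻¹ f.1, precomp_mem V h⁻¹ f.2⟩
  one_smul f := by
    apply Subtype.ext; funext X
    change f.1 ((1 : torus n K)⁻¹ • X) = f.1 X
    rw [inv_one, one_smul]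
  mul_smul s t f := by
    apply Subtype.ext; funext X
    change f.1 ((s * t)⁻¹ • X) = f.1 (t⁻¹ • s⁻¹ • X)
    rw [mul_inv_rev, mul_smul]
  smul_zero _ := rfl
  smul_add _ _ _ := rfl
  smul_one _ := rfl
  smul_mul _ _ _ := rfl

theorem coe_smul_apply (h : torus n K) (f : coordRing (V : Set (SpTuple g n K))) (X : V) :
    (h • f).1 X = f.1 (h⁻¹ • X) := rfl

/-- The ring of invariants `K[V]^T`. -/
def invariants : Subalgebra K (coordRing (V : Set (SpTuple g n K))) where
  carrier := {f | ∀ h : torus n K, h • f = f}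
  mul_mem' {f₁ f₂} h₁ h₂ h := by rw [smul_mul', h₁ h, h₂ h]
  add_mem' {f₁ f₂} h₁ h₂ h := by rw [smul_add, h₁ h, h₂ h]
  algebraMap_mem' _ _ := rfl

/-- The affine variety `V`, as the scheme `Spec K[V]`. -/
abbrev affineVar : Scheme.{u} := Spec (CommRingCat.of (coordRing (V : Set (SpTuple g n K))))

/-- The quotient `V // T = Spec (K[V]^T)`. -/
abbrev quot : Scheme.{u} := Spec (CommRingCat.of (invariants V))

/-- The morphism `V ⟶ V // T` given by the inclusion `K[V]^T ⊆ K[V]`. -/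
abbrev quotMap : affineVar V ⟶ quot V :=
  Spec.map (CommRingCat.ofHom (algebraMap (invariants V) (coordRing (V : Set (SpTuple g n K)))))

/-- The action of a group `G` on `Spec A` induced by an action of `G` on the ring `A`:
the element `x` acts through `f ↦ x⁻¹ • f` on functions. -/
def specAction (G A : Type u) [Group G] [CommRing A] [MulSemiringAction G A] :
    G →* End (Spec (CommRingCat.of A)) where
  toFun x := Spec.map (CommRingCat.ofHom (MulSemiringAction.toRingHom G A x⁻¹))
  map_one' := by
    have : MulSemiringAction.toRingHom G A (1 : G)⁻¹ = RingHom.id A := by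
      ext a; simp
    rw [this]
    exact Spec.map_id _
  map_mul' x y := by
    rw [End.mul_def, ← Spec.map_comp, ← CommRingCat.ofHom_comp]
    congr 2
    ext a
    simp [mul_smul]

/-- The action of the torus on the scheme `V`. -/
abbrev torusAction : torus n K →* End (affineVar V) :=
  specAction (torus n K) (coordRing (V : Set (SpTuple g n K)))

end

/-! ### Geometric quotients -/

theorem preimage_le_of_invariant {X Y : Scheme.{u}} {π : X ⟶ Y} {f : X ⟶ X} (h : f ≫ π = π)
    (W : Y.Opens) : π ⁻¹ᵁ W ≤ f ⁻¹ᵁ (π ⁻¹ᵁ W) := by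
  rw [← Scheme.Hom.comp_preimage, h]

/-- `π : X ⟶ Y` is a good quotient for the action `ρ` of the group `G` on `X`. (Used for the
group of points of an algebraic group acting on a variety over an algebraically closed field.) -/
structure IsGoodQuotient {G : Type u} [Group G] {X Y : Scheme.{u}} (ρ : G →* End X)
    (π : X ⟶ Y) : Prop where
  /-- `π` is constant on orbits. -/
  invariant (t : G) : (ρ t).asHom ≫ π = π
  surjective : Function.Surjective π
  /-- `𝒪_Y(W) → 𝒪_X(π⁻¹ W)` is an isomorphism onto the invariant functions. -/
  injective_app (W : Y.Opens) : Function.Injective (π.app W)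
  range_app (W : Y.Opens) : Set.range (π.app W) =
    {s : Γ(X, π ⁻¹ᵁ W) | ∀ t : G, (ρ t).asHom.appLE (π ⁻¹ᵁ W) (π ⁻¹ᵁ W)
      (preimage_le_of_invariant (invariant t) W) s = s}
  /-- The image of a closed invariant subset is closed. -/
  isClosed_image (C : Set X) (hC : IsClosed C) (hinv : ∀ t : G, Set.MapsTo (ρ t).asHom C C) :
    IsClosed (π '' C)
  /-- The images of disjoint closed invariant subsets are disjoint. -/
  disjoint_image (C D : Set X) (hC : IsClosed C) (hD : IsClosed D)
    (hCinv : ∀ t : G, Set.MapsTo (ρ t).asHom C C)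
    (hDinv : ∀ t : G, Set.MapsTo (ρ t).asHom D D) (hCD : Disjoint C D) :
    Disjoint (π '' C) (π '' D)
  isAffineHom : IsAffineHom π

/-- `π : X ⟶ Y` is a geometric quotient: a good quotient such that the preimage of each point is
a single orbit. Points are meant as in the theory of varieties over an algebraically closed field,
that is, they are the closed points of the schemes. -/
structure IsGeometricQuotient {G : Type u} [Group G] {X Y : Scheme.{u}} (ρ : G →* End X)
    (π : X ⟶ Y) : Prop extends IsGoodQuotient ρ π where
  fiber_eq_orbit (y : Y) (hy : IsClosed {y}) : ∃ x : X,
    {x' : X | IsClosed {x'} ∧ π x' = y} = Set.range fun t : G => (ρ t).asHom x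

/-! ### Dimension -/

/-- The topological space `S` is of (Krull) dimension `d`; in particular `S` is non-empty
and `0 ≤ d`. -/
def HasDim (S : Type u) [TopologicalSpace S] (d : ℤ) : Prop :=
  ∃ k : ℕ, (k : ℤ) = d ∧ topologicalKrullDim S = k

end SpCharVar

namespace SpCharVar

open CategoryTheory AlgebraicGeometry

/-! ### Dimension theory of finitely generated algebras -/

/-! Everything rests on one consequence of genericity. Suppose that all `A i`, `B i` preserve the
span of the row vectors `e_r`, `r ∈ R`. The determinant on this span kills commutators, so the
diagonal entries of `ξ` indexed by `R` have product 1, and genericity makes `R` stable under the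
swap of the two halves of the index set (`swap_mem_of_closed`). Draw an edge from `p` to `q` when
some matrix of the tuple has a non-zero entry there: reachability is then symmetric, and every index
is joined to its swap.

Stabilisers: the diagonal entries of an `h` fixing `X` agree along edges, hence agree with their
inverses.

Quotient: the coordinate ring is the sum of its weight spaces, and projection to weight 0 is a
Reynolds operator, which yields a good quotient (`isGoodQuotient_specMap`). If two points have the
same invariants, the ratio of their values on functions of weight `w` is a character on the group of
those `w` for which functions of weights `w` and `-w` are non-zero at the point. It extends to all
weights because the group of units of `K` is divisible, and so comes from the torus. Symmetry of
reachability puts the weight of every non-zero entry into this group, so the points are conjugate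
(`exists_smul_eq_of_same_invariants`).

Dimension: for `g ≥ 1` all components of `U` have dimension `(2g-1)n(2n+1)`. The lower bound is
Krull's height theorem. Writing `μ(X) = ξ` entry by entry would take too many equations; instead one
asks that `S = ξ⁻¹ μ(X)` be an involution, which takes only `n(2n+1)` equations, and the solutions
with `S = 1` are split off by the condition `det(1 + S) ≠ 0`, as `2 ≠ 0`. The upper bound is the
tangent space: the differential of the commutator product is surjective at each `X`
(`dCommP_surjective`), since a linear form killing its image is given by an element of the
symplectic Lie algebra commuting with the whole tuple; this element is diagonal, constant along
edges and odd under the swap, hence zero. The quotient loses exactly `n` dimensions, because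
functions of weights `± 2 eᵢ` not vanishing at a given point exist along the paths from `i` to its
swap (`trdeg_quotient_le`, `exists_prime_le_trdeg`). -/

theorem ringKrullDim_eq_of_isIntegral {R S : Type*} [CommRing R] [CommRing S] [Algebra R S]
    [Algebra.IsIntegral R S] (hinj : Function.Injective (algebraMap R S)) :
    ringKrullDim S = ringKrullDim R := by
  apply le_antisymm
  · exact Order.krullDim_le_of_strictMono (PrimeSpectrum.comap (algebraMap R S))
      fun I J h => Ideal.IsIntegral.comap_lt_comap h
  · refine iSup_le fun l => ?_
    -- Lying over for the bottom of the chain, then going up along the chain.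
    obtain ⟨P, -, hP, hPl⟩ := Ideal.exists_ideal_over_prime_of_isIntegral l.head.asIdeal (⊥ : Ideal S)
      (by
        intro x hx
        have : x = 0 := hinj (by simpa using hx)
        rw [this]; exact zero_mem _)
    have : P.LiesOver l.head.asIdeal := ⟨hPl.symm⟩
    obtain ⟨L, hL, -⟩ := Ideal.exists_ltSeries_of_hasGoingUp l P
    rw [← hL]
    exact le_iSup (fun l : LTSeries (PrimeSpectrum S) => (l.length : WithBot ℕ∞)) L

/-- Noether normalisation: an injective integral extension changes neither invariant. This
translates between Krull dimension, which appears in the theorem, and transcendence degree, which is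
additive in towers. -/
theorem exists_ringKrullDim_eq_trdeg (k A : Type u) [Field k] [CommRing A] [IsDomain A]
    [Algebra k A] [Algebra.FiniteType k A] :
    ∃ s : ℕ, ringKrullDim A = s ∧ Algebra.trdeg k A = s := by
  obtain ⟨s, φ, hφ, hφi⟩ := exists_integral_inj_algHom_of_fg k A
  algebraize [φ.toRingHom]
  have hinj : Function.Injective (algebraMap (MvPolynomial (Fin s) k) A) := hφ
  have hint : Algebra.IsIntegral (MvPolynomial (Fin s) k) A := ⟨hφi⟩
  have hf : FaithfulSMul (MvPolynomial (Fin s) k) A := (faithfulSMul_iff_algebraMap_injective _ _).2 hinj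
  refine ⟨s, ?_, ?_⟩
  · rw [ringKrullDim_eq_of_isIntegral hinj, MvPolynomial.ringKrullDim_of_isNoetherianRing,
      ringKrullDim_eq_zero_of_field]
    simp
  · rw [← trdeg_add_eq k (S := MvPolynomial (Fin s) k) (A := A), MvPolynomial.trdeg_of_isDomain,
      trdeg_eq_zero]
    simp

/-- Let `p` be the contraction of `P`. Either `P` is extended from `p`, and the quotient `(R ⧸
p)[X]` has one more transcendental while the height does not drop, by going down; or `P` is strictly
larger and its height grows by at least one. The natural number `h` mediates between heights in `ℕ∞`
and cardinals. -/
theorem height_add_trdeg_polynomial {k R : Type u} [Field k] [CommRing R] [IsNoetherianRing R]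
    [Algebra k R] (N : Cardinal.{u})
    (hR : ∀ p : Ideal R, p.IsPrime → ∃ h : ℕ, (h : ℕ∞) ≤ p.height ∧ N ≤ h + Algebra.trdeg k (R ⧸ p))
    (P : Ideal (Polynomial R)) [hP : P.IsPrime] :
    ∃ h : ℕ, (h : ℕ∞) ≤ P.height ∧ N + 1 ≤ h + Algebra.trdeg k (Polynomial R ⧸ P) := by
  set p : Ideal R := P.comap Polynomial.C with hp
  have hpp : p.IsPrime := inferInstance
  obtain ⟨h, hh, hN⟩ := hR p hpp
  have hle : p.map Polynomial.C ≤ P := Ideal.map_comap_le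
  have hprime : (p.map Polynomial.C).IsPrime := Ideal.isPrime_map_C_of_isPrime
  have hover : (p.map Polynomial.C).LiesOver p := ⟨by
    change p = Ideal.comap Polynomial.C _
    refine le_antisymm Ideal.le_comap_map fun x hx => ?_
    simpa using (Ideal.mem_map_C_iff.1 (Ideal.mem_comap.1 hx)) 0⟩
  have hht : (h : ℕ∞) ≤ (p.map Polynomial.C).height := by
    rw [Ideal.height_eq_height_add_of_liesOver_of_hasGoingDown p (p.map Polynomial.C)]
    exact hh.trans le_self_add
  by_cases hPp : P = p.map Polynomial.C
  · refine ⟨h, hPp ▸ hht, ?_⟩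
    let e₀ : (Polynomial (R ⧸ p)) ≃+* (Polynomial R ⧸ p.map Polynomial.C) :=
      Ideal.polynomialQuotientEquivQuotientPolynomial p
    let e : (Polynomial (R ⧸ p)) ≃ₐ[k] (Polynomial R ⧸ p.map Polynomial.C) :=
      AlgEquiv.ofRingEquiv (f := e₀) (fun x => by
        change e₀ (Polynomial.C (Ideal.Quotient.mk p (algebraMap k R x))) = _
        have := Ideal.polynomialQuotientEquivQuotientPolynomial_map_mk p
          (Polynomial.C (algebraMap k R x))
        rw [Polynomial.map_C] at this
        exact this)
    rw [hPp, ← e.trdeg_eq, ← trdeg_add_eq k (S := R ⧸ p) (A := Polynomial (R ⧸ p)),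
      Polynomial.trdeg_of_isDomain, ← add_assoc]
    gcongr
  · have hlt : p.map Polynomial.C < P := lt_of_le_of_ne hle (Ne.symm hPp)
    refine ⟨h + 1, ?_, ?_⟩
    · push_cast
      exact (add_le_add_left hht 1).trans (Ideal.height_add_one_le_of_lt_of_isPrime hlt)
    · let f : (R ⧸ p) →ₐ[k] (Polynomial R ⧸ P) :=
        Ideal.quotientMapₐ P (IsScalarTower.toAlgHom k R (Polynomial R)) le_rfl
      have hf : Function.Injective f := Ideal.quotientMap_injective
      have := trdeg_le_of_injective f hf
      push_cast
      rw [add_right_comm]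
      gcongr
      exact hN.trans (by gcongr)

/-- The half of the dimension formula for affine space that is needed: Krull's height theorem bounds
the height from above, so this bounds the transcendence degree from below. -/
theorem exists_nat_le_height_add_trdeg {k : Type u} [Field k] (N : ℕ)
    (P : Ideal (MvPolynomial (Fin N) k)) [hP : P.IsPrime] :
    ∃ h : ℕ, (h : ℕ∞) ≤ P.height ∧
      (N : Cardinal) ≤ h + Algebra.trdeg k (MvPolynomial (Fin N) k ⧸ P) := by
  induction N with
  | zero => exact ⟨0, by simp, by simp⟩
  | succ N ih =>
    let e := MvPolynomial.finSuccEquiv k N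
    set Q : Ideal (Polynomial (MvPolynomial (Fin N) k)) := P.comap e.symm with hQ
    have hQp : Q.IsPrime := inferInstance
    obtain ⟨h, h1, h2⟩ := height_add_trdeg_polynomial (k := k) (R := MvPolynomial (Fin N) k) N
      (fun p hp => ih p) Q
    refine ⟨h, ?_, ?_⟩
    · have : Q.height = P.height := RingEquiv.height_comap e.symm.toRingEquiv P
      rwa [this] at h1
    · let e' : (Polynomial (MvPolynomial (Fin N) k) ⧸ Q) ≃ₐ[k] (MvPolynomial (Fin (N + 1)) k ⧸ P) :=
        Ideal.quotientEquivAlg Q P e.symm (by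
          rw [hQ]; exact (Ideal.map_comap_of_surjective _ e.symm.surjective P).symm)
      rw [← AlgEquiv.trdeg_eq (A := Polynomial (MvPolynomial (Fin N) k) ⧸ Q) e']
      exact_mod_cast h2

/-- In the affine space of dimension `N`, the quotient by a prime `P` which is minimal over an ideal
with `r` generators has transcendence degree at least `N - r`. -/
theorem card_le_add_trdeg_of_mem_minimalPrimes {k : Type u} [Field k] {σ ι : Type*} [Finite σ]
    [Finite ι] {f : ι → MvPolynomial σ k} {A : Type u} [CommRing A] [Algebra k A]
    (φ : MvPolynomial σ k →ₐ[k] A) (hφ : Function.Surjective φ)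
    (hP : RingHom.ker φ ∈ (Ideal.span (Set.range f)).minimalPrimes) :
    (Nat.card σ : Cardinal) ≤ Nat.card ι + Algebra.trdeg k A := by
  let e := MvPolynomial.renameEquiv k (Finite.equivFin σ)
  let ψ : MvPolynomial (Fin (Nat.card σ)) k →ₐ[k] A := φ.comp e.symm
  have hψ : Function.Surjective ψ := hφ.comp e.symm.surjective
  have hφp : (RingHom.ker φ).IsPrime := hP.1.1
  have hker : RingHom.ker ψ = (RingHom.ker φ).comap e.symm := rfl
  have hψp : (RingHom.ker ψ).IsPrime := by rw [hker]; infer_instance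
  obtain ⟨h, h1, h2⟩ := exists_nat_le_height_add_trdeg (k := k) _ (RingHom.ker ψ)
  have hht : (RingHom.ker ψ).height = (RingHom.ker φ).height :=
    RingEquiv.height_comap e.symm.toRingEquiv (RingHom.ker φ)
  have h3 : (h : ℕ∞) ≤ Nat.card ι := by
    refine (h1.trans_eq hht).trans
      ((Ideal.height_le_card_of_mem_minimalPrimes_span (Set.finite_range f) hP).trans ?_)
    exact_mod_cast Finite.card_range_le f
  have h4 := (Ideal.quotientKerAlgEquivOfSurjective hψ).trdeg_eq
  rw [← h4]
  refine h2.trans ?_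
  gcongr
  exact_mod_cast h3

/-- Nakayama without localising: with `I` generated by the `f i`, some `r ≡ 1` modulo `m` kills `m /
I`. A prime between `I` and `m` does not contain `r`, so it contains `m`. Thus `m` is minimal over
`I`, and Krull's height theorem applies. -/
theorem height_le_of_le_sup_sq {A ι : Type*} [CommRing A] [IsNoetherianRing A] [Finite ι]
    (m : Ideal A) [hm : m.IsPrime] (f : ι → A) (hf : ∀ i, f i ∈ m)
    (hs : m ≤ Ideal.span (Set.range f) ⊔ m ^ 2) : m.height ≤ Nat.card ι := by
  have hle : Ideal.span (Set.range f) ≤ m := Ideal.span_le.2 (by rintro _ ⟨i, rfl⟩; exact hf i)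
  suffices h : m ∈ (Ideal.span (Set.range f)).minimalPrimes by
    refine (Ideal.height_le_card_of_mem_minimalPrimes_span (Set.finite_range f) h).trans ?_
    exact_mod_cast Finite.card_range_le f
  set I := Ideal.span (Set.range f)
  obtain ⟨r, hr, hr'⟩ := Submodule.exists_sub_one_mem_and_smul_eq_zero_of_fg_of_le_smul m
    (Submodule.map (Submodule.mkQ I) m) (Submodule.FG.map _ (IsNoetherian.noetherian m)) (by
      have h1 := Submodule.map_mono (f := Submodule.mkQ I) hs
      rwa [Submodule.map_sup, Submodule.mkQ_map_self, bot_sup_eq, pow_two, ← smul_eq_mul,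
        Submodule.map_smul''] at h1)
  refine ⟨⟨hm, hle⟩, fun q ⟨hq, hIq⟩ hqm x hx => ?_⟩
  have hrx : r * x ∈ I := by
    have := hr' (Submodule.mkQ I x) (Submodule.mem_map_of_mem hx)
    rw [← map_smul] at this
    exact (Submodule.Quotient.mk_eq_zero I).1 this
  refine ((hq.mem_or_mem (hIq hrx)).resolve_left fun hrq => ?_)
  exact hm.ne_top ((Ideal.eq_top_iff_one _).2 (by simpa using sub_mem (hqm hrq) hr))

/-- Lifts to `m` of a `k`-basis of `m / m²` satisfy the hypothesis of the preceding lemma. -/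
theorem height_le_finrank_cotangent {k A : Type*} [Field k] [CommRing A] [IsNoetherianRing A]
    [Algebra k A] (m : Ideal A) [hm : m.IsPrime] [Module.Finite k m.Cotangent] :
    m.height ≤ Module.finrank k m.Cotangent := by
  let b := Module.finBasis k m.Cotangent
  choose f hf using fun i => m.toCotangent_surjective (b i)
  have := height_le_of_le_sup_sq m (fun i => (f i : A)) (fun i => (f i).2) ?_
  · simpa using this
  intro x hx
  have hb := b.sum_repr (m.toCotangent ⟨x, hx⟩)
  rw [Submodule.mem_sup]
  refine ⟨∑ i, algebraMap k A (b.repr (m.toCotangent ⟨x, hx⟩) i) * f i, ?_,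
    x - ∑ i, algebraMap k A (b.repr (m.toCotangent ⟨x, hx⟩) i) * f i, ?_, by ring⟩
  · exact Ideal.sum_mem _ fun i _ => Ideal.mul_mem_left _ _ (Ideal.subset_span ⟨i, rfl⟩)
  · have : m.toCotangent ⟨x, hx⟩ =
        m.toCotangent (∑ i, algebraMap k A (b.repr (m.toCotangent ⟨x, hx⟩) i) • f i) := by
      conv_lhs => rw [← hb]
      rw [map_sum]
      refine Finset.sum_congr rfl fun i _ => ?_
      rw [map_smul, hf, algebraMap_smul]
    rw [Ideal.toCotangent_eq] at this
    simpa [Algebra.smul_def] using this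

theorem ringKrullDim_le_of_minimalPrimes {R : Type*} [CommRing R] (d : ℕ)
    (h : ∀ q ∈ minimalPrimes R, ringKrullDim (R ⧸ q) ≤ d) : ringKrullDim R ≤ d := by
  refine iSup_le fun l => ?_
  obtain ⟨q, hq, hql⟩ := Ideal.exists_minimalPrimes_le (I := ⊥) (J := l.head.asIdeal) bot_le
  refine le_trans ?_ (h q hq)
  rw [ringKrullDim_quotient]
  let L : LTSeries (PrimeSpectrum.zeroLocus (R := R) q) :=
    { length := l.length
      toFun := fun i => ⟨l i, hql.trans (LTSeries.head_le l i)⟩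
      step := fun i => l.step i }
  exact le_iSup (fun l : LTSeries (PrimeSpectrum.zeroLocus (R := R) q) => (l.length : WithBot ℕ∞)) L

theorem topologicalKrullDim_zeroLocus {R : Type*} [CommRing R] (I : Ideal R) :
    topologicalKrullDim (PrimeSpectrum.zeroLocus (I : Set R)) = ringKrullDim (R ⧸ I) := by
  have hs : Function.Surjective (Ideal.Quotient.mk I) := Ideal.Quotient.mk_surjective
  have hr : Set.range (PrimeSpectrum.comap (Ideal.Quotient.mk I)) = PrimeSpectrum.zeroLocus I := by
    rw [range_comap_of_surjective _ _ hs, Ideal.mk_ker]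
  have e := (PrimeSpectrum.isEmbedding_comap_of_surjective _ _ hs).toHomeomorph
  rw [← PrimeSpectrum.topologicalKrullDim_eq_ringKrullDim, ← hr]
  exact (IsHomeomorph.topologicalKrullDim_eq _ e.isHomeomorph).symm

/-- `Y` lies between a component of dimension `d` and the whole spectrum, whose dimension is bounded
through the minimal primes. This serves both connected and irreducible components. -/
theorem hasDim_of_subset {R : Type u} [CommRing R] (d : ℕ)
    (h : ∀ q ∈ minimalPrimes R, ringKrullDim (R ⧸ q) = d) (Y C : Set (PrimeSpectrum R))
    (hC : C ∈ irreducibleComponents (PrimeSpectrum R)) (hCY : C ⊆ Y) : HasDim Y d := by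
  refine ⟨d, rfl, le_antisymm ?_ ?_⟩
  · refine (topologicalKrullDim_subspace_le _ Y).trans ?_
    rw [PrimeSpectrum.topologicalKrullDim_eq_ringKrullDim]
    exact ringKrullDim_le_of_minimalPrimes d fun q hq => (h q hq).le
  · rw [← PrimeSpectrum.zeroLocus_minimalPrimes] at hC
    obtain ⟨q, hq, rfl⟩ := hC
    rw [← h q hq, ← topologicalKrullDim_zeroLocus]
    exact (Topology.IsInducing.topologicalKrullDim_le (f := Set.inclusion hCY)
      (Topology.IsEmbedding.inclusion hCY).isInducing)

theorem hasDim_primeSpectrum {R : Type u} [CommRing R] [Nontrivial R] (d : ℕ)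
    (h : ∀ q ∈ minimalPrimes R, ringKrullDim (R ⧸ q) = d) : HasDim (PrimeSpectrum R) d := by
  obtain ⟨q, hq⟩ := Ideal.nonempty_minimalPrimes (I := (⊥ : Ideal R)) bot_ne_top
  refine ⟨d, rfl, ?_⟩
  rw [PrimeSpectrum.topologicalKrullDim_eq_ringKrullDim]
  refine le_antisymm (ringKrullDim_le_of_minimalPrimes d fun q hq => (h q hq).le) ?_
  rw [← h q hq]
  exact ringKrullDim_quotient_le q

/-! ### Good quotients of affine schemes -/

section Sections

open TopologicalSpace Opposite PrimeSpectrum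

noncomputable section

/-- The sections of the structure sheaf of `Spec A`. -/
def Sec (A : Type u) [CommRing A] (U : Opens (PrimeSpectrum A)) : Type u :=
  (Spec.structureSheaf A).1.obj (op U)

variable {A : Type u} [CommRing A]

instance (U : Opens (PrimeSpectrum A)) : CommRing (Sec A U) :=
  inferInstanceAs (CommRing ((Spec.structureSheaf A).1.obj (op U)))

instance (U : Opens (PrimeSpectrum A)) : Algebra A (Sec A U) :=
  StructureSheaf.openAlgebra A (op U)

instance (f : A) : IsLocalization.Away f (Sec A (basicOpen f)) :=
  StructureSheaf.IsLocalization.to_basicOpen A f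

/-- Restriction of sections of the structure sheaf. -/
def secRes {U V : Opens (PrimeSpectrum A)} (h : V ≤ U) : Sec A U →+* Sec A V :=
  ((Spec.structureSheaf A).1.map (homOfLE h).op).hom

theorem sec_exists_of_eq_basicOpen {f : A} {V : Opens (PrimeSpectrum A)} (hV : V = basicOpen f)
    (s : Sec A V) : ∃ (k : ℕ) (a : A), algebraMap A _ (f ^ k) * s = algebraMap A _ a := by
  subst hV
  obtain ⟨⟨a, ⟨_, k, rfl⟩⟩, h⟩ := IsLocalization.surj (Submonoid.powers f) s
  exact ⟨k, a, by rw [mul_comm]; exact h⟩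

theorem sec_algebraMap_eq_zero {f : A} {V : Opens (PrimeSpectrum A)} (hV : V = basicOpen f)
    {a : A} (ha : algebraMap A (Sec A V) a = 0) : ∃ k : ℕ, f ^ k * a = 0 := by
  subst hV
  obtain ⟨⟨_, k, rfl⟩, h⟩ := (IsLocalization.map_eq_zero_iff (Submonoid.powers f) _ a).1 ha
  exact ⟨k, h⟩

theorem sec_isUnit {f : A} {V : Opens (PrimeSpectrum A)} (hV : V = basicOpen f) :
    IsUnit (algebraMap A (Sec A V) f) := by
  subst hV
  exact IsLocalization.Away.algebraMap_isUnit f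

theorem sec_eq_of_locally_eq {W : Opens (PrimeSpectrum A)} {ι : Type u}
    (U : ι → Opens (PrimeSpectrum A)) (hU : ∀ i, U i ≤ W) (hW : W ≤ iSup U) (s t : Sec A W)
    (h : ∀ i, secRes (hU i) s = secRes (hU i) t) : s = t :=
  (Spec.structureSheaf A).eq_of_locally_eq' U W (fun i => homOfLE (hU i)) hW s t h

theorem sec_exists_gluing {W : Opens (PrimeSpectrum A)} {ι : Type u}
    (U : ι → Opens (PrimeSpectrum A)) (hU : ∀ i, U i ≤ W) (hW : W ≤ iSup U)
    (s : ∀ i, Sec A (U i))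
    (h : ∀ i j, secRes (inf_le_left : U i ⊓ U j ≤ U i) (s i) = secRes inf_le_right (s j)) :
    ∃ t : Sec A W, ∀ i, secRes (hU i) t = s i :=
  ((Spec.structureSheaf A).existsUnique_gluing' U W (fun i => homOfLE (hU i)) hW s h).exists

theorem le_iSup_basicOpen (W : Opens (PrimeSpectrum A)) :
    W ≤ ⨆ f : {f : A // basicOpen f ≤ W}, basicOpen f.1 := by
  intro x hx
  obtain ⟨_, ⟨f, rfl⟩, hxf, hfW⟩ := isTopologicalBasis_basic_opens.exists_subset_of_mem_open hx W.2
  exact Opens.mem_iSup.2 ⟨⟨f, hfW⟩, hxf⟩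

variable {R : Type u} [CommRing R] (φ : R →+* A)

/-- The preimage of an open set under the map of spectra given by `φ`. -/
def specPre (W : Opens (PrimeSpectrum R)) : Opens (PrimeSpectrum A) :=
  Opens.comap ⟨PrimeSpectrum.comap φ, PrimeSpectrum.continuous_comap φ⟩ W

/-- Pullback of sections of the structure sheaf. -/
def secComap (U : Opens (PrimeSpectrum R)) (V : Opens (PrimeSpectrum A))
    (h : V ≤ specPre φ U) : Sec R U →+* Sec A V := StructureSheaf.comap φ U V h

theorem secComap_algebraMap {U : Opens (PrimeSpectrum R)} {V : Opens (PrimeSpectrum A)}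
    (h : V ≤ specPre φ U) (r : R) :
    secComap φ U V h (algebraMap R _ r) = algebraMap A _ (φ r) := by
  refine Subtype.ext <| funext fun x => ?_
  refine (StructureSheaf.comap_apply φ U V h _ x).trans ?_
  have : x.1.asIdeal.IsPrime := x.1.isPrime
  exact Localization.localRingHom_to_map _ _ _ _ _

theorem secComap_secRes {U U' : Opens (PrimeSpectrum R)} {V V' : Opens (PrimeSpectrum A)}
    (h : V ≤ specPre φ U) (h' : V' ≤ specPre φ U') (hU : U' ≤ U) (hV : V' ≤ V) (s : Sec R U) :
    secComap φ U' V' h' (secRes hU s) = secRes hV (secComap φ U V h s) :=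
  rfl

theorem specPre_basicOpen (f : R) : specPre φ (basicOpen f) = basicOpen (φ f) := rfl

theorem basicOpen_le_specPre (f : R) : basicOpen (φ f) ≤ specPre φ (basicOpen f) := le_rfl

theorem specPre_mono {U V : Opens (PrimeSpectrum R)} (h : U ≤ V) : specPre φ U ≤ specPre φ V :=
  fun _ hx => h hx

/-- Local on the basic open sets `D(f)` in `W`: there a section is `r / f ^ k`, and if a power of `φ
f` kills `φ r` then the same power of `f` kills `r`. -/
theorem secComap_injective (hφ : Function.Injective φ) (W : Opens (PrimeSpectrum R)) :
    Function.Injective (secComap φ W (specPre φ W) le_rfl) := by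
  rw [injective_iff_map_eq_zero]
  intro s hs
  refine sec_eq_of_locally_eq (fun f : {f : R // basicOpen f ≤ W} => basicOpen f.1) (fun f => f.2)
    (le_iSup_basicOpen W) s 0 fun ⟨f, hf⟩ => ?_
  rw [map_zero]
  obtain ⟨k, r, hr⟩ := sec_exists_of_eq_basicOpen (rfl : basicOpen f = basicOpen f) (secRes hf s)
  have h0 : secComap φ (basicOpen f) (basicOpen (φ f)) (basicOpen_le_specPre φ f) (secRes hf s) = 0 := by
    have hle : basicOpen (φ f) ≤ specPre φ W := (basicOpen_le_specPre φ f).trans (specPre_mono φ hf)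
    rw [secComap_secRes φ (le_refl (specPre φ W)) _ hf hle, hs, map_zero]
  have h1 := congrArg (secComap φ (basicOpen f) (basicOpen (φ f)) (basicOpen_le_specPre φ f)) hr
  rw [map_mul, h0, mul_zero, secComap_algebraMap] at h1
  obtain ⟨m, hm⟩ := sec_algebraMap_eq_zero rfl h1.symm
  rw [← map_pow, ← map_mul] at hm
  have hm' : f ^ m * r = 0 := hφ (by rw [hm, map_zero])
  have hu := (sec_isUnit (rfl : basicOpen f = basicOpen f)).pow (m + k)
  refine (hu.mul_right_eq_zero).1 ?_
  rw [← map_pow, pow_add, map_mul, mul_assoc, hr, ← map_mul, hm', map_zero]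

/-- On `D(φ f)` an invariant section is `a / φ(f) ^ k`, and reducedness makes the numerator
invariant after one more factor `φ f`. The local preimages glue because pullback is injective. -/
theorem range_secComap [IsReduced A] (hφ : Function.Injective φ) {ι : Type*} (ψ : ι → A →+* A)
    (hψ : ∀ i r, ψ i (φ r) = φ r) (hinv : ∀ a, (∀ i, ψ i a = a) → a ∈ φ.range)
    (W : Opens (PrimeSpectrum R)) (hW : ∀ i, specPre φ W ≤ specPre (ψ i) (specPre φ W))
    (s : Sec A (specPre φ W)) (hs : ∀ i, secComap (ψ i) _ _ (hW i) s = s) :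
    ∃ t, secComap φ W (specPre φ W) le_rfl t = s := by
  have hloc : ∀ f : {f : R // basicOpen f ≤ W}, ∃ t : Sec R (basicOpen f.1),
      secComap φ (basicOpen f.1) (basicOpen (φ f.1)) (basicOpen_le_specPre φ f.1) t =
        secRes (specPre_mono φ f.2) s := by
    rintro ⟨f, hf⟩
    have hf' : basicOpen (φ f) ≤ specPre φ W := fun x hx => hf hx
    have hi : ∀ i, basicOpen (φ f) ≤ specPre (ψ i) (basicOpen (φ f)) := fun i => by
      rw [specPre_basicOpen, hψ]
    obtain ⟨k, a, ha⟩ := sec_exists_of_eq_basicOpen (rfl : basicOpen (φ f) = basicOpen (φ f)) (secRes hf' s)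
    -- Invariance of the fraction only gives `φ(f) ^ m * (ψ i a - a) = 0` with `m` depending on `i`,
    -- and there may be infinitely many `i`. As `A` is reduced, the exponent 1 works for all of
    -- them.
    have hfa : ∀ i, ψ i (φ f * a) = φ f * a := by
      intro i
      have h1 := congrArg (secComap (ψ i) (basicOpen (φ f)) (basicOpen (φ f)) (hi i)) ha
      rw [map_mul, secComap_secRes (ψ i) (hW i) (hi i) hf' hf', hs, secComap_algebraMap,
        secComap_algebraMap, ← map_pow, hψ, map_pow, ha] at h1
      have h2 : algebraMap A (Sec A (basicOpen (φ f))) (ψ i a - a) = 0 := by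
        rw [map_sub, h1, sub_self]
      obtain ⟨m, hm⟩ := sec_algebraMap_eq_zero rfl h2
      rw [map_mul, hψ, ← sub_eq_zero, ← mul_sub]
      refine IsReduced.eq_zero _ ⟨m + 1, ?_⟩
      calc (φ f * (ψ i a - a)) ^ (m + 1) =
          (φ f ^ m * (ψ i a - a)) * (φ f * (ψ i a - a) ^ m) := by
            rw [mul_pow, pow_succ, pow_succ]; ring
        _ = 0 := by rw [hm, zero_mul]
    obtain ⟨r, hr⟩ := hinv _ hfa
    obtain ⟨u, hu⟩ := (sec_isUnit (rfl : basicOpen f = basicOpen f)).pow (k + 1)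
    refine ⟨↑u⁻¹ * algebraMap R _ r, ?_⟩
    have hu' := (sec_isUnit (rfl : basicOpen (φ f) = basicOpen (φ f))).pow (k + 1)
    refine hu'.mul_left_cancel ?_
    have e1 : algebraMap A (Sec A (basicOpen (φ f))) (φ f) ^ (k + 1) =
        secComap φ (basicOpen f) (basicOpen (φ f)) (basicOpen_le_specPre φ f) u := by
      rw [hu, map_pow, secComap_algebraMap]
    conv_lhs => rw [e1]
    rw [← map_mul, Units.mul_inv_cancel_left, secComap_algebraMap, hr, map_mul, ← ha, ← mul_assoc, map_pow,
      pow_succ']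
    rfl
  choose t ht using hloc
  -- The local preimages agree on overlaps since their pullbacks are restrictions of the same `s`.
  obtain ⟨t₀, ht₀⟩ := sec_exists_gluing (fun f : {f : R // basicOpen f ≤ W} => basicOpen f.1)
    (fun f => f.2) (le_iSup_basicOpen W) t (by
      intro f g
      apply secComap_injective φ hφ
      rw [secComap_secRes φ (le_refl (specPre φ (basicOpen f.1))) _ _
          (specPre_mono φ inf_le_left),
        secComap_secRes φ (le_refl (specPre φ (basicOpen g.1))) _ _
          (specPre_mono φ inf_le_right)]
      exact (congrArg (secRes _) (ht f)).trans (congrArg (secRes _) (ht g)).symm)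
  refine ⟨t₀, ?_⟩
  refine sec_eq_of_locally_eq (fun f : {f : R // basicOpen f ≤ W} => basicOpen (φ f.1))
    (fun f => (basicOpen_le_specPre φ f.1).trans (specPre_mono φ f.2)) ?_ _ _ fun f => ?_
  · intro x hx
    obtain ⟨f, hf⟩ := Opens.mem_iSup.1 (le_iSup_basicOpen W hx)
    exact Opens.mem_iSup.2 ⟨f, hf⟩
  · refine Eq.trans ?_ (ht f)
    rw [← ht₀ f]
    rfl

end

end Sections

section Quotient

variable {G A R : Type u} [Group G] [CommRing A] [MulSemiringAction G A] [CommRing R] [Algebra R A]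

/-- If `r = i + j` with `i ∈ I` and `j` in the ideal generated by `q`, apply the Reynolds operator:
`r = ρ i + ρ j`, and both terms lie in `q`. So the sum of `I` and the extension of `q` contracts
into `q`. The choices of `I` give surjectivity (`I = 0`), closed images (one vanishing ideal) and
disjoint images (a sum of two). -/
theorem exists_prime_of_stable (ρ : A →ₗ[R] R) (hρ1 : ∀ r, ρ (algebraMap R A r) = r)
    {I : Ideal A} (hI : ∀ a ∈ I, algebraMap R A (ρ a) ∈ I) (q : Ideal R) [q.IsPrime]
    (hq : ∀ r, algebraMap R A r ∈ I → r ∈ q) :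
    ∃ P : Ideal A, P.IsPrime ∧ I ≤ P ∧ P.comap (algebraMap R A) = q := by
  have key : (I ⊔ q.map (algebraMap R A)).comap (algebraMap R A) ≤ q := by
    intro r hr
    obtain ⟨i, hi, j, hj, hij⟩ := Submodule.mem_sup.1 (Ideal.mem_comap.1 hr)
    rw [← hρ1 r, ← hij, map_add]
    refine add_mem (hq _ (hI i hi)) ?_
    have hj' : j ∈ q • (⊤ : Submodule R A) := by
      rw [Ideal.smul_top_eq_map]
      exact hj
    refine Submodule.smul_induction_on (p := fun j => ρ j ∈ q) hj' (fun x hx a _ => ?_) (fun x y hx hy => ?_)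
    · rw [map_smul, smul_eq_mul]
      exact q.mul_mem_right _ hx
    · rw [map_add]
      exact add_mem hx hy
  obtain ⟨P, hP, hPp, hPq⟩ := Ideal.exists_ideal_comap_le_prime q _ key
  exact ⟨P, hPp, le_sup_left.trans hP, le_antisymm hPq
    (Ideal.map_le_iff_le_comap.1 (le_sup_right.trans hP))⟩

theorem isGoodQuotient_specMap [IsReduced A] (hinj : Function.Injective (algebraMap R A))
    (hfix : ∀ (h : G) (r : R), h • algebraMap R A r = algebraMap R A r)
    (hinv : ∀ a : A, (∀ h : G, h • a = a) → a ∈ (algebraMap R A).range)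
    (ρ : A →ₗ[R] R) (hρ1 : ∀ r, ρ (algebraMap R A r) = r)
    (hρ : ∀ I : Ideal A, (∀ (h : G), ∀ a ∈ I, h • a ∈ I) → ∀ a ∈ I, algebraMap R A (ρ a) ∈ I) :
    IsGoodQuotient (specAction G A) (Spec.map (CommRingCat.ofHom (algebraMap R A))) := by
  have hvan : ∀ C : Set (PrimeSpectrum A),
      (∀ t : G, Set.MapsTo (specAction G A t).asHom C C) →
      ∀ (h : G), ∀ a ∈ PrimeSpectrum.vanishingIdeal C, h • a ∈ PrimeSpectrum.vanishingIdeal C := by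
    intro C hC h a ha
    rw [PrimeSpectrum.mem_vanishingIdeal] at ha ⊢
    intro x hx
    have h1 : MulSemiringAction.toRingHom G A (h⁻¹)⁻¹ a ∈ x.asIdeal := ha _ (hC h⁻¹ hx)
    rwa [inv_inv] at h1
  have hinvt : ∀ t : G, (specAction G A t).asHom ≫ Spec.map (CommRingCat.ofHom (algebraMap R A)) =
      Spec.map (CommRingCat.ofHom (algebraMap R A)) := by
    intro t
    change Spec.map _ ≫ Spec.map _ = _
    rw [← Spec.map_comp, ← CommRingCat.ofHom_comp]
    congr 2
    ext r
    exact hfix _ r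
  have hmem : ∀ (C : Set (PrimeSpectrum A)) (c : PrimeSpectrum A), c ∈ C →
      ∀ r, algebraMap R A r ∈ PrimeSpectrum.vanishingIdeal C →
      r ∈ c.asIdeal.comap (algebraMap R A) := fun C c hc r hr =>
    (PrimeSpectrum.mem_vanishingIdeal _ _).1 hr c hc
  refine ⟨hinvt, ?_, ?_, ?_, ?_, ?_, ?_⟩
  · intro y
    have : y.asIdeal.IsPrime := y.2
    obtain ⟨P, hP, -, hPy⟩ := exists_prime_of_stable ρ hρ1 (I := ⊥)
      (fun a ha => by rw [Ideal.mem_bot.1 ha, map_zero, map_zero]; exact zero_mem _) y.asIdeal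
      (fun r hr => by
        rw [Ideal.mem_bot, ← map_zero (algebraMap R A)] at hr
        rw [hinj hr]; exact zero_mem _)
    exact ⟨⟨P, hP⟩, PrimeSpectrum.ext hPy⟩
  · intro W
    exact secComap_injective (algebraMap R A) hinj W
  · intro W
    refine Set.Subset.antisymm ?_ ?_
    · rintro _ ⟨s, rfl⟩ t
      have := (Scheme.Hom.comp_appLE (specAction G A t).asHom
        (Spec.map (CommRingCat.ofHom (algebraMap R A))) W
        (Spec.map (CommRingCat.ofHom (algebraMap R A)) ⁻¹ᵁ W)
        (preimage_le_of_invariant (hinvt t) W)).symm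
      have h2 := congrArg (fun f => f.hom s) this
      refine Eq.trans h2 ?_
      simp only [hinvt t, Scheme.Hom.appLE_eq_app]
    · intro s hs
      exact range_secComap (algebraMap R A) hinj
        (fun t : G => MulSemiringAction.toRingHom G A t⁻¹) (fun t r => hfix _ r)
        (fun a ha => hinv a fun h => by simpa using ha h⁻¹) W
        (fun t => preimage_le_of_invariant (hinvt t) W) s hs
  · intro C hC hCinv
    have hCI := hρ _ (hvan C hCinv)
    -- The image of `C` is the zero locus of the invariants vanishing on `C`.
    have : (Spec.map (CommRingCat.ofHom (algebraMap R A))) '' C = PrimeSpectrum.zeroLocus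
        ((PrimeSpectrum.vanishingIdeal C).comap (algebraMap R A) : Set R) := by
      refine Set.Subset.antisymm ?_ ?_
      · rintro _ ⟨c, hc, rfl⟩ r hr
        exact hmem C c hc r hr
      · intro y hy
        have : y.asIdeal.IsPrime := y.2
        obtain ⟨P, hP, hIP, hPy⟩ := exists_prime_of_stable ρ hρ1 hCI y.asIdeal (fun r hr => hy hr)
        refine ⟨⟨P, hP⟩, ?_, PrimeSpectrum.ext hPy⟩
        have hcl : PrimeSpectrum.zeroLocus (PrimeSpectrum.vanishingIdeal C : Set A) = C := by
          exact (PrimeSpectrum.zeroLocus_vanishingIdeal_eq_closure _).trans hC.closure_eq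
        rw [← hcl]
        exact hIP
    rw [this]
    exact PrimeSpectrum.isClosed_zeroLocus _
  · intro C D hC hD hCinv hDinv hCD
    rw [Set.disjoint_left]
    rintro _ ⟨c, hc, rfl⟩ ⟨d, hd, hdc⟩
    have hdc' : d.asIdeal.comap (algebraMap R A) = c.asIdeal.comap (algebraMap R A) :=
      congrArg PrimeSpectrum.asIdeal hdc
    have hCI := hρ _ (hvan C hCinv)
    have hDI := hρ _ (hvan D hDinv)
    have hcp : c.asIdeal.IsPrime := c.2
    have hcp' : (c.asIdeal.comap (algebraMap R A)).IsPrime := Ideal.comap_isPrime _ _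
    -- If `c ∈ C` and `d ∈ D` had the same image, an invariant `i + j` in the sum of the two ideals
    -- would equal `ρ i + ρ j`, with `ρ i` vanishing at `c` and `ρ j` at `d`. The resulting prime is
    -- a common point of `C` and `D`.
    obtain ⟨P, hP, hIP, -⟩ := exists_prime_of_stable ρ hρ1
      (I := PrimeSpectrum.vanishingIdeal C ⊔ PrimeSpectrum.vanishingIdeal D) (by
        intro a ha
        obtain ⟨i, hi, j, hj, rfl⟩ := Submodule.mem_sup.1 ha
        rw [map_add, map_add]
        exact add_mem (Ideal.mem_sup_left (hCI i hi)) (Ideal.mem_sup_right (hDI j hj)))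
      (c.asIdeal.comap (algebraMap R A)) (by
        intro r hr
        obtain ⟨i, hi, j, hj, hij⟩ := Submodule.mem_sup.1 hr
        rw [← hρ1 r, ← hij, map_add]
        exact add_mem (hmem C c hc _ (hCI i hi)) (hdc' ▸ hmem D d hd _ (hDI j hj)))
    have hcl : ∀ E : Set (PrimeSpectrum A), IsClosed E →
        PrimeSpectrum.vanishingIdeal E ≤ P → (⟨P, hP⟩ : PrimeSpectrum A) ∈ E := by
      intro E hE hEP
      have h1 : PrimeSpectrum.zeroLocus (PrimeSpectrum.vanishingIdeal E : Set A) = E := by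
        rw [PrimeSpectrum.zeroLocus_vanishingIdeal_eq_closure, hE.closure_eq]
      rw [← h1]
      exact hEP
    exact Set.disjoint_left.1 hCD (hcl C hC (le_sup_left.trans hIP))
      (hcl D hD (le_sup_right.trans hIP))
  · infer_instance

end Quotient

/-! ### Weight spaces -/

section Weights

variable {K A G W : Type*} [Field K] [CommRing A] [Algebra K A] [Group G] [MulSemiringAction G A]
  [SMulCommClass G K A] [AddCommGroup W] (χ : Multiplicative W →* (G →* K))

/-- The space of the elements of weight `w`. -/
def wtSpace (w : W) : Submodule K A where
  carrier := {a | ∀ h : G, h • a = χ (.ofAdd w) h • a}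
  add_mem' ha hb h := by rw [smul_add, ha, hb, smul_add]
  zero_mem' h := by rw [smul_zero, smul_zero]
  smul_mem' c a ha h := by rw [smul_comm, ha, smul_comm]

theorem mem_wtSpace {w : W} {a : A} :
    a ∈ wtSpace χ w ↔ ∀ h : G, h • a = χ (.ofAdd w) h • a := Iff.rfl

theorem mem_wtSpace_zero {a : A} : a ∈ wtSpace χ 0 ↔ ∀ h : G, h • a = a := by
  simp [mem_wtSpace]

instance wtSpace_gradedMonoid : SetLike.GradedMonoid (wtSpace χ : W → Submodule K A) where
  one_mem := by simp [mem_wtSpace]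
  mul_mem i j a b ha hb h := by
    rw [smul_mul', ha, hb, ofAdd_add, map_mul, MonoidHom.mul_apply, smul_mul_smul_comm]

variable {χ}

/-- Dedekind's independence of characters, applied to each linear form on `A ⧸ I`. For `I = 0` it
makes the weight spaces independent; in general it makes stable subspaces graded. -/
theorem mem_of_sum_mem (hχ : Function.Injective χ) (I : Submodule K A)
    (hI : ∀ (h : G), ∀ a ∈ I, h • a ∈ I) (s : Finset W) (f : W → A) (hf : ∀ w, f w ∈ wtSpace χ w)
    (hs : ∑ w ∈ s, f w ∈ I) : ∀ w ∈ s, f w ∈ I := by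
  intro w hw
  rw [← Submodule.Quotient.mk_eq_zero I, ← Module.forall_dual_apply_eq_zero_iff K]
  intro ℓ
  have hli := (linearIndependent_monoidHom G K).comp (fun w : W => χ (.ofAdd w))
    (hχ.comp Multiplicative.ofAdd.injective)
  rw [linearIndependent_iff'] at hli
  refine hli s (fun w => ℓ (Submodule.Quotient.mk (f w))) ?_ w hw
  funext h
  have h1 := hI h _ hs
  rw [Finset.smul_sum, ← Submodule.Quotient.mk_eq_zero I] at h1
  have h2 := congrArg ℓ h1
  rw [← Submodule.mkQ_apply, map_sum, map_sum, map_zero] at h2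
  rw [Finset.sum_apply, Pi.zero_apply, ← h2]
  refine Finset.sum_congr rfl fun v _ => ?_
  rw [hf v h, map_smul, map_smul, smul_eq_mul]
  exact mul_comm _ _

/-- The grading of `A` by the weight spaces, when these span `A`. -/
@[reducible]
noncomputable def wtGraded [DecidableEq W] (hχ : Function.Injective χ)
    (htop : ⨆ w, (wtSpace χ w : Submodule K A) = ⊤) :
    GradedAlgebra (wtSpace χ : W → Submodule K A) :=
  { wtSpace_gradedMonoid χ with
    toDecomposition := DirectSum.IsInternal.chooseDecomposition _ <|
      DirectSum.isInternal_submodule_of_iSupIndep_of_iSup_eq_top (by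
        rw [iSupIndep_iff_finsetSum_eq_zero_imp_eq_zero]
        intro s f hf h0 w hw
        classical
        have := mem_of_sum_mem hχ (⊥ : Submodule K A)
          (fun h a ha => by rw [(Submodule.mem_bot K).1 ha, smul_zero]; exact zero_mem _) s
          (fun w => if hw : w ∈ s then f w else 0)
          (fun w => by
            split_ifs with h
            · exact hf w h
            · exact zero_mem _)
          (by
            rw [Submodule.mem_bot, ← h0]
            exact Finset.sum_congr rfl fun w hw => by simp [hw]) w hw
        simpa [hw] using this) htop }

theorem proj_mem_of_mem [DecidableEq W] (hχ : Function.Injective χ)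
    [GradedAlgebra (wtSpace χ : W → Submodule K A)] (I : Submodule K A)
    (hI : ∀ (h : G), ∀ a ∈ I, h • a ∈ I) {a : A} (ha : a ∈ I) (w : W) :
    (DirectSum.decompose (wtSpace χ) a w : A) ∈ I := by
  classical
  by_cases hw : w ∈ (DirectSum.decompose (wtSpace χ) a).support
  · refine mem_of_sum_mem hχ I hI _ (fun w => (DirectSum.decompose (wtSpace χ) a w : A))
      (fun w => (DirectSum.decompose (wtSpace χ) a w).2) ?_ w hw
    rwa [DirectSum.sum_support_decompose]
  · rw [DFinsupp.notMem_support_iff.1 hw]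
    exact zero_mem _

/-- The Reynolds operator. -/
theorem exists_reynolds [DecidableEq W] (hχ : Function.Injective χ)
    (htop : ⨆ w, (wtSpace χ w : Submodule K A) = ⊤) (S : Subalgebra K A)
    (hS : ∀ a, a ∈ S ↔ ∀ h : G, h • a = a) :
    ∃ ρ : A →ₗ[S] S, (∀ r, ρ (algebraMap S A r) = r) ∧
      ∀ I : Ideal A, (∀ (h : G), ∀ a ∈ I, h • a ∈ I) → ∀ a ∈ I, algebraMap S A (ρ a) ∈ I := by
  let _ := wtGraded hχ htop
  have h0 : ∀ a : A, (DirectSum.decompose (wtSpace χ) a 0 : A) ∈ S := fun a =>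
    (hS _).2 ((mem_wtSpace_zero χ).1 (DirectSum.decompose (wtSpace χ) a 0).2)
  -- The projection to weight 0, which is `S`-linear because `S` is the part of weight 0.
  refine ⟨⟨⟨fun a => ⟨DirectSum.decompose (wtSpace χ) a 0, h0 a⟩, fun a b => ?_⟩, fun r a => ?_⟩,
    fun r => ?_, fun I hI a ha => ?_⟩
  · apply Subtype.ext
    simp [DirectSum.decompose_add]
  · apply Subtype.ext
    exact DirectSum.coe_decompose_mul_of_left_mem_zero (wtSpace χ)
      ((mem_wtSpace_zero χ).2 ((hS _).1 r.2))
  · apply Subtype.ext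
    exact DirectSum.decompose_of_mem_same (wtSpace χ) ((mem_wtSpace_zero χ).2 ((hS _).1 r.2))
  · exact proj_mem_of_mem hχ (I.restrictScalars K) hI ha 0

section Generators

variable {ι : Type*} [Fintype ι] {x : ι → A} {wt : ι → W}

theorem monomial_mem_wtSpace (hx : ∀ i, x i ∈ wtSpace χ (wt i)) (d : ι → ℕ) :
    ∏ i, x i ^ d i ∈ wtSpace χ (∑ i, d i • wt i) :=
  SetLike.prod_mem_graded _ _ _ fun i _ => SetLike.pow_mem_graded _ (hx i)

theorem exists_eq_sum_monomials (hgen : Algebra.adjoin K (Set.range x) = ⊤) (a : A) : ∃ p : MvPolynomial ι K,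
    a = ∑ d ∈ p.support, p.coeff d • ∏ i, x i ^ d i := by
  have ha : a ∈ Algebra.adjoin K (Set.range x) := hgen ▸ Algebra.mem_top
  rw [Algebra.adjoin_range_eq_range_aeval] at ha
  obtain ⟨p, rfl⟩ := ha
  refine ⟨p, ?_⟩
  change MvPolynomial.aeval x p = _
  rw [MvPolynomial.aeval_def, MvPolynomial.eval₂_eq']
  simp only [Algebra.smul_def]

theorem iSup_wtSpace_eq_top (hx : ∀ i, x i ∈ wtSpace χ (wt i))
    (hgen : Algebra.adjoin K (Set.range x) = ⊤) :
    ⨆ w, (wtSpace χ w : Submodule K A) = ⊤ := by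
  rw [eq_top_iff]
  intro a _
  obtain ⟨p, rfl⟩ := exists_eq_sum_monomials hgen a
  exact Submodule.sum_mem _ fun d _ => Submodule.smul_mem _ _
    (Submodule.mem_iSup_of_mem _ (monomial_mem_wtSpace hx d))

/-- Gordan's lemma: the exponent vectors of weight 0 form a finitely generated monoid, and the
corresponding monomials span the invariants. -/
theorem fg_invariants [DecidableEq W] (hx : ∀ i, x i ∈ wtSpace χ (wt i))
    (hgen : Algebra.adjoin K (Set.range x) = ⊤) (hχ : Function.Injective χ) (S : Subalgebra K A)
    (hS : ∀ a, a ∈ S ↔ ∀ h : G, h • a = a) : S.FG := by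
  classical
  let _ := wtGraded hχ (iSup_wtSpace_eq_top hx hgen)
  let f : (ι → ℕ) →+ W :=
    { toFun := fun d => ∑ i, d i • wt i
      map_zero' := by simp
      map_add' := fun d e => by simp [add_smul, Finset.sum_add_distrib] }
  obtain ⟨T, hT⟩ := AddSubmonoid.fg_eqLocusM f 0
  have hmon : ∀ d, f d = 0 → ∏ i, x i ^ d i ∈ S := fun d hd =>
    (hS _).2 ((mem_wtSpace_zero χ).1 (hd ▸ monomial_mem_wtSpace hx d))
  have hclos : ∀ d ∈ AddSubmonoid.closure (T : Set (ι → ℕ)), ∏ i, x i ^ d i ∈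
      Algebra.adjoin K (T.image fun d => ∏ i, x i ^ d i : Set A) := by
    intro d hd
    induction hd using AddSubmonoid.closure_induction with
    | mem d hd => exact Algebra.subset_adjoin (Finset.mem_coe.2 (Finset.mem_image_of_mem _ hd))
    | zero => simp
    | add d e _ _ hd he =>
      simp only [Pi.add_apply, pow_add, Finset.prod_mul_distrib]
      exact mul_mem hd he
  refine ⟨T.image fun d => ∏ i, x i ^ d i, le_antisymm (Algebra.adjoin_le ?_) fun a ha => ?_⟩
  · intro a ha
    obtain ⟨d, hd, rfl⟩ := Finset.mem_image.1 ha
    exact hmon d ((hT ▸ AddSubmonoid.subset_closure hd : d ∈ f.eqLocusM 0))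
  · have ha0 := DirectSum.decompose_of_mem_same (wtSpace χ) ((mem_wtSpace_zero χ).2 ((hS _).1 ha))
    obtain ⟨p, hp⟩ := exists_eq_sum_monomials hgen a
    -- An invariant equals its projection to weight 0, which keeps exactly the monomials of weight
    -- 0.
    rw [← ha0, hp, DirectSum.decompose_sum, DFinsupp.finsetSum_apply, AddSubmonoidClass.coe_finsetSum]
    refine Subalgebra.sum_mem _ fun d _ => ?_
    rw [DirectSum.decompose_smul]
    refine Subalgebra.smul_mem _ ?_ _
    by_cases hd : f d = 0
    · rw [DirectSum.decompose_of_mem_same (wtSpace χ) (hd ▸ monomial_mem_wtSpace hx d)]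
      exact hclos d (hT ▸ hd)
    · rw [DirectSum.decompose_of_mem_ne (wtSpace χ) (monomial_mem_wtSpace hx d) hd]
      exact zero_mem _

end Generators

end Weights

noncomputable section

variable {n g : ℕ} {K : Type u} [Field K]

/-! ### Symplectic matrices over rings -/

/-- The map between symplectic groups given by a ring homomorphism. -/
def spMap {l R S : Type*} [Fintype l] [DecidableEq l] [CommRing R] [CommRing S] (f : R →+* S) :
    Matrix.symplecticGroup l R →* Matrix.symplecticGroup l S where
  toFun M := ⟨M.1.map f, SymplecticGroup.map_mem M.2 f⟩
  map_one' := Subtype.ext (by simp)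
  map_mul' M N := Subtype.ext (by simp [Matrix.map_mul])

theorem spMap_apply {l R S : Type*} [Fintype l] [DecidableEq l] [CommRing R] [CommRing S]
    (f : R →+* S) (M : Matrix.symplecticGroup l R) (p q : l ⊕ l) :
    (spMap f M).1 p q = f (M.1 p q) := rfl

/-- The product of the commutators `[A₁ : B₁] ⋯ [A_g : B_g]` in a group. -/
def commP {G : Type*} [Group G] {g : ℕ} (A B : Fin g → G) : G :=
  (List.ofFn fun i => A i * B i * (A i)⁻¹ * (B i)⁻¹).prod

theorem map_commP {G H : Type*} [Group G] [Group H] (f : G →* H) {g : ℕ} (A B : Fin g → G) :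
    f (commP A B) = commP (fun i => f (A i)) (fun i => f (B i)) := by
  rw [commP, commP, map_list_prod, List.map_ofFn]
  congr 2
  funext i
  simp [Function.comp]

theorem commP_succ {G : Type*} [Group G] {g : ℕ} (A B : Fin (g + 1) → G) :
    commP A B = (A 0 * B 0 * (A 0)⁻¹ * (B 0)⁻¹) *
      commP (fun i => A i.succ) (fun i => B i.succ) := by
  rw [commP, commP, List.ofFn_succ, List.prod_cons]

/-! ### The coordinate ring -/

/-- All the matrices of a tuple. -/
def SpTuple.mat (X : SpTuple g n K) : Fin g ⊕ Fin g → Sp n K := Sum.elim X.A X.B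

section CoordRing

variable (V : Set (SpTuple g n K))

/-- A matrix entry, as an element of the coordinate ring. -/
def coord (i : Fin g ⊕ Fin g) (p q : Fin n ⊕ Fin n) : coordRing V :=
  ⟨fun X => ((X : SpTuple g n K).mat i).1 p q, Algebra.subset_adjoin (by
    rcases i with i | i
    · exact Or.inl ⟨i, p, q, rfl⟩
    · exact Or.inr ⟨i, p, q, rfl⟩)⟩

theorem adjoin_coord : Algebra.adjoin K (Set.range fun i : (Fin g ⊕ Fin g) × (Fin n ⊕ Fin n) ×
    (Fin n ⊕ Fin n) => coord V i.1 i.2.1 i.2.2) = ⊤ := by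
  rw [eq_top_iff]
  rintro ⟨f, hf⟩ -
  induction hf using Algebra.adjoin_induction with
  | mem f hf =>
    apply Algebra.subset_adjoin
    rcases hf with ⟨i, p, q, rfl⟩ | ⟨i, p, q, rfl⟩
    · exact ⟨(Sum.inl i, p, q), rfl⟩
    · exact ⟨(Sum.inr i, p, q), rfl⟩
  | algebraMap r => exact Subalgebra.algebraMap_mem _ r
  | add f g _ _ hf hg => exact add_mem hf hg
  | mul f g _ _ hf hg => exact mul_mem hf hg

instance : Algebra.FiniteType K (coordRing V) :=
  ⟨⟨(Set.finite_range _).toFinset, by rw [Set.Finite.coe_toFinset]; exact adjoin_coord V⟩⟩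

instance : IsReduced (coordRing V) :=
  isReduced_of_injective (coordRing V).val Subtype.val_injective

variable {V}

/-- Evaluation at a point. -/
def evalAt (X : V) : coordRing V →ₐ[K] K := (Pi.evalAlgHom K (fun _ : V => K) X).comp (coordRing V).val

theorem evalAt_coord (X : V) (i p q) : evalAt X (coord V i p q) = (X.1.mat i).1 p q := rfl

theorem coordRing_ext {f g : coordRing V} (h : ∀ X, evalAt X f = evalAt X g) : f = g :=
  Subtype.ext (funext h)

variable (V) in
/-- The universal matrices over the coordinate ring. -/
def univ (i : Fin g ⊕ Fin g) : Matrix.symplecticGroup (Fin n) (coordRing V) :=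
  ⟨Matrix.of fun p q => coord V i p q, by
    rw [SymplecticGroup.mem_iff]
    have key : ∀ X : V, ((Matrix.of fun p q => coord V i p q) * Matrix.J (Fin n) (coordRing V) *
      (Matrix.of fun p q => coord V i p q).transpose).map (evalAt X) =
        (Matrix.J (Fin n) (coordRing V)).map (evalAt X) := by
      intro X
      rw [Matrix.map_mul, Matrix.map_mul, Matrix.map_J, Matrix.transpose_map]
      exact SymplecticGroup.mem_iff.1 (X.1.mat i).2
    exact Matrix.ext fun p q => coordRing_ext fun X => congrFun (congrFun (key X) p) q⟩

theorem spMap_univ (X : V) (i) : spMap (evalAt X : coordRing V →+* K) (univ V i) = X.1.mat i :=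
  rfl

theorem sp_coordRing_ext {M N : Matrix.symplecticGroup (Fin n) (coordRing V)}
    (h : ∀ X : V, spMap (evalAt X : coordRing V →+* K) M = spMap (evalAt X : coordRing V →+* K) N) :
    M = N :=
  Subtype.ext <| Matrix.ext fun p q =>
    coordRing_ext fun X => congrFun (congrFun (congrArg Subtype.val (h X)) p) q

theorem commP_univ {a : Fin n → Kˣ} (hV : V ⊆ U g a) :
    commP (fun i => univ V (Sum.inl i)) (fun i => univ V (Sum.inr i)) =
      spMap (algebraMap K (coordRing V)) (diagSp a) := by
  apply sp_coordRing_ext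
  intro X
  rw [map_commP]
  have : commP (fun i => X.1.mat (Sum.inl i)) (fun i => X.1.mat (Sum.inr i)) = diagSp a := hV X.2
  simp only [spMap_univ, this]
  apply Subtype.ext
  ext p q
  simp [spMap_apply]

/-- The tuple of matrices given by a point of the coordinate ring. -/
def tupleOfHom (ψ : coordRing V →ₐ[K] K) : SpTuple g n K where
  A i := spMap (ψ : coordRing V →+* K) (univ V (Sum.inl i))
  B i := spMap (ψ : coordRing V →+* K) (univ V (Sum.inr i))

theorem mat_tupleOfHom (ψ : coordRing V →ₐ[K] K) (i) :
    (tupleOfHom ψ).mat i = spMap (ψ : coordRing V →+* K) (univ V i) := by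
  rcases i with i | i <;> rfl

theorem algHom_ext_coord {R : Type*} [CommRing R] [Algebra K R] {ψ ψ' : coordRing V →ₐ[K] R}
    (h : ∀ i p q, ψ (coord V i p q) = ψ' (coord V i p q)) : ψ = ψ' := by
  apply AlgHom.ext_of_adjoin_eq_top (adjoin_coord V)
  rintro _ ⟨i, rfl⟩
  exact h _ _ _

theorem spMap_algHom_diagSp {R : Type*} [CommRing R] [Algebra K R] (ψ : coordRing V →ₐ[K] R)
    (M : Sp n K) : spMap (ψ : coordRing V →+* R) (spMap (algebraMap K (coordRing V)) M) =
      spMap (algebraMap K R) M := by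
  apply Subtype.ext
  ext p q
  simp [spMap_apply]

theorem spMap_id (M : Sp n K) : spMap (algebraMap K K) M = M := rfl

theorem tupleOfHom_mem_U {a : Fin n → Kˣ} (hV : V ⊆ U g a) (ψ : coordRing V →ₐ[K] K) :
    tupleOfHom ψ ∈ U g a := by
  have := congrArg (spMap (ψ : coordRing V →+* K)) (commP_univ hV)
  rw [map_commP, spMap_algHom_diagSp] at this
  exact this

theorem mat_smul (h : torus n K) (X : SpTuple g n K) (i) :
    (h • X).mat i = (h : Sp n K)⁻¹ * X.mat i * h := by
  rcases i with i | i <;> rfl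

theorem SpTuple.mat_ext {X Y : SpTuple g n K} (h : ∀ i, X.mat i = Y.mat i) : X = Y :=
  SpTuple.ext (funext fun i => h (Sum.inl i)) (funext fun i => h (Sum.inr i))

/-- Being fixed by `h` is an identity between the universal matrices, since it can be tested at the
points of `V`; it therefore specialises along every `ψ`. -/
theorem smul_tupleOfHom {h : torus n K} (hV : ∀ X ∈ V, h • X = X) (ψ : coordRing V →ₐ[K] K) :
    h • tupleOfHom ψ = tupleOfHom ψ := by
  apply SpTuple.mat_ext
  intro i
  have huniv : (spMap (algebraMap K (coordRing V)) (h : Sp n K))⁻¹ * univ V i *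
      spMap (algebraMap K (coordRing V)) (h : Sp n K) = univ V i := by
    apply sp_coordRing_ext
    intro X
    rw [map_mul, map_mul, map_inv, spMap_algHom_diagSp, spMap_univ, spMap_id, ← mat_smul,
      hV X.1 X.2]
  have := congrArg (spMap (ψ : coordRing V →+* K)) huniv
  rw [map_mul, map_mul, map_inv, spMap_algHom_diagSp, spMap_id, ← mat_tupleOfHom] at this
  rw [mat_smul, this]

end CoordRing

theorem UH_subset_U (a : Fin n → Kˣ) (H : Subgroup (torus n K)) :
    (UH g a H : Set (SpTuple g n K)) ⊆ U g a := fun _ h => h.1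

theorem UH_bot (a : Fin n → Kˣ) : UH g a (⊥ : Subgroup (torus n K)) = U g a := by
  ext X
  exact ⟨fun h => h.1, fun h => ⟨h, bot_le⟩⟩

/-- `U_{n,H}` is Zariski closed: the points of its coordinate ring are its points. -/
theorem exists_eq_evalAt (a : Fin n → Kˣ) (H : Subgroup (torus n K))
    (ψ : coordRing (UH g a H : Set (SpTuple g n K)) →ₐ[K] K) :
    ∃ X : (UH g a H : Set (SpTuple g n K)), ψ = evalAt X := by
  refine ⟨⟨tupleOfHom ψ, tupleOfHom_mem_U (UH_subset_U a H) ψ, fun h hh => ?_⟩,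
    algHom_ext_coord fun i p q => ?_⟩
  · rw [MulAction.mem_stabilizer_iff]
    exact smul_tupleOfHom (fun X hX => hX.2 hh) ψ
  · rw [evalAt_coord, mat_tupleOfHom]
    rfl

/-- A maximal ideal of a finitely generated algebra over an algebraically closed field is the kernel
of a point. -/
theorem exists_algHom_of_isMaximal {A : Type*} [CommRing A] [Algebra K A] [IsAlgClosed K]
    [Algebra.FiniteType K A] (m : Ideal A) (hm : m.IsMaximal) :
    ∃ ψ : A →ₐ[K] K, RingHom.ker ψ = m := by
  let _ : Field (A ⧸ m) := Ideal.Quotient.field m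
  have hfin : Module.Finite K (A ⧸ m) := finite_of_finite_type_of_isJacobsonRing K (A ⧸ m)
  have hbij : Function.Bijective (algebraMap K (A ⧸ m)) :=
    IsAlgClosed.algebraMap_bijective_of_isIntegral
  let e : K ≃ₐ[K] (A ⧸ m) := AlgEquiv.ofBijective (Algebra.ofId K (A ⧸ m)) hbij
  refine ⟨(e.symm : (A ⧸ m) →ₐ[K] K).comp (Ideal.Quotient.mkₐ K m), ?_⟩
  ext x
  simp [RingHom.mem_ker, Ideal.Quotient.eq_zero_iff_mem]

theorem isMaximal_ker_evalAt {V : Set (SpTuple g n K)} (X : V) :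
    (RingHom.ker (evalAt X)).IsMaximal :=
  RingHom.ker_isMaximal_of_surjective _ fun c => ⟨algebraMap K _ c, by simp⟩

end

noncomputable section

variable {n g : ℕ} {K : Type u} [Field K]

/-! ### Connectedness of the tuples in `U` -/

theorem commP_eq_one {G : Type*} [CommGroup G] {g : ℕ} (A B : Fin g → G) : commP A B = 1 := by
  apply List.prod_eq_one
  intro x hx
  obtain ⟨i, rfl⟩ := List.mem_ofFn.1 hx
  rw [mul_inv_eq_one, mul_comm (A i), mul_inv_cancel_right]

/-- The sign of an index. -/
def sgn (R : Type*) [CommRing R] {l : Type*} : l ⊕ l → R := Sum.elim (fun _ => 1) (fun _ => -1)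

theorem sgn_mul_self (R : Type*) [CommRing R] {l : Type*} (p : l ⊕ l) : sgn R p * sgn R p = 1 := by
  rcases p with p | p <;> simp [sgn]

theorem mul_J_apply {l R : Type*} [Fintype l] [DecidableEq l] [CommRing R]
    (M : Matrix (l ⊕ l) (l ⊕ l) R) (p q : l ⊕ l) :
    (M * Matrix.J l R) p q = sgn R q * M p q.swap := by
  rcases q with q | q <;> simp [Matrix.mul_apply, Matrix.J, Matrix.one_apply, sgn]

theorem J_mul_apply {l R : Type*} [Fintype l] [DecidableEq l] [CommRing R]
    (M : Matrix (l ⊕ l) (l ⊕ l) R) (p q : l ⊕ l) :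
    (Matrix.J l R * M) p q = -(sgn R p * M p.swap q) := by
  rcases p with p | p <;> simp [Matrix.mul_apply, Matrix.J, Matrix.one_apply, sgn]

/-- Entrywise form of `M⁻¹ = -J Mᵗ J`. It relates zero patterns of `M⁻¹` and `M`, which makes
reachability symmetric. -/
theorem sp_inv_apply {l R : Type*} [Fintype l] [DecidableEq l] [CommRing R]
    (M : Matrix.symplecticGroup l R) (p q : l ⊕ l) :
    (M⁻¹).1 p q = sgn R p * sgn R q * M.1 q.swap p.swap := by
  rw [SymplecticGroup.coe_inv, mul_J_apply, Matrix.neg_mul, Matrix.neg_apply, J_mul_apply,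
    Matrix.transpose_apply]
  ring

/-- The diagonal entries of `diagSp a`. -/
def diagEntry {G : Type*} [Group G] (a : Fin n → G) : Fin n ⊕ Fin n → G := Sum.elim a a⁻¹

theorem diagSp_val (a : Fin n → Kˣ) :
    (diagSp a).1 = Matrix.diagonal fun p => ((diagEntry a p : Kˣ) : K) := by
  change Matrix.diagonal _ = _
  congr 1
  funext p
  rcases p with p | p <;> simp [diagEntry]

theorem diagEntry_swap {G : Type*} [Group G] (a : Fin n → G) (p : Fin n ⊕ Fin n) :
    diagEntry a p.swap = (diagEntry a p)⁻¹ := by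
  rcases p with p | p <;> simp [diagEntry]

/-! ### Invariant coordinate subspaces and the determinant on them -/

section Stable

variable (R : Set (Fin n ⊕ Fin n))

open Classical in
/-- The symplectic matrices which preserve the span of the row vectors `e_r`, `r ∈ R`. -/
def rowStab : Subgroup (Sp n K) where
  carrier := {M | M.1.BlockTriangular fun p => if p ∈ R then 1 else 0}
  one_mem' := Matrix.blockTriangular_one
  mul_mem' ha hb := Matrix.BlockTriangular.mul ha hb
  inv_mem' {M} hM := by
    have : Invertible M.1 := Matrix.invertibleOfIsUnitDet _ (SymplecticGroup.symplectic_det M.2)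
    rw [Set.mem_ofPred_eq, SymplecticGroup.coe_inv']
    exact Matrix.blockTriangular_inv_of_blockTriangular hM

variable {R}

theorem mem_rowStab {M : Sp n K} : M ∈ rowStab R ↔ ∀ p ∈ R, ∀ q ∉ R, M.1 p q = 0 := by
  classical
  change (M.1.BlockTriangular _) ↔ _
  constructor
  · intro h p hp q hq
    exact h (by simp [hp, hq])
  · intro h p q hpq
    by_cases hp : p ∈ R <;> by_cases hq : q ∈ R <;> simp [hp, hq] at hpq
    exact h p hp q hq

open Classical in
/-- The determinant of the action of a matrix on the span of the row vectors `e_r`, `r ∈ R`. -/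
def rowDet : rowStab (K := K) R →* K where
  toFun M := (M.1.1.submatrix (Subtype.val : R → _) (Subtype.val : R → _)).det
  map_one' := by
    change ((1 : Matrix (Fin n ⊕ Fin n) (Fin n ⊕ Fin n) K).submatrix _ _).det = 1
    rw [Matrix.submatrix_one _ Subtype.val_injective, Matrix.det_one]
  map_mul' M N := by
    rw [← Matrix.det_mul]
    congr 1
    ext p q
    change (M.1.1 * N.1.1) p q = _
    rw [Matrix.mul_apply, Matrix.mul_apply]
    have h := Fintype.sum_subtype_add_sum_subtype (· ∈ R)
      (fun k => M.1.1 p k * N.1.1 k q)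
    refine h.symm.trans (add_eq_left.2 ?_)
    refine Finset.sum_eq_zero fun k _ => ?_
    rw [mem_rowStab.1 M.2 p p.2 k k.2, zero_mul]

open Classical in
-- The determinant on the invariant subspace has commutative target, so it is 1 on products of
-- commutators; on `ξ` it is the product of the diagonal entries indexed by `R`.
theorem prod_diagEntry_eq_one {A B : Fin g → Sp n K} {a : Fin n → Kˣ} (h : commP A B = diagSp a)
    (hA : ∀ i, A i ∈ rowStab R) (hB : ∀ i, B i ∈ rowStab R) :
    ∏ r : R, diagEntry a r = 1 := by
  have h1 := map_commP (rowStab R).subtype (fun i => ⟨A i, hA i⟩) (fun i => ⟨B i, hB i⟩)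
  simp only [Subgroup.coe_subtype] at h1
  have h2 := map_commP (MonoidHom.toHomUnits (rowDet (K := K) (R := R)))
    (fun i => ⟨A i, hA i⟩) (fun i => ⟨B i, hB i⟩)
  rw [commP_eq_one] at h2
  have h3 := congrArg Units.val h2
  rw [MonoidHom.coe_toHomUnits, Units.val_one] at h3
  change (Matrix.submatrix (Subtype.val (Subtype.val _)) _ _).det = 1 at h3
  rw [h1, h, diagSp_val, Matrix.submatrix_diagonal _ _ Subtype.val_injective,
    Matrix.det_diagonal] at h3
  apply Units.ext
  rw [Units.coe_prod]
  exact h3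

open Classical in
/-- The condition on `ξ` says that the invariant coordinate subspaces are non-degenerate. -/
theorem swap_mem_of_prod_eq_one {G : Type*} [CommGroup G] {a : Fin n → G}
    (hJL : ∀ J L : Finset (Fin n), Disjoint J L → ¬ (J = ∅ ∧ L = ∅) → ∏ j ∈ J, a j ≠ ∏ l ∈ L, a l)
    (h : ∏ r : R, diagEntry a r = 1) {p : Fin n ⊕ Fin n} (hp : p ∈ R) : p.swap ∈ R := by
  let P : Finset (Fin n) := Finset.univ.filter fun i => Sum.inl i ∈ R
  let Q : Finset (Fin n) := Finset.univ.filter fun i => Sum.inr i ∈ R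
  have h1 : (∏ i ∈ P, a i) = ∏ i ∈ Q, a i := by
    have e : ∏ r : R, diagEntry a r = ∏ p : Fin n ⊕ Fin n, if p ∈ R then diagEntry a p else 1 := by
      rw [← Finset.prod_filter, ← Finset.prod_subtype_eq_prod_filter]
      exact Finset.prod_congr (by ext; simp) fun _ _ => rfl
    rw [e, Fintype.prod_sum_type, ← Finset.prod_filter, ← Finset.prod_filter] at h
    simp only [diagEntry, Sum.elim_inl, Sum.elim_inr, Pi.inv_apply, Finset.prod_inv_distrib] at h
    exact mul_inv_eq_one.1 h
  -- Cancelling the common part `P ∩ Q` leaves an equality of products over disjoint sets, which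
  -- genericity allows only if both are empty.
  have h2 : P \ Q = ∅ ∧ Q \ P = ∅ := by
    by_contra hne
    refine hJL (P \ Q) (Q \ P) disjoint_sdiff_sdiff hne ?_
    rw [← Finset.prod_inter_mul_prod_sdiff P Q, ← Finset.prod_inter_mul_prod_sdiff Q P,
      Finset.inter_comm Q P] at h1
    exact mul_left_cancel h1
  rw [Finset.sdiff_eq_empty_iff_subset, Finset.sdiff_eq_empty_iff_subset] at h2
  rcases p with i | i
  · have : i ∈ Q := h2.1 (by simpa [P] using hp)
    simpa [Q] using this
  · have : i ∈ P := h2.2 (by simpa [Q] using hp)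
    simpa [P] using this

end Stable

/-- The condition on `ξ = diag(a₁, …, aₙ, a₁⁻¹, …, aₙ⁻¹)`. -/
def IsGeneric (a : Fin n → Kˣ) : Prop :=
  ∀ J L : Finset (Fin n), Disjoint J L → ¬ (J = ∅ ∧ L = ∅) → ∏ j ∈ J, a j ≠ ∏ l ∈ L, a l

/-! ### The graph of non-zero entries -/

section Paths

variable {a : Fin n → Kˣ} {X : SpTuple g n K}

/-- Two indices are joined by an edge if some matrix has a non-zero entry there. -/
def Edge (X : SpTuple g n K) (p q : Fin n ⊕ Fin n) : Prop := ∃ i, (X.mat i).1 p q ≠ 0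

theorem mat_mem_rowStab {R : Set (Fin n ⊕ Fin n)} (hR : ∀ p ∈ R, ∀ q, Edge X p q → q ∈ R) (i) :
    X.mat i ∈ rowStab R := by
  rw [mem_rowStab]
  intro p hp q hq
  by_contra h
  exact hq (hR p hp q ⟨i, h⟩)

theorem swap_mem_of_closed (ha : IsGeneric a) (hX : X ∈ U g a) {R : Set (Fin n ⊕ Fin n)}
    (hR : ∀ p ∈ R, ∀ q, Edge X p q → q ∈ R) {p : Fin n ⊕ Fin n} (hp : p ∈ R) : p.swap ∈ R :=
  swap_mem_of_prod_eq_one ha (prod_diagEntry_eq_one hX (fun i => mat_mem_rowStab hR (Sum.inl i))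
    fun i => mat_mem_rowStab hR (Sum.inr i)) hp

/-- The inverses preserve the span of `R` too, and the entry of the inverse at `(q.swap, p.swap)`
is, up to sign, the entry at `(p, q)`. If `p ∉ R`, it vanishes because `R` is stable under the swap.
-/
theorem mem_of_edge_mem (ha : IsGeneric a) (hX : X ∈ U g a) {R : Set (Fin n ⊕ Fin n)}
    (hR : ∀ p ∈ R, ∀ q, Edge X p q → q ∈ R) {p q : Fin n ⊕ Fin n} (hpq : Edge X p q)
    (hq : q ∈ R) : p ∈ R := by
  by_contra hp
  obtain ⟨i, hi⟩ := hpq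
  apply hi
  have h1 := mem_rowStab.1 (inv_mem (mat_mem_rowStab hR i)) q.swap (swap_mem_of_closed ha hX hR hq)
    p.swap (fun h => hp (by simpa using swap_mem_of_closed ha hX hR h))
  rw [sp_inv_apply, Sum.swap_swap, Sum.swap_swap] at h1
  have h2 : ∀ p : Fin n ⊕ Fin n, sgn K p ≠ 0 := fun p hp => by
    have := sgn_mul_self K p
    rw [hp, zero_mul] at this
    exact zero_ne_one this
  simpa [h2] using h1

/-- There is a path from `p` to `q`. -/
def Reach (X : SpTuple g n K) : Fin n ⊕ Fin n → Fin n ⊕ Fin n → Prop := Relation.ReflTransGen (Edge X)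

theorem reach_of_edge (ha : IsGeneric a) (hX : X ∈ U g a) {p q : Fin n ⊕ Fin n} (h : Edge X p q) :
    Reach X q p :=
  mem_of_edge_mem ha hX (R := {r | Reach X q r}) (fun _ hp _ hq => hp.tail hq) h
    Relation.ReflTransGen.refl

theorem reach_swap (ha : IsGeneric a) (hX : X ∈ U g a) (p : Fin n ⊕ Fin n) : Reach X p p.swap :=
  swap_mem_of_closed ha hX (R := {r | Reach X p r}) (fun _ hp _ hq => hp.tail hq)
    Relation.ReflTransGen.refl

theorem reach_symm (ha : IsGeneric a) (hX : X ∈ U g a) {p q : Fin n ⊕ Fin n} (h : Reach X p q) :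
    Reach X q p := by
  induction h with
  | refl => exact Relation.ReflTransGen.refl
  | tail _ h ih => exact (reach_of_edge ha hX h).trans ih

/-- The form in which connectedness is used: for the diagonal of a stabilising torus element, and
for the diagonal of a matrix commuting with the tuple. -/
theorem apply_swap_of_edge (ha : IsGeneric a) (hX : X ∈ U g a) {S : Type*}
    (f : Fin n ⊕ Fin n → S) (hf : ∀ p q, Edge X p q → f p = f q) (p : Fin n ⊕ Fin n) :
    f p.swap = f p := by
  have : ∀ q, Reach X p q → f q = f p := by
    intro q h
    induction h with
    | refl => rfl
    | tail _ h ih => rw [← hf _ _ h, ih]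
  exact this _ (reach_swap ha hX p)

theorem diagSp_conj_apply (l : Fin n → Kˣ) (M : Sp n K) (p q) :
    ((diagSp l)⁻¹ * M * diagSp l).1 p q =
      ((diagEntry l p : Kˣ) : K)⁻¹ * M.1 p q * (diagEntry l q : Kˣ) := by
  rw [← map_inv]
  change ((diagSp l⁻¹).1 * M.1 * (diagSp l).1) p q = _
  rw [diagSp_val, diagSp_val, Matrix.mul_diagonal, Matrix.diagonal_mul]
  rcases p with p | p <;> simp [diagEntry]

theorem stabilizer_le_mu2 (ha : IsGeneric a) (hX : X ∈ U g a) :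
    MulAction.stabilizer (torus n K) X ≤ mu2 n K := by
  rintro ⟨_, l, rfl⟩ hh
  rw [MulAction.mem_stabilizer_iff] at hh
  have hedge : ∀ p q, Edge X p q → diagEntry l p = diagEntry l q := by
    rintro p q ⟨i, hi⟩
    have h1 := congrFun (congrFun (congrArg (fun Y => (SpTuple.mat Y i).1) hh) p) q
    simp only [mat_smul, diagSp_conj_apply] at h1
    have h2 : ((diagEntry l q : Kˣ) : K) = (diagEntry l p : Kˣ) := by
      field_simp at h1
      exact h1
    exact (Units.ext h2).symm
  have hl : ∀ i, l i * l i = 1 := by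
    intro i
    have h1 := apply_swap_of_edge ha hX _ hedge (Sum.inl i)
    rw [diagEntry_swap] at h1
    exact inv_eq_iff_mul_eq_one.1 h1
  change (_ : torus n K) ^ 2 = 1
  apply Subtype.ext
  change diagSp l ^ 2 = 1
  rw [← map_pow, show l ^ 2 = 1 from funext fun i => by simpa [pow_two] using hl i, map_one]

end Paths

end

noncomputable section

/-! ### Points with the same invariants -/

section SameInvariants

variable {K A G W : Type*} [Field K] [CommRing A] [Algebra K A] [Group G] [MulSemiringAction G A]
  [SMulCommClass G K A] [AddCommGroup W] (χ : Multiplicative W →* (G →* K))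

/-- The weights `w` such that there are functions of weights `w` and `-w` which do not vanish at a
given point. -/
def ptWeights (φ : A →ₐ[K] K) : AddSubgroup W where
  carrier := {w | ∃ f ∈ wtSpace (A := A) χ w, ∃ f' ∈ wtSpace (A := A) χ (-w), φ f ≠ 0 ∧ φ f' ≠ 0}
  zero_mem' := ⟨1, SetLike.GradedOne.one_mem, 1, by rw [neg_zero]; exact SetLike.GradedOne.one_mem,
    by simp, by simp⟩
  add_mem' := by
    rintro v w ⟨f, hf, f', hf', h, h'⟩ ⟨e, he, e', he', k, k'⟩
    exact ⟨f * e, SetLike.mul_mem_graded hf he, f' * e', by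
      rw [neg_add]; exact SetLike.mul_mem_graded hf' he', by simp [h, k], by simp [h', k']⟩
  neg_mem' := by
    rintro w ⟨f, hf, f', hf', h, h'⟩
    exact ⟨f', hf', f, by rwa [neg_neg], h', h⟩

variable {χ}

theorem map_mul_eq_of_same_invariants {φ φ' : A →ₐ[K] K}
    (hinv : ∀ f ∈ wtSpace (A := A) χ 0, φ f = φ' f) {w : W} {f f' : A} (hf : f ∈ wtSpace χ w)
    (hf' : f' ∈ wtSpace χ (-w)) : φ f * φ f' = φ' f * φ' f' := by
  rw [← map_mul, ← map_mul]
  apply hinv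
  rw [← add_neg_cancel w]
  exact SetLike.mul_mem_graded hf hf'

/-- Fix `f'` of weight `-w` that does not vanish at `φ`. All products `f * f'` are invariant, so the
ratio of `φ' f` to `φ f` is that of `φ f'` to `φ' f'`, whatever `f` is. -/
theorem exists_units_of_same_invariants {φ φ' : A →ₐ[K] K}
    (hinv : ∀ f ∈ wtSpace (A := A) χ 0, φ f = φ' f) {w : W} (hw : w ∈ ptWeights χ φ) :
    ∃ c : Kˣ, ∀ f ∈ wtSpace (A := A) χ w, φ' f = c * φ f := by
  obtain ⟨f₁, hf₁, f', hf', h, h'⟩ := hw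
  have h1 := map_mul_eq_of_same_invariants hinv hf₁ hf'
  have h2 : φ' f' ≠ 0 := fun h0 => by simp [h0, h, h'] at h1
  refine ⟨Units.mk0 (φ f' / φ' f') (div_ne_zero h' h2), fun f hf => ?_⟩
  have h3 := map_mul_eq_of_same_invariants hinv hf hf'
  rw [Units.val_mk0, div_mul_eq_mul_div, eq_div_iff h2, ← h3, mul_comm]

/-- Two points with the same invariants differ by a character of the group of weights. -/
theorem exists_character_of_same_invariants [IsAlgClosed K] {φ φ' : A →ₐ[K] K}
    (hinv : ∀ f ∈ wtSpace (A := A) χ 0, φ f = φ' f) :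
    ∃ c : W →+ Additive Kˣ, ∀ w ∈ ptWeights χ φ, ∀ f ∈ wtSpace (A := A) χ w,
      φ' f = ((c w).toMul : Kˣ) * φ f := by
  choose! c hc using fun (w : W) (hw : w ∈ ptWeights χ φ) => exists_units_of_same_invariants hinv hw
  let c' : ptWeights χ φ →+ Additive Kˣ := AddMonoidHom.mk' (fun w => Additive.ofMul (c w)) (by
    rintro ⟨v, hv⟩ ⟨w, hw⟩
    apply Additive.toMul.injective
    apply Units.ext
    obtain ⟨f, hf, _, _, h, _⟩ := id hv
    obtain ⟨e, he, _, _, k, _⟩ := id hw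
    have h1 := hc (v + w) (add_mem hv hw) (f * e) (SetLike.mul_mem_graded hf he)
    rw [map_mul, map_mul, hc v hv f hf, hc w hw e he] at h1
    change ((c (v + w) : Kˣ) : K) = c v * c w
    have h2 : φ f * φ e ≠ 0 := mul_ne_zero h k
    apply mul_right_cancel₀ h2
    rw [← h1]
    ring)
  -- Over an algebraically closed field the group of units is divisible, hence an injective abelian
  -- group, and the character extends from the subgroup to all weights.
  have hdiv : DivisibleBy (Additive Kˣ) ℤ := by
    refine @AddGroup.divisibleByIntOfDivisibleByNat (Additive Kˣ) _ ?_
    refine divisibleByOfSMulRightSurj _ _ fun {m} hm u => ?_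
    obtain ⟨z, hz⟩ := IsAlgClosed.exists_pow_nat_eq ((u.toMul : Kˣ) : K) (Nat.pos_of_ne_zero hm)
    have hz0 : z ≠ 0 := by
      rintro rfl
      rw [zero_pow hm] at hz
      exact (u.toMul : Kˣ).ne_zero hz.symm
    exact ⟨Additive.ofMul (Units.mk0 z hz0), Additive.toMul.injective (Units.ext (by simpa using hz))⟩
  obtain ⟨d, hd⟩ := (Module.Baer.of_divisible (Additive Kˣ)).extension_property_addMonoidHom
    (ptWeights χ φ).subtype Subtype.val_injective c'
  refine ⟨d, fun w hw f hf => ?_⟩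
  have h1 : d w = Additive.ofMul (c w) := DFunLike.congr_fun hd ⟨w, hw⟩
  rw [h1, hc w hw f hf]
  rfl

end SameInvariants

variable {n g : ℕ} {K : Type u} [Field K]

/-! ### The weights of the torus -/

theorem diagSp_injective : Function.Injective (diagSp (n := n) (K := K)) := by
  intro l k h
  funext i
  have h1 := congrFun (congrFun (congrArg Subtype.val h) (Sum.inl i)) (Sum.inl i)
  rw [diagSp_val, diagSp_val, Matrix.diagonal_apply_eq, Matrix.diagonal_apply_eq] at h1
  exact Units.ext h1

variable (n K) in
/-- The coordinates on the torus. -/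
def torusEquiv : (Fin n → Kˣ) ≃* torus n K := MonoidHom.ofInjective diagSp_injective

theorem torusEquiv_coe (l : Fin n → Kˣ) : (torusEquiv n K l : Sp n K) = diagSp l := rfl

variable (n K) in
/-- The characters of the torus. -/
def torusChar : Multiplicative (Fin n → ℤ) →* (torus n K →* K) where
  toFun w := (Units.coeHom K).comp
    { toFun := fun h => ∏ i, ((torusEquiv n K).symm h i) ^ (w.toAdd i)
      map_one' := by simp
      map_mul' := fun h k => by simp [mul_zpow, Finset.prod_mul_distrib] }
  map_one' := by ext h; simp
  map_mul' v w := by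
    ext h
    simp [zpow_add, Finset.prod_mul_distrib]

theorem torusChar_apply (w : Fin n → ℤ) (l : Fin n → Kˣ) :
    torusChar n K (.ofAdd w) (torusEquiv n K l) = ((∏ i, l i ^ w i : Kˣ) : K) := by
  change ((∏ i, ((torusEquiv n K).symm (torusEquiv n K l) i) ^ (w i) : Kˣ) : K) = _
  rw [MulEquiv.symm_apply_apply]

/-- If `w i ≠ 0` and `w` gave the trivial character, all units of `K` would be roots of unity of one
fixed order, hence finite in number. -/
theorem torusChar_injective [Infinite K] : Function.Injective (torusChar n K) := by
  rw [injective_iff_map_eq_one]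
  intro w hw
  apply Multiplicative.toAdd.injective
  funext i
  by_contra hne
  have h1 : ∀ u : Kˣ, u ^ (w.toAdd i) = 1 := by
    intro u
    have h2 := DFunLike.congr_fun hw (torusEquiv n K (Pi.mulSingle i u))
    rw [show w = .ofAdd w.toAdd from rfl, torusChar_apply, Finset.prod_eq_single i] at h2
    · rw [Pi.mulSingle_eq_same] at h2
      exact Units.ext h2
    · intro j _ hj
      rw [Pi.mulSingle_eq_of_ne hj, one_zpow]
    · simp
  have h3 : (w.toAdd i).natAbs ≠ 0 := Int.natAbs_ne_zero.2 hne
  have h4 : ∀ u : Kˣ, u ^ (w.toAdd i).natAbs = 1 := fun u => by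
    rcases Int.natAbs_eq (w.toAdd i) with h | h
    · have := h1 u; rw [h, zpow_natCast] at this; exact this
    · have := h1 u; rw [h, zpow_neg, inv_eq_one, zpow_natCast] at this; exact this
  have hinf : Infinite Kˣ := by
    by_contra hfin
    rw [not_infinite_iff_finite] at hfin
    have : Finite K := by
      have : (Set.univ : Set K).Finite := by
        refine ((Set.finite_range (Units.val : Kˣ → K)).insert 0).subset fun x _ => ?_
        by_cases hx : x = 0
        · exact Or.inl hx
        · exact Or.inr ⟨Units.mk0 x hx, rfl⟩
      exact Set.finite_univ_iff.1 this
    exact not_finite K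
  have : NeZero (w.toAdd i).natAbs := ⟨h3⟩
  have hfin : Finite (rootsOfUnity (w.toAdd i).natAbs K) := inferInstance
  have : (⊤ : Subgroup Kˣ) ≤ rootsOfUnity (w.toAdd i).natAbs K := fun u _ => h4 u
  have : Finite (⊤ : Subgroup Kˣ) := Finite.of_injective _ (Subgroup.inclusion_injective this)
  have : Finite Kˣ := Finite.of_equiv _ Subgroup.topEquiv.toEquiv
  exact not_finite Kˣ

/-- The weight of a basis vector. -/
def wt : Fin n ⊕ Fin n → Fin n → ℤ := Sum.elim (fun i => Pi.single i 1) fun i => -Pi.single i 1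

theorem wt_swap (p : Fin n ⊕ Fin n) : wt p.swap = -wt p := by
  rcases p with p | p <;> simp [wt]

theorem torusChar_wt (l : Fin n → Kˣ) (p : Fin n ⊕ Fin n) :
    torusChar n K (.ofAdd (wt p)) (torusEquiv n K l) = (diagEntry l p : Kˣ) := by
  rw [torusChar_apply]
  congr 1
  rcases p with p | p
  · rw [Finset.prod_eq_single p] <;> simp +contextual [wt, diagEntry]
  · rw [Finset.prod_eq_single p] <;> simp +contextual [wt, diagEntry]

theorem torusChar_neg (w : Fin n → ℤ) (h : torus n K) :
    torusChar n K (.ofAdd (-w)) h * torusChar n K (.ofAdd w) h = 1 := by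
  rw [← MonoidHom.mul_apply, ← map_mul, ← ofAdd_add, neg_add_cancel, ofAdd_zero, map_one,
    MonoidHom.one_apply]

/-! ### Weights of the coordinate functions and fibres of the quotient map -/

section Quotient

variable (V : SubMulAction (torus n K) (SpTuple g n K))

instance : SMulCommClass (torus n K) K (coordRing (V : Set (SpTuple g n K))) := ⟨fun _ _ _ => rfl⟩

/-- The inverses in the two actions cancel: `h` sends the entry at `(p, q)` to that of `h X h⁻¹`, so
it is scaled by the entry of `h` at `p` divided by the one at `q`. -/
theorem coord_mem_wtSpace (i p q) :
    coord (V : Set (SpTuple g n K)) i p q ∈ wtSpace (torusChar n K) (wt p - wt q) := by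
  intro h
  obtain ⟨l, rfl⟩ := (torusEquiv n K).surjective h
  apply coordRing_ext
  intro X
  have h1 : evalAt (V := (V : Set (SpTuple g n K))) X
      (torusEquiv n K l • coord (V : Set (SpTuple g n K)) i p q) =
      ((((torusEquiv n K l)⁻¹ • (X : V)) : V).1.mat i).1 p q := rfl
  have h2 := torusChar_neg (wt q) (torusEquiv n K l)
  rw [torusChar_wt, mul_eq_one_iff_eq_inv₀ (Units.ne_zero _)] at h2
  refine h1.trans ?_
  rw [map_smul, SetLike.val_smul, mat_smul, ← map_inv, torusEquiv_coe,
    diagSp_conj_apply, sub_eq_add_neg, ofAdd_add, map_mul, MonoidHom.mul_apply, torusChar_wt, h2]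
  have h3 : ∀ p, diagEntry l⁻¹ p = (diagEntry l p)⁻¹ := by
    intro p
    rcases p with p | p <;> simp [diagEntry]
  rw [h3, h3, smul_eq_mul, evalAt_coord, Units.val_inv_eq_inv_val, Units.val_inv_eq_inv_val, inv_inv]
  ring

theorem mem_invariants {f : coordRing (V : Set (SpTuple g n K))} :
    f ∈ invariants V ↔ ∀ h : torus n K, h • f = f := Iff.rfl

theorem mem_invariants_iff {f : coordRing (V : Set (SpTuple g n K))} :
    f ∈ invariants V ↔ f ∈ wtSpace (torusChar n K) 0 := (mem_wtSpace_zero _).symm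

theorem iSup_wtSpace_coordRing :
    ⨆ w, (wtSpace (torusChar n K) w : Submodule K (coordRing (V : Set (SpTuple g n K)))) = ⊤ :=
  iSup_wtSpace_eq_top (x := fun i : (Fin g ⊕ Fin g) × (Fin n ⊕ Fin n) × (Fin n ⊕ Fin n) =>
    coord (V : Set (SpTuple g n K)) i.1 i.2.1 i.2.2) (wt := fun i => wt i.2.1 - wt i.2.2)
    (fun i => coord_mem_wtSpace V i.1 i.2.1 i.2.2) (adjoin_coord _)

theorem invariants_fg [Infinite K] : (invariants V).FG :=
  fg_invariants (x := fun i : (Fin g ⊕ Fin g) × (Fin n ⊕ Fin n) × (Fin n ⊕ Fin n) =>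
    coord (V : Set (SpTuple g n K)) i.1 i.2.1 i.2.2) (wt := fun i => wt i.2.1 - wt i.2.2)
    (fun i => coord_mem_wtSpace V i.1 i.2.1 i.2.2) (adjoin_coord _) torusChar_injective
    (invariants V) fun _ => mem_invariants V

instance [Infinite K] : Algebra.FiniteType K (invariants V) :=
  (invariants V).fg_iff_finiteType.1 (invariants_fg V)

theorem isGoodQuotient_quotMap [Infinite K] : IsGoodQuotient (torusAction V) (quotMap V) := by
  obtain ⟨ρ, h1, h2⟩ := exists_reynolds (χ := torusChar n K) torusChar_injective
    (iSup_wtSpace_coordRing V) (invariants V) fun _ => mem_invariants V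
  exact isGoodQuotient_specMap Subtype.val_injective (fun h r => r.2 h) (fun a ha => ⟨⟨a, ha⟩, rfl⟩)
    ρ h1 h2

variable {V}

/-- The coordinates along a path from `p` to `q` multiply to a function of weight `wt p - wt q` that
is non-zero at `X`. A path back, from symmetry of reachability, gives the opposite weight. -/
theorem mem_ptWeights_of_edge {a : Fin n → Kˣ} (ha : IsGeneric a)
    (hV : (V : Set (SpTuple g n K)) ⊆ U g a) (X : (V : Set (SpTuple g n K)))
    {p q : Fin n ⊕ Fin n} (hpq : Reach X.1 p q) :
    wt p - wt q ∈ ptWeights (torusChar n K) (evalAt X) := by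
  have key : ∀ p q, Reach X.1 p q → ∃ f ∈ wtSpace (A := coordRing (V : Set (SpTuple g n K)))
      (torusChar n K) (wt p - wt q), evalAt X f ≠ 0 := by
    intro p q h
    induction h with
    | refl => exact ⟨1, by rw [sub_self]; exact SetLike.GradedOne.one_mem, by simp⟩
    | @tail r s _ h ih =>
      obtain ⟨f, hf, hf0⟩ := ih
      obtain ⟨i, hi⟩ := h
      refine ⟨f * coord _ i r s, ?_, ?_⟩
      · rw [← sub_add_sub_cancel _ (wt r)]
        exact SetLike.mul_mem_graded hf (coord_mem_wtSpace V i r s)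
      · rw [map_mul]
        exact mul_ne_zero hf0 hi
  obtain ⟨f, hf, hf0⟩ := key p q hpq
  obtain ⟨f', hf', hf0'⟩ := key q p (reach_symm ha (hV X.2) hpq)
  exact ⟨f, hf, f', by rwa [neg_sub], hf0, hf0'⟩

/-- Points with the same invariants lie in the same orbit. -/
theorem exists_smul_eq_of_same_invariants [IsAlgClosed K] {a : Fin n → Kˣ} (ha : IsGeneric a)
    (hV : (V : Set (SpTuple g n K)) ⊆ U g a) (X X' : V)
    (hinv : ∀ f ∈ invariants V, evalAt (V := (V : Set (SpTuple g n K))) X f =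
      evalAt (V := (V : Set (SpTuple g n K))) X' f) :
    ∃ h : torus n K, h • X = X' := by
  have hinv' : ∀ f ∈ wtSpace (A := coordRing (V : Set (SpTuple g n K))) (torusChar n K) 0,
      evalAt (V := (V : Set (SpTuple g n K))) X f = evalAt (V := (V : Set (SpTuple g n K))) X' f :=
    fun f hf => hinv f ((mem_invariants_iff V).2 hf)
  obtain ⟨c, hc⟩ := exists_character_of_same_invariants hinv'
  let l : Fin n → Kˣ := fun i => (c (Pi.single i 1)).toMul
  have hl : ∀ p, (c (wt p)).toMul = diagEntry l p := by
    intro p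
    rcases p with p | p <;> simp [wt, diagEntry, l]
  -- The inverse occurs because `h` acts by `h⁻¹ X h`: the entry at `(p, q)` has to be multiplied by
  -- the value of the character at `wt p - wt q`.
  refine ⟨torusEquiv n K l⁻¹, Subtype.ext (SpTuple.mat_ext fun i => Subtype.ext ?_)⟩
  ext p q
  rw [SetLike.val_smul, mat_smul, torusEquiv_coe, diagSp_conj_apply]
  have h3 : ∀ p, diagEntry l⁻¹ p = (diagEntry l p)⁻¹ := by
    intro p
    rcases p with p | p <;> simp [diagEntry]
  rw [h3, h3, Units.val_inv_eq_inv_val, Units.val_inv_eq_inv_val, inv_inv]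
  by_cases h : Edge X.1 p q
  · have h1 := hc _ (mem_ptWeights_of_edge ha hV X (Relation.ReflTransGen.single h)) _
      (coord_mem_wtSpace V i p q)
    rw [evalAt_coord, evalAt_coord, map_sub, toMul_sub, hl, hl, Units.val_div_eq_div_val] at h1
    rw [h1]
    ring
  · have h0 : (X.1.mat i).1 p q = 0 := by
      by_contra h0
      exact h ⟨i, h0⟩
    rw [h0, mul_zero, zero_mul]
    by_contra h1
    -- An entry that vanishes at `X` but not at `X'` is impossible: multiplied by a function of
    -- opposite weight that is non-zero at `X'`, it becomes an invariant separating the two points.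
    have h2 : Edge X'.1 p q := ⟨i, fun h => h1 h.symm⟩
    obtain ⟨_, _, f', hf', _, hf0⟩ :=
      mem_ptWeights_of_edge ha hV X' (Relation.ReflTransGen.single h2)
    have h4 := map_mul_eq_of_same_invariants hinv' (coord_mem_wtSpace V i p q) hf'
    rw [evalAt_coord, evalAt_coord, h0, zero_mul] at h4
    exact mul_ne_zero (fun h => h1 h.symm) hf0 h4.symm

end Quotient

theorem exists_evalAt_of_isMaximal [IsAlgClosed K] (a : Fin n → Kˣ) (H : Subgroup (torus n K))
    (m : Ideal (coordRing (UH g a H : Set (SpTuple g n K)))) (hm : m.IsMaximal) :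
    ∃ X : (UH g a H : Set (SpTuple g n K)), m = RingHom.ker (evalAt X) := by
  obtain ⟨ψ, rfl⟩ := exists_algHom_of_isMaximal (K := K) m hm
  obtain ⟨X, rfl⟩ := exists_eq_evalAt a H ψ
  exact ⟨X, rfl⟩

/-- The point of the scheme given by a tuple. -/
def closedPt {V : SubMulAction (torus n K) (SpTuple g n K)} (X : V) : affineVar V :=
  (⟨RingHom.ker (evalAt (V := (V : Set (SpTuple g n K))) X),
    (isMaximal_ker_evalAt (V := (V : Set (SpTuple g n K))) X).isPrime⟩ :
    PrimeSpectrum (coordRing (V : Set (SpTuple g n K))))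

theorem torusAction_closedPt {V : SubMulAction (torus n K) (SpTuple g n K)} (h : torus n K)
    (X : V) : (torusAction V h).asHom (closedPt X) = closedPt (h • X) := by
  apply PrimeSpectrum.ext
  ext f
  change evalAt (V := (V : Set (SpTuple g n K))) X (h⁻¹ • f) = 0 ↔
    evalAt (V := (V : Set (SpTuple g n K))) (h • X : V) f = 0
  have : evalAt (V := (V : Set (SpTuple g n K))) X (h⁻¹ • f) = f.1 (h⁻¹⁻¹ • X : V) := rfl
  rw [this, inv_inv]
  rfl

theorem isGeometricQuotient_quotMap [IsAlgClosed K] {a : Fin n → Kˣ} (ha : IsGeneric a)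
    (H : Subgroup (torus n K)) :
    IsGeometricQuotient (torusAction (UH g a H)) (quotMap (UH g a H)) := by
  have hgood := isGoodQuotient_quotMap (UH g a H)
  refine { hgood with fiber_eq_orbit := fun y hy => ?_ }
  obtain ⟨x₀, hx₀⟩ := hgood.surjective y
  have hymax : (PrimeSpectrum.asIdeal y).IsMaximal :=
    (PrimeSpectrum.isClosed_singleton_iff_isMaximal y).1 hy
  obtain ⟨m, hm, hle⟩ := Ideal.exists_le_maximal _ x₀.isPrime.ne_top
  obtain ⟨X, rfl⟩ := exists_evalAt_of_isMaximal a H m hm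
  -- A point over `y` specialises to a closed point `X`, which still lies over `y` because `y` is
  -- maximal.
  have hX : quotMap (UH g a H) (closedPt (V := UH g a H) X) = y := by
    apply PrimeSpectrum.ext
    have h1 : PrimeSpectrum.asIdeal y ≤
        (PrimeSpectrum.asIdeal (quotMap (UH g a H) (closedPt (V := UH g a H) X))) := by
      rw [← hx₀]
      exact Ideal.comap_mono hle
    exact (hymax.eq_of_le (PrimeSpectrum.isPrime _).ne_top h1).symm
  refine ⟨closedPt (V := UH g a H) X, Set.Subset.antisymm ?_ ?_⟩
  · rintro x ⟨hx, hxy⟩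
    obtain ⟨X', hX'⟩ := exists_evalAt_of_isMaximal a H _
      ((PrimeSpectrum.isClosed_singleton_iff_isMaximal x).1 hx)
    have hxX' : x = closedPt (V := UH g a H) X' := PrimeSpectrum.ext hX'
    obtain ⟨h, hh⟩ := exists_smul_eq_of_same_invariants ha (UH_subset_U a H)
      (X : UH g a H) X' fun f hf => by
        -- The invariant `f - f(X)` lies in the maximal ideal of the common image, so it vanishes at
        -- `X'` as well.
        let r : invariants (UH g a H) := ⟨f, hf⟩ - algebraMap K _ (evalAt X f)
        have h1 : r ∈ PrimeSpectrum.asIdeal (quotMap (UH g a H) (closedPt (V := UH g a H) X)) := by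
          change evalAt X (f - algebraMap K _ (evalAt X f)) = 0
          rw [map_sub, AlgHom.commutes, Algebra.algebraMap_self_apply, sub_self]
        rw [hX, ← hxy, hxX'] at h1
        change evalAt X' (f - algebraMap K _ (evalAt X f)) = 0 at h1
        rw [map_sub, AlgHom.commutes, Algebra.algebraMap_self_apply, sub_eq_zero] at h1
        exact h1.symm
    exact ⟨h, by rw [hxX', ← hh]; exact torusAction_closedPt h _⟩
  · rintro _ ⟨h, rfl⟩
    refine ⟨?_, ?_⟩
    · dsimp only
      rw [torusAction_closedPt]
      exact (PrimeSpectrum.isClosed_singleton_iff_isMaximal _).2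
        (isMaximal_ker_evalAt (V := (UH g a H : Set (SpTuple g n K))) _)
    · exact (congrArg (fun f => f (closedPt (V := UH g a H) X)) (hgood.invariant h)).trans hX

end

noncomputable section

/-! ### The dimension of the representation variety is at least the expected one -/

theorem sym2_out_eq {α : Type*} (p q : α) : Quot.out s(p, q) = (p, q) ∨ Quot.out s(p, q) = (q, p) := by
  have h : s((Quot.out s(p, q)).1, (Quot.out s(p, q)).2) = s((p, q).1, (p, q).2) := Quot.out_eq _
  exact Sym2.mk_eq_mk_iff.1 h

section Equations

variable {l R : Type*} [Fintype l] [DecidableEq l] [CommRing R] {g : ℕ}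

/-- The expression which is the inverse of `M` when `M` is symplectic. -/
def sstar (M : Matrix (l ⊕ l) (l ⊕ l) R) : Matrix (l ⊕ l) (l ⊕ l) R :=
  -Matrix.J l R * M.transpose * Matrix.J l R

/-- The product of the commutators, as a polynomial expression. -/
def matCommP (N : Fin g ⊕ Fin g → Matrix (l ⊕ l) (l ⊕ l) R) : Matrix (l ⊕ l) (l ⊕ l) R :=
  (List.ofFn fun i => N (Sum.inl i) * N (Sum.inr i) * sstar (N (Sum.inl i)) *
    sstar (N (Sum.inr i))).prod

theorem sstar_coe (M : Matrix.symplecticGroup l R) : sstar M.1 = (M⁻¹).1 :=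
  (SymplecticGroup.coe_inv M).symm

theorem matCommP_coe (M : Fin g ⊕ Fin g → Matrix.symplecticGroup l R) :
    matCommP (fun i => (M i).1) =
      (commP (fun i => M (Sum.inl i)) (fun i => M (Sum.inr i))).1 := by
  rw [commP, matCommP]
  refine Eq.trans ?_ (map_list_prod (Matrix.symplecticGroup l R).subtype _).symm
  rw [List.map_ofFn]
  simp only [sstar_coe]
  rfl

theorem map_sstar {S : Type*} [CommRing S] (f : R →+* S) (M : Matrix (l ⊕ l) (l ⊕ l) R) :
    (sstar M).map f = sstar (M.map f) := by
  rw [sstar, sstar, Matrix.map_mul, Matrix.map_mul, Matrix.map_neg _ (map_neg f), Matrix.map_J,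
    Matrix.transpose_map]

theorem map_matCommP {S : Type*} [CommRing S] (f : R →+* S)
    (N : Fin g ⊕ Fin g → Matrix (l ⊕ l) (l ⊕ l) R) :
    (matCommP N).map f = matCommP fun i => (N i).map f := by
  change f.mapMatrix _ = _
  rw [matCommP, matCommP, map_list_prod, List.map_ofFn]
  congr 2
  funext i
  simp only [Function.comp, map_mul, RingHom.mapMatrix_apply, map_sstar]

/-- The matrix `N J Nᵗ - J`, which is alternating. -/
def spDefect (N : Matrix (l ⊕ l) (l ⊕ l) R) : Matrix (l ⊕ l) (l ⊕ l) R :=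
  N * Matrix.J l R * N.transpose - Matrix.J l R

theorem spDefect_apply_self (N : Matrix (l ⊕ l) (l ⊕ l) R) (p : l ⊕ l) : spDefect N p p = 0 := by
  rw [spDefect, Matrix.sub_apply, Matrix.mul_apply, Fintype.sum_sum_type]
  have h1 : Matrix.J l R p p = 0 := by rcases p with p | p <;> simp [Matrix.J]
  rw [h1, sub_zero, ← Finset.sum_add_distrib]
  refine Finset.sum_eq_zero fun i _ => ?_
  rw [mul_J_apply, mul_J_apply]
  simp only [Matrix.transpose_apply, sgn, Sum.elim_inl, Sum.elim_inr, Sum.swap_inl, Sum.swap_inr]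
  ring

theorem spDefect_apply_swap (N : Matrix (l ⊕ l) (l ⊕ l) R) (p q : l ⊕ l) :
    spDefect N q p = -spDefect N p q := by
  have : (spDefect N).transpose = -spDefect N := by
    rw [spDefect, Matrix.transpose_sub, Matrix.transpose_mul, Matrix.transpose_mul,
      Matrix.transpose_transpose, Matrix.J_transpose]
    simp only [Matrix.mul_neg, Matrix.neg_mul, Matrix.mul_assoc]
    abel
  exact congrFun (congrFun this p) q

/-- The matrix `J S + (J S)ᵗ`, which is symmetric and vanishes if `S` is a symplectic involution. -/
def invDefect (S : Matrix (l ⊕ l) (l ⊕ l) R) : Matrix (l ⊕ l) (l ⊕ l) R :=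
  Matrix.J l R * S + (Matrix.J l R * S).transpose

theorem invDefect_apply_swap (S : Matrix (l ⊕ l) (l ⊕ l) R) (p q : l ⊕ l) :
    invDefect S q p = invDefect S p q := by
  rw [invDefect, Matrix.add_apply, Matrix.add_apply, Matrix.transpose_apply, Matrix.transpose_apply,
    add_comm]

/-- The equations for a tuple of matrices: the matrices are symplectic and the product of their
commutators, multiplied by the inverse of `ξ`, is an involution. -/
def eqs (x : Matrix (l ⊕ l) (l ⊕ l) R) (N : Fin g ⊕ Fin g → Matrix (l ⊕ l) (l ⊕ l) R) :
    ((Fin g ⊕ Fin g) × {z : Sym2 (l ⊕ l) // ¬ z.IsDiag}) ⊕ Sym2 (l ⊕ l) → R :=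
  -- One equation for each unordered pair suffices: `spDefect` is alternating, which also removes
  -- the diagonal, and `invDefect` is symmetric. `Quot.out` chooses the order of the pair.
  Sum.elim (fun i => spDefect (N i.1) (Quot.out i.2.1).1 (Quot.out i.2.1).2)
    fun z => invDefect (x * matCommP N) (Quot.out z).1 (Quot.out z).2

theorem map_eqs {S : Type*} [CommRing S] (f : R →+* S) (x : Matrix (l ⊕ l) (l ⊕ l) R)
    (N : Fin g ⊕ Fin g → Matrix (l ⊕ l) (l ⊕ l) R) (i) :
    f (eqs x N i) = eqs (x.map f) (fun i => (N i).map f) i := by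
  have h1 : ∀ M : Matrix (l ⊕ l) (l ⊕ l) R, (spDefect M).map f = spDefect (M.map f) := by
    intro M
    rw [spDefect, spDefect, Matrix.map_sub _ (map_sub f), Matrix.map_mul, Matrix.map_mul,
      Matrix.map_J, Matrix.transpose_map]
  have h2 : ∀ M : Matrix (l ⊕ l) (l ⊕ l) R, (invDefect M).map f = invDefect (M.map f) := by
    intro M
    rw [invDefect, invDefect, Matrix.map_add _ (map_add f), Matrix.transpose_map, Matrix.map_mul,
      Matrix.map_J]
  rcases i with i | z
  · simp only [eqs, Sum.elim_inl, ← h1, Matrix.map_apply]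
  · simp only [eqs, Sum.elim_inr, ← map_matCommP, ← Matrix.map_mul, ← h2, Matrix.map_apply]

theorem mem_symplecticGroup_of_eqs {x : Matrix (l ⊕ l) (l ⊕ l) R}
    {N : Fin g ⊕ Fin g → Matrix (l ⊕ l) (l ⊕ l) R} (h : ∀ i, eqs x N i = 0) (i) :
    N i ∈ Matrix.symplecticGroup l R := by
  rw [SymplecticGroup.mem_iff, ← sub_eq_zero]
  change spDefect (N i) = 0
  ext p q
  rw [Matrix.zero_apply]
  by_cases hpq : p = q
  · rw [hpq, spDefect_apply_self]
  · have h1 := h (Sum.inl (i, ⟨s(p, q), by simpa using hpq⟩))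
    change spDefect (N i) (Quot.out s(p, q)).1 (Quot.out s(p, q)).2 = 0 at h1
    rcases sym2_out_eq p q with h2 | h2
    · rw [h2] at h1
      exact h1
    · rw [h2, spDefect_apply_swap, neg_eq_zero] at h1
      exact h1

/-- The inverse of a symplectic `S` is `-J Sᵗ J`, so antisymmetry of `J S` says precisely that `S⁻¹
= S`. -/
theorem inv_eq_self_of_eqs {x : Matrix.symplecticGroup l R}
    {N : Fin g ⊕ Fin g → Matrix.symplecticGroup l R} (h : ∀ i, eqs x.1 (fun i => (N i).1) i = 0) :
    (x * commP (fun i => N (Sum.inl i)) (fun i => N (Sum.inr i)))⁻¹ =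
      x * commP (fun i => N (Sum.inl i)) (fun i => N (Sum.inr i)) := by
  set s := x * commP (fun i => N (Sum.inl i)) (fun i => N (Sum.inr i)) with hs
  have h0 : invDefect s.1 = 0 := by
    have hs1 : s.1 = x.1 * matCommP fun i => (N i).1 := by rw [matCommP_coe]; rfl
    ext p q
    have h1 := h (Sum.inr s(p, q))
    change invDefect (x.1 * matCommP fun i => (N i).1) (Quot.out s(p, q)).1
      (Quot.out s(p, q)).2 = 0 at h1
    rw [← hs1] at h1
    rcases sym2_out_eq p q with h2 | h2
    · rw [h2] at h1
      exact h1
    · rw [h2, invDefect_apply_swap] at h1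
      exact h1
  apply Subtype.ext
  rw [SymplecticGroup.coe_inv]
  rw [invDefect, Matrix.transpose_mul, Matrix.J_transpose, Matrix.mul_neg, ← sub_eq_add_neg,
    sub_eq_zero] at h0
  rw [Matrix.mul_assoc, ← h0, ← Matrix.mul_assoc, Matrix.neg_mul, Matrix.J_squared, neg_neg,
    Matrix.one_mul]

theorem eqs_eq_zero {x : Matrix.symplecticGroup l R}
    {N : Fin g ⊕ Fin g → Matrix.symplecticGroup l R}
    (h : x * commP (fun i => N (Sum.inl i)) (fun i => N (Sum.inr i)) = 1) (i) :
    eqs x.1 (fun i => (N i).1) i = 0 := by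
  rcases i with i | z
  · have : spDefect (N i.1).1 = 0 := sub_eq_zero.2 (SymplecticGroup.mem_iff.1 (N i.1).2)
    simp [eqs, this]
  · have h1 : x.1 * matCommP (fun i => (N i).1) = 1 := by
      rw [matCommP_coe]
      exact congrArg Subtype.val h
    have : invDefect (1 : Matrix (l ⊕ l) (l ⊕ l) R) = 0 := by
      rw [invDefect, Matrix.mul_one, Matrix.J_transpose, add_neg_cancel]
    simp [eqs, h1, this]

/-- `(1 + S)(1 - S) = 0`, and the adjugate of `1 + S` turns the first factor into a non-zero scalar.
At `S = 1` the determinant is a power of 2, so this condition isolates the solutions wanted among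
all involutions. -/
theorem eq_one_of_inv_eq_self [IsDomain R] {s : Matrix.symplecticGroup l R} (h : s⁻¹ = s)
    (hdet : (1 + s.1).det ≠ 0) : s = 1 := by
  have h1 : s.1 * s.1 = 1 := by
    have := mul_inv_cancel s
    rw [h] at this
    exact congrArg Subtype.val this
  have h2 : (1 + s.1) * (1 - s.1) = 0 := by
    rw [mul_sub, Matrix.mul_one, add_mul, h1, Matrix.one_mul, add_comm, sub_self]
  have h3 := congrArg (fun M => (1 + s.1).adjugate * M) h2
  simp only [← Matrix.mul_assoc, Matrix.adjugate_mul, Matrix.smul_mul, Matrix.one_mul,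
    Matrix.mul_zero] at h3
  have h4 := (smul_eq_zero.1 h3).resolve_left hdet
  exact Subtype.ext (sub_eq_zero.1 h4).symm

theorem card_eqs : Nat.card (((Fin g ⊕ Fin g) × {z : Sym2 (l ⊕ l) // ¬ z.IsDiag}) ⊕ Sym2 (l ⊕ l)) =
    2 * g * (Fintype.card l * (2 * Fintype.card l - 1)) +
      Fintype.card l * (2 * Fintype.card l + 1) := by
  classical
  rw [Nat.card_eq_fintype_card, Fintype.card_sum, Fintype.card_prod, Sym2.card_subtype_not_diag,
    Sym2.card, Fintype.card_sum, Fintype.card_sum, Fintype.card_fin, Nat.choose_two_right,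
    Nat.choose_two_right, ← two_mul, ← two_mul, Nat.add_sub_cancel, mul_assoc 2 (Fintype.card l),
    Nat.mul_div_cancel_left _ two_pos, mul_comm (2 * Fintype.card l + 1),
    mul_assoc 2 (Fintype.card l), Nat.mul_div_cancel_left _ two_pos]

end Equations

variable {n g : ℕ} {K : Type u} [Field K]

/-- The index set of the entries of `2 g` matrices. -/
abbrev EntryIdx (g n : ℕ) : Type := (Fin g ⊕ Fin g) × (Fin n ⊕ Fin n) × (Fin n ⊕ Fin n)

/-- The presentation of the coordinate ring. -/
def presentation (V : Set (SpTuple g n K)) : MvPolynomial (EntryIdx g n) K →ₐ[K] coordRing V :=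
  MvPolynomial.aeval fun i => coord V i.1 i.2.1 i.2.2

theorem presentation_surjective (V : Set (SpTuple g n K)) :
    Function.Surjective (presentation V) := by
  rw [← AlgHom.range_eq_top, presentation, ← Algebra.adjoin_range_eq_range_aeval]
  exact adjoin_coord _

/-- The images of the generic matrices. -/
def genMat {R : Type*} [CommRing R] [Algebra K R] (f : MvPolynomial (EntryIdx g n) K →ₐ[K] R)
    (i : Fin g ⊕ Fin g) : Matrix (Fin n ⊕ Fin n) (Fin n ⊕ Fin n) R :=
  Matrix.of fun p q => f (MvPolynomial.X (i, p, q))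

theorem genMat_presentation (V : Set (SpTuple g n K)) :
    genMat (presentation V) = fun i => (univ V i).1 := by
  ext i p q
  simp [genMat, presentation, univ]

/-- The equations for the representation variety, up to an open and closed part. -/
def genEqs (g : ℕ) (a : Fin n → Kˣ) := eqs (g := g)
  (spMap (algebraMap K (MvPolynomial (EntryIdx g n) K)) (diagSp a⁻¹)).1 (genMat (AlgHom.id K _))

theorem map_genEqs {R : Type*} [CommRing R] [Algebra K R]
    (f : MvPolynomial (EntryIdx g n) K →ₐ[K] R) (a : Fin n → Kˣ) (i) :
    f (genEqs g a i) = eqs (spMap (algebraMap K R) (diagSp a⁻¹)).1 (genMat f) i := by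
  refine (map_eqs (f : MvPolynomial (EntryIdx g n) K →+* R) _ _ i).trans ?_
  congr 1
  ext p q
  exact f.commutes _

/-- The determinant of `1 + S`. -/
def genDet (g : ℕ) (a : Fin n → Kˣ) : MvPolynomial (EntryIdx g n) K :=
  (1 + (spMap (algebraMap K (MvPolynomial (EntryIdx g n) K)) (diagSp a⁻¹)).1 *
    matCommP (genMat (AlgHom.id K _))).det

theorem map_genDet {R : Type*} [CommRing R] [Algebra K R]
    (f : MvPolynomial (EntryIdx g n) K →ₐ[K] R) (a : Fin n → Kˣ) :
    f (genDet g a) =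
      (1 + (spMap (algebraMap K R) (diagSp a⁻¹)).1 * matCommP (genMat f)).det := by
  refine (RingHom.map_det (f : MvPolynomial (EntryIdx g n) K →+* R) _).trans ?_
  congr 1
  rw [RingHom.mapMatrix_apply, Matrix.map_add _ (map_add _), Matrix.map_one _ (map_zero _)
    (map_one _), Matrix.map_mul, map_matCommP]
  congr 2
  ext p q
  exact f.commutes _

theorem spMap_inv_mul (R : Type*) [CommRing R] [Algebra K R] (a : Fin n → Kˣ) :
    spMap (algebraMap K R) (diagSp a⁻¹) * spMap (algebraMap K R) (diagSp a) = 1 := by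
  rw [← map_mul, ← map_mul, inv_mul_cancel, map_one, map_one]

theorem presentation_genEqs (a : Fin n → Kˣ) (i) : presentation (U g a : Set (SpTuple g n K)) (genEqs g a i) = 0 := by
  rw [map_genEqs]
  rw [genMat_presentation]
  apply eqs_eq_zero
  rw [commP_univ subset_rfl, spMap_inv_mul]

theorem presentation_genDet (a : Fin n → Kˣ) :
    presentation (U g a : Set (SpTuple g n K)) (genDet g a) = 2 ^ (n + n) := by
  rw [map_genDet]
  rw [genMat_presentation]
  rw [matCommP_coe, commP_univ subset_rfl]
  have h2 := congrArg Subtype.val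
    (spMap_inv_mul (coordRing (U g a : Set (SpTuple g n K))) a)
  change _ * _ = (1 : Matrix _ _ _) at h2
  rw [h2, ← two_smul (coordRing (U g a : Set (SpTuple g n K))), Matrix.det_smul,
    Matrix.det_one, mul_one, Fintype.card_sum, Fintype.card_fin]

/-- A polynomial vanishing on `U` vanishes at its points with values in reduced algebras. -/
theorem eq_zero_of_presentation_eq_zero [IsAlgClosed K] {a : Fin n → Kˣ} {D : Type*} [CommRing D]
    [Algebra K D] [IsReduced D] (π : MvPolynomial (EntryIdx g n) K →ₐ[K] D)
    (hπ : Function.Surjective π) (M : Fin g ⊕ Fin g → Matrix.symplecticGroup (Fin n) D)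
    (hM : ∀ i, (M i).1 = genMat π i)
    (hcomm : commP (fun i => M (Sum.inl i)) (fun i => M (Sum.inr i)) =
      spMap (algebraMap K D) (diagSp a)) {f : MvPolynomial (EntryIdx g n) K}
    (hf : presentation (U g a : Set (SpTuple g n K)) f = 0) : π f = 0 := by
  have hfin : Algebra.FiniteType K D := Algebra.FiniteType.of_surjective π hπ
  have hJac : IsJacobsonRing D := isJacobsonRing_of_finiteType (A := K)
  by_contra hf0
  -- In a reduced Jacobson ring a non-zero element avoids some maximal ideal, and the `K`-point of
  -- that ideal is a tuple in `U`.
  have hJ : (⊥ : Ideal D).jacobson = ⊥ :=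
    IsJacobsonRing.out' ⊥ (Ideal.isRadical_bot_iff.2 inferInstance)
  have h1 : π f ∉ (⊥ : Ideal D).jacobson := by rwa [hJ]
  rw [Ideal.jacobson, Ideal.mem_sInf] at h1
  push Not at h1
  obtain ⟨m, ⟨-, hm⟩, hfm⟩ := h1
  obtain ⟨ψ, rfl⟩ := exists_algHom_of_isMaximal (K := K) m hm
  let X : SpTuple g n K := ⟨fun i => spMap (ψ : D →+* K) (M (Sum.inl i)),
    fun i => spMap (ψ : D →+* K) (M (Sum.inr i))⟩
  have hX : X ∈ U g a := by
    have := congrArg (spMap (ψ : D →+* K)) hcomm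
    rw [map_commP] at this
    refine this.trans (Subtype.ext ?_)
    ext p q
    simp [spMap_apply]
  have h2 : (evalAt (V := (U g a : Set (SpTuple g n K))) ⟨X, hX⟩).comp (presentation _) =
      ψ.comp π := by
    apply MvPolynomial.algHom_ext
    rintro ⟨i, p, q⟩
    have h3 : ψ (π (MvPolynomial.X (i, p, q))) = (X.mat i).1 p q := by
      have h4 : π (MvPolynomial.X (i, p, q)) = (M i).1 p q := by rw [hM]; rfl
      rw [h4]
      rcases i with i | i <;> rfl
    rw [AlgHom.comp_apply, AlgHom.comp_apply, h3, presentation, MvPolynomial.aeval_X, evalAt_coord]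
  apply hfm
  rw [RingHom.mem_ker]
  have h5 := DFunLike.congr_fun h2 f
  rw [AlgHom.comp_apply, hf, map_zero] at h5
  exact h5.symm

/-- A component of the representation variety is a component of the variety defined by the
equations. -/
theorem comap_presentation_mem_minimalPrimes [IsAlgClosed K] (hK : (2 : K) ≠ 0) {a : Fin n → Kˣ}
    {P : Ideal (coordRing (U g a : Set (SpTuple g n K)))} (hP : P ∈ minimalPrimes _) :
    P.comap (presentation (U g a : Set (SpTuple g n K))) ∈
      (Ideal.span (Set.range (genEqs g a))).minimalPrimes := by
  have hPprime : P.IsPrime := hP.1.1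
  refine ⟨⟨Ideal.IsPrime.comap _, ?_⟩, ?_⟩
  · rw [Ideal.span_le]
    rintro _ ⟨i, rfl⟩
    change presentation _ _ ∈ P
    rw [presentation_genEqs]
    exact zero_mem _
  rintro Q ⟨hQ, hle⟩ hQP
  -- Modulo `Q` the generic matrices are symplectic and `S` is an involution. Moreover `det(1 + S)`
  -- is not in `Q`, as it becomes a unit modulo the larger prime coming from `P`. Hence `S = 1`
  -- modulo `Q`, and every polynomial vanishing on `U` lies in `Q`.
  have hker : RingHom.ker (presentation (U g a : Set (SpTuple g n K))) ≤ Q := by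
    let π : MvPolynomial (EntryIdx g n) K →ₐ[K] (MvPolynomial (EntryIdx g n) K ⧸ Q) :=
      Ideal.Quotient.mkₐ K Q
    have hπ : ∀ f, π f = 0 ↔ f ∈ Q := fun f => Ideal.Quotient.eq_zero_iff_mem
    have heq : ∀ i, eqs (spMap (algebraMap K _) (diagSp a⁻¹)).1 (genMat π) i = 0 := by
      intro i
      rw [← map_genEqs]
      exact (hπ _).2 (hle (Ideal.subset_span ⟨i, rfl⟩))
    let M : Fin g ⊕ Fin g → Matrix.symplecticGroup (Fin n) (MvPolynomial (EntryIdx g n) K ⧸ Q) :=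
      fun i => ⟨genMat π i, mem_symplecticGroup_of_eqs heq i⟩
    have hone : spMap (algebraMap K _) (diagSp a⁻¹) *
        commP (fun i => M (Sum.inl i)) (fun i => M (Sum.inr i)) = 1 := by
      apply eq_one_of_inv_eq_self (inv_eq_self_of_eqs (N := M) heq)
      have h2 : (spMap (algebraMap K _) (diagSp a⁻¹) *
          commP (fun i => M (Sum.inl i)) (fun i => M (Sum.inr i))).1 =
          (spMap (algebraMap K _) (diagSp a⁻¹)).1 * matCommP (genMat π) :=
        congrArg ((spMap (algebraMap K _) (diagSp a⁻¹)).1 * ·) (matCommP_coe M).symm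
      rw [h2, ← map_genDet]
      intro h0
      have h3 : genDet g a ∈ P.comap (presentation (U g a : Set (SpTuple g n K))) :=
        hQP ((hπ _).1 h0)
      rw [Ideal.mem_comap, presentation_genDet] at h3
      refine hPprime.ne_top (Ideal.eq_top_of_isUnit_mem _ h3 ?_)
      have := (IsUnit.mk0 _ (pow_ne_zero (n + n) hK)).map
        (algebraMap K (coordRing (U g a : Set (SpTuple g n K))))
      rwa [map_pow, map_ofNat] at this
    intro f hf
    refine (hπ f).1 (eq_zero_of_presentation_eq_zero (a := a) π (Ideal.Quotient.mkₐ_surjective K Q) M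
      (fun _ => rfl) ?_ hf)
    rw [← mul_right_inj, hone]
    exact (spMap_inv_mul _ _).symm
  have h1 : (Q.map (presentation (U g a : Set (SpTuple g n K)))).IsPrime :=
    Ideal.map_isPrime_of_surjective (presentation_surjective _) hker
  have h2 : (Q.map (presentation (U g a : Set (SpTuple g n K)))) ≤ P := Ideal.map_le_iff_le_comap.2 hQP
  have h3 := hP.2 ⟨h1, bot_le⟩ h2
  have h4 := Ideal.comap_mono (f := presentation (U g a : Set (SpTuple g n K))) h3
  rwa [Ideal.comap_map_of_surjective' _ (presentation_surjective _), sup_eq_left.2 hker] at h4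

/-- The count of unknowns and equations: each of the `2g` matrices contributes `(2n)² - n(2n-1) =
n(2n+1)`, and the last condition costs `n(2n+1)`. The additive form avoids truncated subtraction. -/
theorem le_of_comap_mem_minimalPrimes {A : Type u} [CommRing A] [Algebra K A] {a : Fin n → Kˣ}
    (f : MvPolynomial (EntryIdx g n) K →ₐ[K] A) (hf : Function.Surjective f) (P : Ideal A)
    (hP : P.comap f ∈ (Ideal.span (Set.range (genEqs g a))).minimalPrimes) {s : ℕ}
    (hs : Algebra.trdeg K (A ⧸ P) = s) :
    2 * g * (n * (2 * n + 1)) ≤ n * (2 * n + 1) + s := by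
  let φ : MvPolynomial (EntryIdx g n) K →ₐ[K] (A ⧸ P) := (Ideal.Quotient.mkₐ K P).comp f
  have hφ : Function.Surjective φ := (Ideal.Quotient.mkₐ_surjective K P).comp hf
  have hker : RingHom.ker φ ∈ (Ideal.span (Set.range (genEqs g a))).minimalPrimes := by
    have : RingHom.ker φ = P.comap f := Ideal.ext fun f => Ideal.Quotient.eq_zero_iff_mem
    rw [this]
    exact hP
  have h1 := card_le_add_trdeg_of_mem_minimalPrimes φ hφ hker
  rw [card_eqs, hs] at h1
  have h2 : Nat.card (EntryIdx g n) = 2 * g * ((2 * n) * (2 * n)) := by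
    rw [Nat.card_eq_fintype_card]
    simp [EntryIdx]
    ring
  rw [h2, Fintype.card_fin] at h1
  have h3 : 2 * g * ((2 * n) * (2 * n)) ≤
    2 * g * (n * (2 * n - 1)) + n * (2 * n + 1) + s := by exact_mod_cast h1
  have h4 : 2 * g * ((2 * n) * (2 * n)) =
      2 * g * (n * (2 * n + 1)) + 2 * g * (n * (2 * n - 1)) := by
    rcases Nat.eq_zero_or_pos n with rfl | hn
    · simp
    · obtain ⟨k, rfl⟩ : ∃ k, n = k + 1 := ⟨n - 1, by omega⟩
      rw [show 2 * (k + 1) - 1 = 2 * k + 1 by omega]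
      ring
  omega

/-- Each irreducible component of the representation variety has at least the expected dimension. -/
theorem le_trdeg_of_mem_minimalPrimes [IsAlgClosed K] (hK : (2 : K) ≠ 0) {a : Fin n → Kˣ}
    {P : Ideal (coordRing (U g a : Set (SpTuple g n K)))} (hP : P ∈ minimalPrimes _) {s : ℕ}
    (hs : Algebra.trdeg K (coordRing (U g a : Set (SpTuple g n K)) ⧸ P) = s) :
    2 * g * (n * (2 * n + 1)) ≤ n * (2 * n + 1) + s :=
  le_of_comap_mem_minimalPrimes (presentation (U g a : Set (SpTuple g n K))) (presentation_surjective _) P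
    (comap_presentation_mem_minimalPrimes hK hP) hs

end

noncomputable section

/-! ### The differential of the product of commutators -/

section Differential

variable {K W G : Type*} [Field K] [AddCommGroup W] [Module K W] [Group G] (ρ : G →* Module.End K W)

/-- The differential of `(A, B) ↦ [A : B]`, in terms of crossed homomorphisms. -/
def dCommOne (A B : G) : W × W →ₗ[K] W :=
  (1 - ρ (A * B * A⁻¹)) ∘ₗ LinearMap.fst K W W +
    (ρ A - ρ (A * B * A⁻¹ * B⁻¹)) ∘ₗ LinearMap.snd K W W

theorem dCommOne_apply (A B : G) (w : W × W) : dCommOne ρ A B w =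
    (w.1 - ρ (A * B * A⁻¹) w.1) + (ρ A w.2 - ρ (A * B * A⁻¹ * B⁻¹) w.2) := rfl

/-- The differential of the product of commutators, in terms of crossed homomorphisms. -/
def dCommP : ∀ {g : ℕ} (_ _ : Fin g → G), (Fin g → W × W) →ₗ[K] W
  | 0, _, _ => 0
  | _ + 1, A, B => dCommOne ρ (A 0) (B 0) ∘ₗ LinearMap.proj 0 +
      ρ (A 0 * B 0 * (A 0)⁻¹ * (B 0)⁻¹) ∘ₗ dCommP (fun i => A i.succ) (fun i => B i.succ) ∘ₗ
        LinearMap.pi fun i => LinearMap.proj i.succ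

theorem dCommP_succ {g : ℕ} (A B : Fin (g + 1) → G) (w : Fin (g + 1) → W × W) :
    dCommP ρ A B w = dCommOne ρ (A 0) (B 0) (w 0) + ρ (A 0 * B 0 * (A 0)⁻¹ * (B 0)⁻¹)
      (dCommP ρ (fun i => A i.succ) (fun i => B i.succ) fun i => w i.succ) := rfl

variable {ρ}

section Crossed

variable {Γ : Type*} [Group Γ] {π : Γ →* G} {d : Γ → W}

theorem crossed_one (hd : ∀ x y, d (x * y) = d x + ρ (π x) (d y)) : d 1 = 0 := by
  have := hd 1 1
  rw [mul_one, map_one, map_one, Module.End.one_apply] at this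
  exact left_eq_add.1 this

theorem crossed_mul_inv (hd : ∀ x y, d (x * y) = d x + ρ (π x) (d y)) (x y : Γ) :
    d (x * y⁻¹) = d x - ρ (π (x * y⁻¹)) (d y) := by
  rw [eq_sub_iff_add_eq, ← hd, inv_mul_cancel_right]

/-- The cocycle rule determines `d` on a product of commutators from its values on the factors. With
the logarithmic derivative for `d`, it differentiates the defining equation of `U`. -/
theorem crossed_commP (hd : ∀ x y, d (x * y) = d x + ρ (π x) (d y)) {g : ℕ} (A B : Fin g → Γ) :
    d (commP A B) = dCommP ρ (fun i => π (A i)) (fun i => π (B i)) fun i => (d (A i), d (B i)) := by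
  induction g with
  | zero => exact crossed_one hd
  | succ g ih =>
    rw [commP_succ, dCommP_succ, hd, ih, crossed_mul_inv hd, crossed_mul_inv hd, hd, dCommOne_apply]
    simp only [map_mul, map_inv]
    abel_nf

end Crossed

/-- The group of the elements which preserve a linear form. -/
def formStab (ρ : G →* Module.End K W) (f : W →ₗ[K] K) : Subgroup G where
  carrier := {x | f ∘ₗ ρ x = f}
  one_mem' := by
    rw [Set.mem_ofPred_eq, map_one]
    rfl
  mul_mem' {x y} hx hy := by
    rw [Set.mem_ofPred_eq, map_mul, Module.End.mul_eq_comp, ← LinearMap.comp_assoc, hx, hy]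
  inv_mem' {x} hx := by
    rw [Set.mem_ofPred_eq] at *
    conv_lhs => rw [← hx]
    rw [LinearMap.comp_assoc, ← Module.End.mul_eq_comp, ← map_mul, mul_inv_cancel, map_one]
    rfl

theorem mem_formStab_iff {f : W →ₗ[K] K} {x : G} : x ∈ formStab ρ f ↔ ∀ w, f (ρ x w) = f w :=
  LinearMap.ext_iff

/-- A linear form vanishing on the image of the differential is invariant. -/
theorem mem_formStab_of_dCommP_eq_zero {f : W →ₗ[K] K} {g : ℕ} {A B : Fin g → G}
    (h : ∀ w, f (dCommP ρ A B w) = 0) (i) : A i ∈ formStab ρ f ∧ B i ∈ formStab ρ f := by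
  induction g with
  | zero => exact i.elim0
  | succ g ih =>
    -- Vary only the first `A`-component; below, only the first `B`-component, twisted by `(A 0)⁻¹`.
    have h1 : A 0 * B 0 * (A 0)⁻¹ ∈ formStab ρ f := by
      rw [mem_formStab_iff]
      intro w
      have := h (Pi.single 0 (w, 0))
      rw [dCommP_succ, dCommOne_apply] at this
      have h0 : (fun i : Fin g => (Pi.single 0 (w, 0) : Fin (g + 1) → W × W) i.succ) = 0 := by
        funext i; simp
      rw [h0] at this
      simp only [Pi.single_eq_same, map_zero, sub_self, add_zero, map_sub] at this
      exact (sub_eq_zero.1 this).symm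
    have h2 : A 0 * B 0 * (A 0)⁻¹ * (B 0)⁻¹ * (A 0)⁻¹ ∈ formStab ρ f := by
      rw [mem_formStab_iff]
      intro w
      have := h (Pi.single 0 (0, ρ (A 0)⁻¹ w))
      rw [dCommP_succ, dCommOne_apply] at this
      have h0 : (fun i : Fin g =>
          (Pi.single 0 (0, ρ (A 0)⁻¹ w) : Fin (g + 1) → W × W) i.succ) = 0 := by
        funext i; simp
      rw [h0] at this
      simp only [Pi.single_eq_same, map_zero, sub_self, zero_add, add_zero, map_sub,
        ← Module.End.mul_apply, ← map_mul, mul_inv_cancel, map_one, Module.End.one_apply] at this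
      exact (sub_eq_zero.1 this).symm
    -- Writing `A`, `B` for `A 0`, `B 0`: the inverse of `A B A⁻¹ B⁻¹ A⁻¹` times `A B A⁻¹` is `A B`;
    -- then `A` and `B` follow.
    have h3 : A 0 * B 0 ∈ formStab ρ f := by
      have := mul_mem (inv_mem h2) h1
      simpa [mul_assoc] using this
    have hA : A 0 ∈ formStab ρ f := by
      have := mul_mem (inv_mem h1) h3
      simpa [mul_assoc] using this
    have hB : B 0 ∈ formStab ρ f := by
      have := mul_mem (inv_mem hA) h3
      simpa using this
    refine Fin.cases ⟨hA, hB⟩ (fun j => ?_) i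
    refine ih (A := fun i => A i.succ) (B := fun i => B i.succ) (fun w => ?_) j
    -- The first commutator preserves `f`, so its twist of the remaining differential can be
    -- dropped.
    have h4 := h (Fin.cons 0 w)
    rw [dCommP_succ] at h4
    simp only [Fin.cons_zero, Fin.cons_succ, map_zero, zero_add] at h4
    rwa [mem_formStab_iff.1 (mul_mem (mul_mem (mul_mem hA hB) (inv_mem hA)) (inv_mem hB))] at h4

end Differential

/-! ### The symplectic Lie algebra -/

section Lie

variable {l : Type*} [Fintype l] [DecidableEq l]

/-- The involution whose fixed points are the matrices in the symplectic Lie algebra. -/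
def tau (R : Type*) [CommRing R] : Matrix (l ⊕ l) (l ⊕ l) R →ₗ[R] Matrix (l ⊕ l) (l ⊕ l) R where
  toFun M := Matrix.J l R * M.transpose * Matrix.J l R
  map_add' M N := by rw [Matrix.transpose_add, mul_add, add_mul]
  map_smul' c M := by simp

theorem tau_apply {R : Type*} [CommRing R] (M : Matrix (l ⊕ l) (l ⊕ l) R) :
    tau R M = Matrix.J l R * M.transpose * Matrix.J l R := rfl

theorem tau_tau {R : Type*} [CommRing R] (M : Matrix (l ⊕ l) (l ⊕ l) R) : tau R (tau R M) = M := by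
  rw [tau_apply, tau_apply, Matrix.transpose_mul, Matrix.transpose_mul, Matrix.transpose_transpose,
    Matrix.J_transpose]
  have h := Matrix.J_squared l R
  have : Matrix.J l R * (-Matrix.J l R * (M * -Matrix.J l R)) * Matrix.J l R =
    (Matrix.J l R * Matrix.J l R) * M * (Matrix.J l R * Matrix.J l R) := by noncomm_ring
  rw [this, h]
  simp

theorem tau_transpose_form {R : Type*} [CommRing R] (Y M : Matrix (l ⊕ l) (l ⊕ l) R) :
    (Y * tau R M).trace = (tau R Y * M).trace := by
  rw [← Matrix.trace_transpose, tau_apply, tau_apply]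
  simp only [Matrix.transpose_mul, Matrix.transpose_transpose, Matrix.J_transpose]
  rw [← Matrix.mul_assoc, Matrix.trace_mul_comm]
  simp only [Matrix.mul_assoc, Matrix.neg_mul, Matrix.mul_neg, neg_neg]
  rw [Matrix.trace_mul_comm (Matrix.J l R)]
  simp only [Matrix.mul_assoc]

theorem sp_transpose_mul_J {R : Type*} [CommRing R] (A : Matrix.symplecticGroup l R) :
    A.1.transpose * Matrix.J l R = Matrix.J l R * (A⁻¹).1 := by
  have h1 := SymplecticGroup.mem_iff'.1 A.2
  have h2 : A.1 * (A⁻¹).1 = 1 := congrArg Subtype.val (mul_inv_cancel A)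
  conv_rhs => rw [← h1]
  rw [Matrix.mul_assoc, h2, Matrix.mul_one]

theorem sp_J_mul_transpose {R : Type*} [CommRing R] (A : Matrix.symplecticGroup l R) :
    Matrix.J l R * (A⁻¹).1.transpose = A.1 * Matrix.J l R := by
  have h1 := SymplecticGroup.mem_iff.1 A.2
  have h2 : (A⁻¹).1 * A.1 = 1 := congrArg Subtype.val (inv_mul_cancel A)
  conv_lhs => rw [← h1]
  rw [Matrix.mul_assoc, ← Matrix.transpose_mul, h2, Matrix.transpose_one, Matrix.mul_one]

theorem tau_conj {R : Type*} [CommRing R] (A : Matrix.symplecticGroup l R)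
    (M : Matrix (l ⊕ l) (l ⊕ l) R) : tau R (A.1 * M * (A⁻¹).1) = A.1 * tau R M * (A⁻¹).1 := by
  rw [tau_apply, tau_apply, Matrix.transpose_mul, Matrix.transpose_mul]
  have : Matrix.J l R * ((A⁻¹).1.transpose * (M.transpose * A.1.transpose)) * Matrix.J l R =
      (Matrix.J l R * (A⁻¹).1.transpose) * M.transpose * (A.1.transpose * Matrix.J l R) := by
    simp only [Matrix.mul_assoc]
  rw [this, sp_J_mul_transpose, sp_transpose_mul_J]
  simp only [Matrix.mul_assoc]

variable (l) in
/-- The symplectic Lie algebra. -/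
def spLie (R : Type*) [CommRing R] : Submodule R (Matrix (l ⊕ l) (l ⊕ l) R) :=
  LinearMap.eqLocus (tau R) LinearMap.id

theorem mem_spLie {R : Type*} [CommRing R] {M : Matrix (l ⊕ l) (l ⊕ l) R} :
    M ∈ spLie l R ↔ tau R M = M := Iff.rfl

variable (l) in
/-- The adjoint representation. -/
def adRep (R : Type*) [CommRing R] : Matrix.symplecticGroup l R →* Module.End R (spLie l R) where
  toFun A :=
    { toFun := fun Z => ⟨A.1 * Z.1 * (A⁻¹).1, by rw [mem_spLie, tau_conj, mem_spLie.1 Z.2]⟩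
      map_add' := fun Z Y => Subtype.ext (by simp [mul_add, add_mul])
      map_smul' := fun c Z => Subtype.ext (by simp) }
  map_one' := LinearMap.ext fun Z => Subtype.ext (by simp)
  map_mul' A B := LinearMap.ext fun Z => Subtype.ext (by
    simp only [LinearMap.coe_mk, AddHom.coe_mk, Module.End.mul_apply, mul_inv_rev]
    change (A.1 * B.1) * Z.1 * ((B⁻¹).1 * (A⁻¹).1) = A.1 * (B.1 * Z.1 * (B⁻¹).1) * (A⁻¹).1
    simp only [Matrix.mul_assoc])

theorem adRep_coe {R : Type*} [CommRing R] (A : Matrix.symplecticGroup l R) (Z : spLie l R) :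
    (adRep l R A Z).1 = A.1 * Z.1 * (A⁻¹).1 := rfl

/-- `Z ↦ Z J` embeds the Lie algebra into the symmetric matrices, which are determined by one entry
for each unordered pair. Only this inequality is needed. -/
theorem finrank_spLie_le (K : Type*) [Field K] :
    Module.finrank K (spLie l K) ≤ Fintype.card l * (2 * Fintype.card l + 1) := by
  let F : spLie l K →ₗ[K] (Sym2 (l ⊕ l) → K) :=
    LinearMap.pi fun z => (LinearMap.proj (Quot.out z).2 ∘ₗ LinearMap.proj (Quot.out z).1) ∘ₗ
      (LinearMap.mulRight K (Matrix.J l K)) ∘ₗ (spLie l K).subtype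
  have hF : ∀ Z z, F Z z = (Z.1 * Matrix.J l K) (Quot.out z).1 (Quot.out z).2 := fun _ _ => rfl
  have hinj : Function.Injective F := by
    rw [injective_iff_map_eq_zero]
    intro Z hZ
    have hsym : ∀ p q, (Z.1 * Matrix.J l K) q p = (Z.1 * Matrix.J l K) p q := by
      have : (Z.1 * Matrix.J l K).transpose = Z.1 * Matrix.J l K := by
        conv_rhs => rw [← mem_spLie.1 Z.2, tau_apply, Matrix.mul_assoc, Matrix.J_squared]
        rw [Matrix.transpose_mul, Matrix.J_transpose]
        simp
      exact fun p q => congrFun (congrFun this p) q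
    have h0 : Z.1 * Matrix.J l K = 0 := by
      ext p q
      have h1 : F Z s(p, q) = 0 := congrFun hZ _
      rw [hF] at h1
      rcases sym2_out_eq p q with h2 | h2
      · rw [h2] at h1
        exact h1
      · rw [h2, hsym] at h1
        exact h1
    have h3 := congrArg (· * Matrix.J l K) h0
    simp only [Matrix.mul_assoc, Matrix.J_squared, Matrix.zero_mul, Matrix.mul_neg, Matrix.mul_one,
      neg_eq_zero] at h3
    exact Subtype.ext h3
  refine (LinearMap.finrank_le_finrank_of_injective hinj).trans (le_of_eq ?_)
  classical
  rw [Module.finrank_fintype_fun_eq_card, Sym2.card, Fintype.card_sum, Nat.choose_two_right, ← two_mul,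
    Nat.add_sub_cancel, mul_comm (2 * Fintype.card l + 1), mul_assoc 2 (Fintype.card l),
    Nat.mul_div_cancel_left _ two_pos]

end Lie

end

noncomputable section

/-! ### Tangent vectors of the representation variety -/

section Dual

open TrivSqZeroExt

variable {l : Type*} {K : Type*} [Field K]

theorem map_snd_mul [Fintype l] (M N : Matrix (l ⊕ l) (l ⊕ l) (DualNumber K)) :
    (M * N).map snd = M.map fst * N.map snd + M.map snd * N.map fst := by
  ext p q
  simp only [Matrix.map_apply, Matrix.mul_apply, Matrix.add_apply, snd_sum, DualNumber.snd_mul,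
    Finset.sum_add_distrib]

theorem map_fst_mul [Fintype l] (M N : Matrix (l ⊕ l) (l ⊕ l) (DualNumber K)) :
    (M * N).map fst = M.map fst * N.map fst :=
  Matrix.map_mul (f := (fstHom K K K : DualNumber K →+* K))

theorem map_J_snd [DecidableEq l] : (Matrix.J l (DualNumber K)).map snd = 0 := by
  ext p q
  rcases p with p | p <;> rcases q with q | q <;> simp [Matrix.J, Matrix.one_apply] <;>
    split_ifs <;> simp

theorem map_J_fst [DecidableEq l] : (Matrix.J l (DualNumber K)).map fst = Matrix.J l K :=
  Matrix.map_J _ (fstHom K K K : DualNumber K →+* K)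

variable [Fintype l] [DecidableEq l]

/-- Reduction of matrices over the dual numbers. -/
def redSp : Matrix.symplecticGroup l (DualNumber K) →* Matrix.symplecticGroup l K :=
  spMap (fstHom K K K : DualNumber K →+* K)

theorem redSp_coe (M : Matrix.symplecticGroup l (DualNumber K)) : (redSp M).1 = M.1.map fst := rfl

/-- The logarithmic derivative of a symplectic matrix over the dual numbers. -/
def logDer (M : Matrix.symplecticGroup l (DualNumber K)) : spLie l K :=
  ⟨M.1.map snd * ((redSp M)⁻¹).1, by
    -- The infinitesimal part of `M J Mᵗ = J`.
    have h1 := congrArg (fun N => N.map snd) (SymplecticGroup.mem_iff.1 M.2)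
    simp only [map_snd_mul, map_fst_mul, map_J_snd, map_J_fst, Matrix.mul_zero, zero_add] at h1
    rw [mem_spLie, tau_apply, Matrix.transpose_mul, ← Matrix.mul_assoc, sp_J_mul_transpose, redSp_coe]
    have h2 := add_eq_zero_iff_eq_neg.1 h1
    have h3 : (M.1.map snd).transpose = M.1.transpose.map snd := rfl
    rw [h3, h2, Matrix.neg_mul, Matrix.mul_assoc]
    have h4 : M.1.transpose.map fst = (redSp M).1.transpose := rfl
    rw [h4, sp_transpose_mul_J, Matrix.mul_assoc, ← Matrix.mul_assoc (Matrix.J l K),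
      Matrix.J_squared]
    simp⟩

theorem logDer_coe (M : Matrix.symplecticGroup l (DualNumber K)) :
    (logDer M).1 = M.1.map snd * ((redSp M)⁻¹).1 := rfl

/-- The product rule, multiplied on the right by the inverse of the reduction of `M N`. It makes
`logDer` a crossed homomorphism for the adjoint representation. -/
theorem logDer_mul (M N : Matrix.symplecticGroup l (DualNumber K)) :
    logDer (M * N) = logDer M + adRep l K (redSp M) (logDer N) := by
  apply Subtype.ext
  change _ = (logDer M).1 + (adRep l K (redSp M) (logDer N)).1
  rw [adRep_coe, logDer_coe, logDer_coe, logDer_coe, map_mul, mul_inv_rev]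
  change (M.1 * N.1).map snd * (((redSp N)⁻¹).1 * ((redSp M)⁻¹).1) = _
  have h1 : (redSp N).1 * ((redSp N)⁻¹).1 = 1 := congrArg Subtype.val (mul_inv_cancel (redSp N))
  rw [map_snd_mul, ← redSp_coe, ← redSp_coe, add_mul, add_comm, Matrix.mul_assoc (M.1.map snd),
    ← Matrix.mul_assoc (redSp N).1, h1, Matrix.one_mul]
  simp only [Matrix.mul_assoc]

theorem map_snd_eq_zero_of_logDer_eq_zero {M : Matrix.symplecticGroup l (DualNumber K)}
    (h : logDer M = 0) : M.1.map snd = 0 := by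
  have h1 : ((redSp M)⁻¹).1 * (redSp M).1 = 1 := congrArg Subtype.val (inv_mul_cancel (redSp M))
  have h2 := congrArg (fun Z => Z.1 * (redSp M).1) h
  simp only [logDer_coe, Matrix.mul_assoc, h1, Matrix.mul_one] at h2
  rw [h2]
  exact Matrix.zero_mul _

theorem logDer_const (M : Matrix.symplecticGroup l K) :
    logDer (spMap (algebraMap K (DualNumber K)) M) = 0 := by
  apply Subtype.ext
  rw [logDer_coe]
  have : (spMap (algebraMap K (DualNumber K)) M).1.map snd = 0 := by
    ext p q
    exact snd_inl (R := K) K (M.1 p q)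
  rw [this]
  exact Matrix.zero_mul _

end Dual

/-! ### Cotangent spaces at rational points and points over the dual numbers -/

section Cotangent

variable {K A : Type*} [Field K] [CommRing A] [Algebra K A] (φ : A →ₐ[K] K)

/-- The class of `f - f(x)` in the cotangent space. -/
def diffAt : A →ₗ[K] (RingHom.ker φ).Cotangent where
  toFun f := (RingHom.ker φ).toCotangent ⟨f - algebraMap K A (φ f), by simp [RingHom.mem_ker]⟩
  map_add' f h := by
    rw [← map_add]
    congr 1
    apply Subtype.ext
    simp only [map_add, Submodule.coe_add]
    ring
  map_smul' c f := by
    rw [← LinearMap.map_smul_of_tower]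
    congr 1
    apply Subtype.ext
    simp [Algebra.smul_def, mul_sub]

theorem diffAt_apply (f : A) : diffAt φ f =
    (RingHom.ker φ).toCotangent ⟨f - algebraMap K A (φ f), by simp [RingHom.mem_ker]⟩ := rfl

theorem diffAt_mul (f h : A) : diffAt φ (f * h) = φ f • diffAt φ h + φ h • diffAt φ f := by
  rw [← map_smul, ← map_smul, ← map_add, ← sub_eq_zero, ← map_sub, diffAt_apply,
    Ideal.toCotangent_eq_zero]
  have : f * h - (φ f • h + φ h • f) - algebraMap K A (φ (f * h - (φ f • h + φ h • f))) =
      (f - algebraMap K A (φ f)) * (h - algebraMap K A (φ h)) := by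
    simp only [map_sub, map_mul, map_add, map_smul, smul_eq_mul]
    simp only [Algebra.smul_def]
    ring
  change f * h - (φ f • h + φ h • f) - algebraMap K A (φ (f * h - (φ f • h + φ h • f))) ∈ _
  rw [this, pow_two]
  exact Ideal.mul_mem_mul (by simp [RingHom.mem_ker]) (by simp [RingHom.mem_ker])

theorem diffAt_of_mem (f : RingHom.ker φ) : diffAt φ f = (RingHom.ker φ).toCotangent f := by
  rw [diffAt_apply]
  congr 1
  apply Subtype.ext
  have : φ f = 0 := f.2
  simp [this]

theorem diffAt_surjective : Function.Surjective (diffAt φ) := fun x => by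
  obtain ⟨f, rfl⟩ := (RingHom.ker φ).toCotangent_surjective x
  exact ⟨f, diffAt_of_mem φ f⟩

/-- The point with values in the dual numbers given by a tangent vector. -/
def tangentHom (ℓ : Module.Dual K (RingHom.ker φ).Cotangent) : A →ₐ[K] DualNumber K :=
  AlgHom.ofLinearMap
    { toFun := fun f => (φ f, ℓ (diffAt φ f))
      map_add' := fun f h => by rw [map_add, map_add, map_add]; rfl
      map_smul' := fun c f => by rw [map_smul, map_smul, map_smul]; rfl }
    (by
      have : diffAt φ 1 = 0 := by
        have := diffAt_mul φ 1 1
        rw [mul_one, map_one φ, one_smul] at this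
        exact left_eq_add.1 this
      change ((φ 1, ℓ (diffAt φ 1)) : K × K) = (1, 0)
      rw [this, map_one, map_zero])
    (fun f h => by
      apply TrivSqZeroExt.ext
      · exact map_mul φ f h
      · rw [DualNumber.snd_mul]
        change ℓ (diffAt φ (f * h)) = φ f * ℓ (diffAt φ h) + ℓ (diffAt φ f) * φ h
        rw [diffAt_mul, map_add, map_smul, map_smul, smul_eq_mul, smul_eq_mul, mul_comm (φ h)])

theorem snd_tangentHom (ℓ : Module.Dual K (RingHom.ker φ).Cotangent) (f : A) :
    (tangentHom φ ℓ f).snd = ℓ (diffAt φ f) := rfl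

end Cotangent

variable {n g : ℕ} {K : Type u} [Field K]

/-- The diagonal entries of `ξ` are distinct. -/
theorem diagEntry_injective {a : Fin n → Kˣ} (ha : IsGeneric a) (hsq : ∀ i, a i ^ 2 ≠ 1) :
    Function.Injective (diagEntry a) := by
  have h1 : ∀ i j, i ≠ j → a i ≠ a j := by
    intro i j hij
    have := ha {i} {j} (by simpa using hij) (by simp)
    simpa using this
  have h2 : ∀ i j, a i ≠ (a j)⁻¹ := by
    intro i j h
    rw [← mul_eq_one_iff_eq_inv] at h
    -- Equal indices are excluded by the condition on squares, distinct ones by genericity with one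
    -- set empty.
    by_cases hij : i = j
    · subst hij
      exact hsq i (by rw [pow_two, h])
    · have := ha {i, j} ∅ (by simp) (by simp)
      rw [Finset.prod_pair hij, Finset.prod_empty] at this
      exact this h
  rintro (i | i) (j | j) h
  · by_contra hij
    exact h1 i j (fun h => hij (by rw [h])) h
  · exact absurd h (h2 i j)
  · exact absurd h.symm (h2 j i)
  · by_contra hij
    exact h1 i j (fun h => hij (by rw [h])) (inv_injective h)

/-- No non-zero element of the symplectic Lie algebra commutes with all matrices of a tuple. -/
theorem eq_zero_of_commute (hK : (2 : K) ≠ 0) {a : Fin n → Kˣ} (ha : IsGeneric a)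
    (hsq : ∀ i, a i ^ 2 ≠ 1) {X : SpTuple g n K} (hX : X ∈ U g a)
    {Y : Matrix (Fin n ⊕ Fin n) (Fin n ⊕ Fin n) K} (hY : tau K Y = Y)
    (hcomm : ∀ i, Y * (X.mat i).1 = (X.mat i).1 * Y) : Y = 0 := by
  let S : Subgroup (Sp n K) :=
    { carrier := {M | Y * M.1 = M.1 * Y}
      one_mem' := by simp
      mul_mem' := fun {M N} hM hN => by
        change Y * (M.1 * N.1) = M.1 * N.1 * Y
        rw [← Matrix.mul_assoc, hM, Matrix.mul_assoc, hN, Matrix.mul_assoc]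
      inv_mem' := fun {M} hM => by
        have h1 : (M⁻¹).1 * M.1 = 1 := congrArg Subtype.val (inv_mul_cancel M)
        have h2 : M.1 * (M⁻¹).1 = 1 := congrArg Subtype.val (mul_inv_cancel M)
        change Y * (M⁻¹).1 = (M⁻¹).1 * Y
        calc Y * (M⁻¹).1 = (M⁻¹).1 * M.1 * Y * (M⁻¹).1 := by rw [h1, Matrix.one_mul]
          _ = (M⁻¹).1 * (Y * M.1) * (M⁻¹).1 := by rw [hM, Matrix.mul_assoc (M⁻¹).1]
          _ = (M⁻¹).1 * Y := by
            rw [Matrix.mul_assoc, Matrix.mul_assoc, h2, Matrix.mul_one] }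
  -- `Y` commutes with `ξ`, a product of commutators of the tuple. As `ξ` has distinct diagonal
  -- entries, `Y` is diagonal.
  have hξ : diagSp a ∈ S := by
    have h1 := map_commP S.subtype (fun i => ⟨X.A i, hcomm (Sum.inl i)⟩)
      fun i => ⟨X.B i, hcomm (Sum.inr i)⟩
    have h2 : commP X.A X.B = diagSp a := hX
    rw [← h2]
    simp only [Subgroup.subtype_apply] at h1
    rw [← h1]
    exact SetLike.coe_mem _
  have hdiag : ∀ p q, p ≠ q → Y p q = 0 := by
    intro p q hpq
    have h1 : Y * (diagSp a).1 = (diagSp a).1 * Y := hξ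
    have h2 := congrFun (congrFun h1 p) q
    rw [diagSp_val, Matrix.mul_diagonal, Matrix.diagonal_mul, mul_comm, ← sub_eq_zero, ← sub_mul,
      mul_eq_zero, sub_eq_zero] at h2
    refine h2.resolve_left fun h => hpq ?_
    exact (diagEntry_injective ha hsq (Units.ext h)).symm
  have hYd : Y = Matrix.diagonal fun p => Y p p := by
    ext p q
    by_cases hpq : p = q
    · subst hpq; simp
    · rw [hdiag p q hpq, Matrix.diagonal_apply_ne _ hpq]
  have hedge : ∀ p q, Edge X p q → Y p p = Y q q := by
    rintro p q ⟨i, hi⟩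
    have h1 := congrFun (congrFun (hcomm i) p) q
    rw [hYd, Matrix.mul_diagonal, Matrix.diagonal_mul, mul_comm] at h1
    exact mul_left_cancel₀ hi h1
  -- Membership in the Lie algebra makes the diagonal odd under the swap, while connectedness makes
  -- it even; 2 is invertible.
  have hswap : ∀ p, Y p.swap p.swap = -Y p p := by
    intro p
    have h1 := congrFun (congrFun hY p) p
    rw [tau_apply, mul_J_apply, J_mul_apply, Matrix.transpose_apply] at h1
    rw [← h1]
    have := sgn_mul_self K p
    linear_combination (-Y p.swap p.swap) * this
  rw [hYd]
  ext p q
  by_cases hpq : p = q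
  · subst hpq
    have h1 := apply_swap_of_edge ha hX (fun p => Y p p) hedge p
    rw [hswap] at h1
    rw [Matrix.diagonal_apply_eq, Matrix.zero_apply]
    have h2 : 2 * Y p p = 0 := by linear_combination -h1
    exact (mul_eq_zero.1 h2).resolve_left hK
  · rw [Matrix.diagonal_apply_ne _ hpq, Matrix.zero_apply]

/-- The differential of the product of commutators is surjective at the points of `U`. -/
theorem dCommP_surjective (hK : (2 : K) ≠ 0) {a : Fin n → Kˣ} (ha : IsGeneric a)
    (hsq : ∀ i, a i ^ 2 ≠ 1) {X : SpTuple g n K} (hX : X ∈ U g a) :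
    Function.Surjective (dCommP (adRep (Fin n) K) X.A X.B) := by
  rw [← LinearMap.range_eq_top]
  by_contra hne
  obtain ⟨f, hf0, hf⟩ := Submodule.exists_le_ker_of_lt_top _ (lt_top_iff_ne_top.2 hne)
  have hstab : ∀ i, X.mat i ∈ formStab (adRep (Fin n) K) f := by
    have := mem_formStab_of_dCommP_eq_zero (f := f) fun w => hf ⟨w, rfl⟩
    rintro (i | i)
    · exact (this i).1
    · exact (this i).2
  -- the invariant form on all matrices
  let pr : Matrix (Fin n ⊕ Fin n) (Fin n ⊕ Fin n) K →ₗ[K] spLie (Fin n) K :=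
    LinearMap.codRestrict _ (LinearMap.id + tau K) fun M => by
      rw [mem_spLie, LinearMap.add_apply, LinearMap.id_apply, map_add, tau_tau, add_comm]
  have hpr : ∀ M, (pr M).1 = M + tau K M := fun _ => rfl
  have hprad : ∀ (A : Sp n K) M, pr (A.1 * M * (A⁻¹).1) = adRep (Fin n) K A (pr M) := by
    intro A M
    apply Subtype.ext
    rw [adRep_coe, hpr, hpr, tau_conj, mul_add, add_mul]
  -- `Y` represents `f ∘ pr` by the trace form on all matrices, so non-degeneracy of the form on the
  -- Lie algebra is not required.
  let Y : Matrix (Fin n ⊕ Fin n) (Fin n ⊕ Fin n) K := Matrix.of fun p q => f (pr (Matrix.single q p 1))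
  have hY : ∀ M, f (pr M) = (Y * M).trace := by
    intro M
    conv_lhs => rw [Matrix.matrix_eq_sum_single M]
    simp only [map_sum, Matrix.trace, Matrix.diag, Matrix.mul_apply]
    rw [Finset.sum_comm]
    refine Finset.sum_congr rfl fun q _ => Finset.sum_congr rfl fun p _ => ?_
    have : Matrix.single p q (M p q) = M p q • Matrix.single p q (1 : K) := by
      rw [Matrix.smul_single, smul_eq_mul, mul_one]
    rw [this, map_smul, map_smul, smul_eq_mul, mul_comm]
    rfl
  have hext : ∀ Z Z' : Matrix (Fin n ⊕ Fin n) (Fin n ⊕ Fin n) K,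
      (∀ M, (Z * M).trace = (Z' * M).trace) → Z = Z' := fun Z Z' h =>
    Matrix.ext_iff_trace_mul_right.2 h
  -- `pr ∘ tau = pr`, and `tau` is self-adjoint for the trace form.
  have hYtau : tau K Y = Y := by
    apply hext
    intro M
    rw [← tau_transpose_form, ← hY, ← hY]
    congr 1
    apply Subtype.ext
    rw [hpr, hpr, tau_tau, add_comm]
  -- Invariance of `f` and equivariance of `pr` make `Y` invariant under conjugation by the tuple.
  have hYcomm : ∀ i, Y * (X.mat i).1 = (X.mat i).1 * Y := by
    intro i
    have h1 : ((X.mat i)⁻¹).1 * Y * (X.mat i).1 = Y := by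
      apply hext
      intro M
      have h2 := hY ((X.mat i).1 * M * ((X.mat i)⁻¹).1)
      rw [hprad, mem_formStab_iff.1 (hstab i), hY] at h2
      rw [h2, Matrix.mul_assoc, Matrix.mul_assoc, Matrix.trace_mul_comm]
      simp only [Matrix.mul_assoc]
    have h2 : (X.mat i).1 * ((X.mat i)⁻¹).1 = 1 := congrArg Subtype.val (mul_inv_cancel (X.mat i))
    conv_rhs => rw [← h1]
    rw [← Matrix.mul_assoc, ← Matrix.mul_assoc, h2, Matrix.one_mul]
  have hY0 := eq_zero_of_commute hK ha hsq hX hYtau hYcomm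
  apply hf0
  ext Z
  have h1 := hY Z.1
  rw [hY0, Matrix.zero_mul, Matrix.trace_zero] at h1
  -- On the Lie algebra `pr` is multiplication by 2, so `f` itself vanishes.
  have h2 : pr Z.1 = (2 : K) • Z := by
    apply Subtype.ext
    rw [hpr, mem_spLie.1 Z.2, ← two_smul K]
    rfl
  rw [h2, map_smul, smul_eq_mul] at h1
  exact (mul_eq_zero.1 h1).resolve_left hK

theorem logDer_tangentHom {V : Set (SpTuple g n K)} (X : V)
    (ℓ : Module.Dual K (RingHom.ker (evalAt X)).Cotangent) (i) :
    (logDer (spMap (tangentHom (evalAt X) ℓ : coordRing V →+* DualNumber K) (univ V i))).1 =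
      (Matrix.of fun p q => ℓ (diffAt (evalAt X) (coord V i p q))) * ((X.1.mat i)⁻¹).1 := rfl

/-- The logarithmic derivatives of the matrices along a tangent vector. -/
def tangentMap {V : Set (SpTuple g n K)} (X : V) :
    Module.Dual K (RingHom.ker (evalAt X)).Cotangent →ₗ[K]
      ((Fin g ⊕ Fin g) → spLie (Fin n) K) where
  toFun ℓ i := logDer (spMap (tangentHom (evalAt X) ℓ : coordRing V →+* DualNumber K) (univ V i))
  map_add' ℓ ℓ' := by
    funext i
    apply Subtype.ext
    rw [Pi.add_apply, Submodule.coe_add]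
    simp only [logDer_tangentHom]
    rw [← Matrix.add_mul]
    rfl
  map_smul' c ℓ := by
    funext i
    apply Subtype.ext
    rw [Pi.smul_apply, Submodule.coe_smul]
    simp only [logDer_tangentHom]
    rw [← Matrix.smul_mul]
    rfl

/-- A tangent vector with zero logarithmic derivatives is constant on the coordinates, and these
generate the ring. -/
theorem tangentMap_injective {V : Set (SpTuple g n K)} (X : V) :
    Function.Injective (tangentMap X) := by
  rw [injective_iff_map_eq_zero]
  intro ℓ hℓ
  have h1 : tangentHom (evalAt X) ℓ = (Algebra.ofId K (DualNumber K)).comp (evalAt X) := by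
    apply algHom_ext_coord
    intro i p q
    apply TrivSqZeroExt.ext
    · rfl
    · exact congrFun (congrFun (map_snd_eq_zero_of_logDer_eq_zero (congrFun hℓ i)) p) q
  ext x
  obtain ⟨f, rfl⟩ := diffAt_surjective _ x
  rw [← snd_tangentHom, h1]
  rfl

/-- Over the dual numbers the commutator product is still the constant `ξ`, whose logarithmic
derivative is zero. -/
theorem dCommP_tangentMap {a : Fin n → Kˣ} {V : Set (SpTuple g n K)} (hV : V ⊆ U g a) (X : V)
    (ℓ : Module.Dual K (RingHom.ker (evalAt X)).Cotangent) :
    dCommP (adRep (Fin n) K) X.1.A X.1.B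
      (fun i => (tangentMap X ℓ (Sum.inl i), tangentMap X ℓ (Sum.inr i))) = 0 := by
  let F : Matrix.symplecticGroup (Fin n) (coordRing V) →* Matrix.symplecticGroup (Fin n) (DualNumber K) :=
    spMap (tangentHom (evalAt X) ℓ : coordRing V →+* DualNumber K)
  have h1 : F (commP (fun i => univ V (Sum.inl i)) fun i => univ V (Sum.inr i)) =
      spMap (algebraMap K (DualNumber K)) (diagSp a) := by
    rw [commP_univ hV]
    exact spMap_algHom_diagSp _ _
  rw [map_commP] at h1
  have h2 := crossed_commP (ρ := adRep (Fin n) K) (π := redSp) (d := logDer) logDer_mul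
    (fun i => F (univ V (Sum.inl i))) (fun i => F (univ V (Sum.inr i)))
  rw [h1, logDer_const] at h2
  exact h2.symm

/-- The dimension of the representation variety is at most the expected one. -/
theorem height_ker_evalAt_add_le (hK : (2 : K) ≠ 0) (hg : 0 < g) {a : Fin n → Kˣ} (ha : IsGeneric a)
    (hsq : ∀ i, a i ^ 2 ≠ 1) {V : Set (SpTuple g n K)} (hV : V ⊆ U g a) (X : V) :
    (RingHom.ker (evalAt X)).height + (n * (2 * n + 1) : ℕ) ≤ (2 * g * (n * (2 * n + 1)) : ℕ) := by
  set T := Module.Dual K (RingHom.ker (evalAt X)).Cotangent with hT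
  let L := dCommP (adRep (Fin n) K) X.1.A X.1.B
  let e : ((Fin g ⊕ Fin g) → spLie (Fin n) K) →ₗ[K] (Fin g → spLie (Fin n) K × spLie (Fin n) K) :=
    LinearMap.pi fun i => (LinearMap.proj (Sum.inl i)).prod (LinearMap.proj (Sum.inr i))
  have he : Function.Injective e := by
    intro u v h
    funext i
    rcases i with i | i
    · exact congrArg Prod.fst (congrFun h i)
    · exact congrArg Prod.snd (congrFun h i)
  let F : T →ₗ[K] LinearMap.ker L :=
    LinearMap.codRestrict _ (e ∘ₗ tangentMap X) fun ℓ => dCommP_tangentMap hV X ℓ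
  have hF : Function.Injective F := fun ℓ ℓ' h =>
    tangentMap_injective X (he (congrArg Subtype.val h))
  have : Module.Finite K T := Module.Finite.of_injective F hF
  -- The dual is finite-dimensional by the injection `F`; the cotangent space embeds into its
  -- bidual.
  have : Module.Finite K (RingHom.ker (evalAt X)).Cotangent :=
    Module.Finite.of_injective (Module.Dual.eval K _) (Module.eval_apply_injective K)
  have hprime : (RingHom.ker (evalAt X)).IsPrime := (isMaximal_ker_evalAt X).isPrime
  have : IsNoetherianRing (coordRing V) := Algebra.FiniteType.isNoetherianRing K _
  have h1 := height_le_finrank_cotangent (k := K) (RingHom.ker (evalAt X))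
  have h2 := LinearMap.finrank_le_finrank_of_injective hF
  rw [Subspace.dual_finrank_eq] at h2
  have h3 := LinearMap.finrank_range_add_finrank_ker L
  rw [LinearMap.range_eq_top.2 (dCommP_surjective hK ha hsq (hV X.2)), finrank_top,
    Module.finrank_pi_fintype, Finset.sum_const, Finset.card_univ, Fintype.card_fin,
    Module.finrank_prod, smul_eq_mul, ← two_mul, ← mul_assoc, mul_comm g] at h3
  -- The bound obtained is `2g - 1` times the dimension of the Lie algebra. Since `g > 0`, the upper
  -- estimate `n(2n+1)` for that dimension is enough.
  have h4 := finrank_spLie_le (l := Fin n) K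
  rw [Fintype.card_fin] at h4
  have h5 : Module.finrank K (RingHom.ker (evalAt X)).Cotangent + n * (2 * n + 1) ≤
      2 * g * (n * (2 * n + 1)) := by
    obtain ⟨k, hk⟩ := Nat.exists_eq_add_of_le h4
    rw [hk]
    have : Module.finrank K (spLie (Fin n) K) + k ≤
      2 * g * (Module.finrank K (spLie (Fin n) K) + k) - Module.finrank K (LinearMap.ker L) := by
      rw [mul_add, ← h3]
      have : k ≤ 2 * g * k := Nat.le_mul_of_pos_left _ (by omega)
      omega
    have h6 : k ≤ 2 * g * k := Nat.le_mul_of_pos_left _ (by omega)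
    rw [mul_add, ← h3]
    omega
  refine (add_le_add_left h1 _).trans ?_
  exact_mod_cast h5

end

/-! ### The transcendence degree of the ring of invariants -/

theorem isAlgebraic_of_mul_sq_eq {R D : Type*} [CommRing R] [CommRing D] [Algebra R D] {b : D}
    {e₁ e₂ : R} (he : e₁ ≠ 0) (h : algebraMap R D e₁ * b ^ 2 = algebraMap R D e₂) :
    IsAlgebraic R b := by
  refine ⟨Polynomial.C e₁ * Polynomial.X ^ 2 - Polynomial.C e₂, fun h => he ?_, ?_⟩
  · have := congrArg (Polynomial.coeff · 2) h
    simpa [Polynomial.coeff_C] using this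
  · simp [h]

theorem trdeg_le_add_of_isAlgebraic {K R D : Type u} [Field K] [CommRing R] [IsDomain R] [CommRing D]
    [IsDomain D] [Algebra K R] [Algebra R D] [Algebra K D] [IsScalarTower K R D] [FaithfulSMul R D]
    {n : ℕ} (f : Fin n → D) (h : Algebra.IsAlgebraic (Algebra.adjoin R (Set.range f)) D) :
    Algebra.trdeg K D ≤ Algebra.trdeg K R + n := by
  rw [← trdeg_add_eq K (S := R) (A := D)]
  refine add_le_add_right ((Algebra.IsAlgebraic.trdeg_le_cardinalMk R (Set.range f)).trans ?_) _
  have := Cardinal.mk_range_le_lift (f := f)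
  simpa using this

theorem trdeg_add_le_of_injective {K R D : Type u} [Field K] [CommRing R] [IsDomain R] [CommRing D]
    [Algebra K R] [Algebra K D] {n : ℕ} (Ψ : MvPolynomial (Fin n) R →ₐ[K] D)
    (hΨ : Function.Injective Ψ) : Algebra.trdeg K R + n ≤ Algebra.trdeg K D := by
  refine le_trans (le_of_eq ?_) (trdeg_le_of_injective Ψ hΨ)
  rw [← trdeg_add_eq K (S := R) (A := MvPolynomial (Fin n) R), MvPolynomial.trdeg_of_isDomain]
  simp

section QuotientDim

variable {K A : Type u} {G : Type*} [Field K] [CommRing A] [Algebra K A] [Group G] [MulSemiringAction G A]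
  [SMulCommClass G K A] {n : ℕ} {χ : Multiplicative (Fin n → ℤ) →* (G →* K)} {S : Subalgebra K A}

theorem prod_pow_mem_wtSpace {f : Fin n → A} {v : Fin n → Fin n → ℤ} (hf : ∀ i, f i ∈ wtSpace χ (v i))
    (d : Fin n → ℕ) : ∏ i, f i ^ d i ∈ wtSpace χ (∑ i, d i • v i) :=
  SetLike.prod_mem_graded _ _ _ fun i _ => SetLike.pow_mem_graded _ (hf i)

theorem sum_smul_single (d : Fin n → ℕ) (c : ℤ) :
    ∑ i, d i • (Pi.single i c : Fin n → ℤ) = fun i => d i * c := by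
  funext j
  rw [Finset.sum_apply, Finset.sum_eq_single j]
  · simp
  · intro i _ hij
    simp [Pi.single_eq_of_ne hij.symm]
  · simp

/-- Modulo `P`, every generator is algebraic over the invariants with the `n` functions `f i`
adjoined: its square has even weight, which monomials in the `f i` and `f' i` bring to 0. -/
theorem trdeg_quotient_le (hS : ∀ a, a ∈ S ↔ ∀ h : G, h • a = a) {ι : Type*} {x : ι → A}
    {wt : ι → Fin n → ℤ} (hx : ∀ i, x i ∈ wtSpace χ (wt i))
    (hgen : Algebra.adjoin K (Set.range x) = ⊤) {f f' : Fin n → A}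
    (hf : ∀ i, f i ∈ wtSpace χ (Pi.single i 2)) (hf' : ∀ i, f' i ∈ wtSpace χ (Pi.single i (-2)))
    (P : Ideal A) [P.IsPrime] (hP : ∀ i, f i * f' i ∉ P) :
    Algebra.trdeg K (A ⧸ P) ≤ Algebra.trdeg K (S ⧸ P.under S) + n := by
  have hS0 : ∀ a ∈ wtSpace (A := A) χ 0, a ∈ S := fun a ha => (hS a).2 ((mem_wtSpace_zero χ).1 ha)
  let C := Algebra.adjoin (S ⧸ P.under S) (Set.range fun i => Ideal.Quotient.mk P (f i))
  have hSC : ∀ a ∈ S, Ideal.Quotient.mk P a ∈ C := fun a ha =>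
    C.algebraMap_mem (Ideal.Quotient.mk (P.under S) ⟨a, ha⟩)
  have hfC : ∀ i, Ideal.Quotient.mk P (f i) ∈ C := fun i => Algebra.subset_adjoin ⟨i, rfl⟩
  have hb : ∀ i, IsAlgebraic C (Ideal.Quotient.mk P (x i)) := by
    intro i
    let w := wt i
    let b := x i
    -- `c` cancels the negative part of the weight `2w` of `b ^ 2` and `c₂` the positive part, so `b
    -- ^ 2 * c * c₂` is invariant. The `f' j` need not lie in `C`; the factor `c₁` makes `c₂ * c₁`
    -- invariant, and `(c * (c₂ * c₁)) * b ^ 2 = (b ^ 2 * c * c₂) * c₁` has coefficients in `C`.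
    let c := ∏ j, f j ^ (-w j).toNat
    let c₁ := ∏ j, f j ^ (w j).toNat
    let c₂ := ∏ j, f' j ^ (w j).toNat
    have h1 : b ^ 2 * c * c₂ ∈ S := by
      apply hS0
      have := SetLike.mul_mem_graded (SetLike.mul_mem_graded (SetLike.pow_mem_graded 2 (hx i))
        (prod_pow_mem_wtSpace hf fun j => (-w j).toNat)) (prod_pow_mem_wtSpace hf' fun j => (w j).toNat)
      convert this
      rw [sum_smul_single, sum_smul_single]
      funext j
      simp only [Pi.zero_apply, Pi.add_apply, Pi.smul_apply]
      rw [nsmul_eq_mul]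
      have : ((w j).toNat : ℤ) - ((-w j).toNat : ℤ) = wt i j := Int.toNat_sub_toNat_neg (w j)
      push_cast
      linarith
    have h2 : c₂ * c₁ = ∏ j, (f j * f' j) ^ (w j).toNat := by
      rw [← Finset.prod_mul_distrib]
      exact Finset.prod_congr rfl fun j _ => by rw [mul_pow, mul_comm]
    have h3 : c₂ * c₁ ∈ S := by
      rw [h2]
      refine Subalgebra.prod_mem _ fun j _ => Subalgebra.pow_mem _ (hS0 _ ?_) _
      have := SetLike.mul_mem_graded (hf j) (hf' j)
      rwa [← Pi.single_add, add_neg_cancel, Pi.single_zero] at this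
    have h4 : c * (c₂ * c₁) ∉ P := by
      have hff : ∀ j, f j ∉ P := fun j h => hP j (P.mul_mem_right _ h)
      rw [h2]
      intro h
      rcases Ideal.IsPrime.mem_or_mem ‹_› h with h | h
      · obtain ⟨j, -, hj⟩ := Ideal.IsPrime.prod_mem_iff.1 h
        exact hff j (Ideal.IsPrime.mem_of_pow_mem ‹_› _ hj)
      · obtain ⟨j, -, hj⟩ := Ideal.IsPrime.prod_mem_iff.1 h
        exact hP j (Ideal.IsPrime.mem_of_pow_mem ‹_› _ hj)
    let e₁ : C := ⟨Ideal.Quotient.mk P (c * (c₂ * c₁)), by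
      rw [map_mul]
      refine mul_mem ?_ (hSC _ h3)
      rw [map_prod]
      exact Subalgebra.prod_mem _ fun j _ => by
        rw [map_pow]
        exact Subalgebra.pow_mem _ (hfC j) _⟩
    let e₂ : C := ⟨Ideal.Quotient.mk P (b ^ 2 * c * c₂ * c₁), by
      rw [map_mul]
      refine mul_mem (hSC _ h1) ?_
      rw [map_prod]
      exact Subalgebra.prod_mem _ fun j _ => by
        rw [map_pow]
        exact Subalgebra.pow_mem _ (hfC j) _⟩
    have he₁ : e₁ ≠ 0 := fun h => h4 (Ideal.Quotient.eq_zero_iff_mem.1 (congrArg Subtype.val h))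
    refine isAlgebraic_of_mul_sq_eq he₁ (e₂ := e₂) ?_
    change Ideal.Quotient.mk P (c * (c₂ * c₁)) * Ideal.Quotient.mk P b ^ 2 =
      Ideal.Quotient.mk P (b ^ 2 * c * c₂ * c₁)
    rw [← map_pow, ← map_mul]
    congr 1
    ring
  have halg : Algebra.IsAlgebraic C (A ⧸ P) := by
    refine ⟨fun d => ?_⟩
    obtain ⟨a, rfl⟩ := Ideal.Quotient.mk_surjective d
    have ha : a ∈ Algebra.adjoin K (Set.range x) := hgen ▸ Algebra.mem_top
    induction ha using Algebra.adjoin_induction with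
    | mem a ha =>
      obtain ⟨i, rfl⟩ := ha
      exact hb i
    | algebraMap r =>
      exact isAlgebraic_algebraMap (⟨_, hSC _ (S.algebraMap_mem r)⟩ : C)
    | add a b _ _ ha hb => rw [map_add]; exact ha.add hb
    | mul a b _ _ ha hb => rw [map_mul]; exact ha.mul hb
  exact trdeg_le_add_of_isAlgebraic _ halg

/-- Distinct monomials in the `f i` have distinct weights, so they are independent over `S ⧸ q`.
Since `P` need not be stable under `G`, the argument takes place modulo the extension `I` of `q`,
which is; the new prime contains `I` but may differ from `P`. -/
theorem exists_prime_le_trdeg (hχ : Function.Injective χ) (hS : ∀ a, a ∈ S ↔ ∀ h : G, h • a = a)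
    {f : Fin n → A} (hf : ∀ i, f i ∈ wtSpace χ (Pi.single i 2)) (P : Ideal A) [hPp : P.IsPrime]
    (hP : ∀ i, f i ∉ P) : ∃ P' : Ideal A, P'.IsPrime ∧
      Algebra.trdeg K (S ⧸ P.under S) + n ≤ Algebra.trdeg K (A ⧸ P') := by
  set q := P.under S with hq
  let I : Ideal A := q.map (algebraMap S A)
  have hIP : I ≤ P := Ideal.map_le_iff_le_comap.2 le_rfl
  have hstab : ∀ (h : G), ∀ a ∈ I.restrictScalars K, h • a ∈ I.restrictScalars K := by
    intro h
    have : I ≤ I.comap (MulSemiringAction.toRingHom G A h) := by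
      refine Ideal.map_le_iff_le_comap.2 fun r hr => ?_
      change h • (r : A) ∈ I
      rw [(hS r).1 r.2 h]
      exact Ideal.mem_map_of_mem (algebraMap S A) hr
    exact this
  let φ : (S ⧸ q) →ₐ[K] (A ⧸ I) := Ideal.quotientMapₐ I S.val Ideal.le_comap_map
  let _ : Algebra (S ⧸ q) (A ⧸ I) := φ.toRingHom.toAlgebra
  have : IsScalarTower K (S ⧸ q) (A ⧸ I) := IsScalarTower.of_algebraMap_eq' φ.comp_algebraMap.symm
  let Φ : MvPolynomial (Fin n) (S ⧸ q) →ₐ[S ⧸ q] (A ⧸ I) :=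
    MvPolynomial.aeval fun i => Ideal.Quotient.mk I (f i)
  have hΦ : Function.Injective Φ := by
    rw [injective_iff_map_eq_zero]
    intro p hp
    obtain ⟨p, rfl⟩ := MvPolynomial.map_surjective _ (Ideal.Quotient.mk_surjective (I := q)) p
    have h1 : Φ (MvPolynomial.map (Ideal.Quotient.mk q) p) =
        Ideal.Quotient.mk I (∑ d ∈ p.support, ((p.coeff d : S) : A) * ∏ i, f i ^ d i) := by
      change MvPolynomial.aeval _ _ = _
      rw [MvPolynomial.aeval_def, MvPolynomial.eval₂_map, MvPolynomial.eval₂_eq', map_sum]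
      refine Finset.sum_congr rfl fun d _ => ?_
      rw [map_mul, map_prod]
      simp only [map_pow]
      rfl
    rw [h1, Ideal.Quotient.eq_zero_iff_mem] at hp
    classical
    let v : (Fin n →₀ ℕ) → Fin n → ℤ := fun d i => d i * 2
    have hv : Function.Injective v := by
      intro d d' h
      ext i
      have := congrFun h i
      simp only [v] at this
      omega
    -- The terms of the relation, reindexed by weight and extended by zero. Each of them lies in `I
    -- ⊆ P`, and since no `f i` lies in `P`, its coefficient lies in `q`.
    let F : (Fin n → ℤ) → A :=
      Function.extend v (fun d : Fin n →₀ ℕ => ((p.coeff d : S) : A) * ∏ i, f i ^ d i) 0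
    have hFv : ∀ d, F (v d) = ((p.coeff d : S) : A) * ∏ i, f i ^ d i := fun d => hv.extend_apply _ _ d
    have hF : ∀ w, F w ∈ wtSpace χ w := by
      intro w
      by_cases hw : ∃ d, v d = w
      · obtain ⟨d, rfl⟩ := hw
        rw [hFv]
        have h2 := SetLike.mul_mem_graded
          ((mem_wtSpace_zero χ).2 ((hS ((p.coeff d : S) : A)).1 (p.coeff d).2)) (prod_pow_mem_wtSpace hf d)
        rw [zero_add, sum_smul_single] at h2
        exact h2
      · rw [show F w = 0 from Function.extend_apply' _ _ _ hw]
        exact zero_mem _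
    have hsum : ∑ w ∈ p.support.map ⟨v, hv⟩, F w ∈ I.restrictScalars K := by
      rw [Finset.sum_map]
      simp only [Function.Embedding.coeFn_mk, hFv]
      exact hp
    have hmem := mem_of_sum_mem hχ (I.restrictScalars K) hstab _ F hF hsum
    ext d
    rw [MvPolynomial.coeff_map, MvPolynomial.coeff_zero, Ideal.Quotient.eq_zero_iff_mem]
    by_cases hd : d ∈ p.support
    · have h2 : F (v d) ∈ I := hmem (v d) (Finset.mem_map_of_mem ⟨v, hv⟩ hd)
      rw [hFv] at h2
      change ((p.coeff d : S) : A) ∈ P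
      refine (hPp.mem_or_mem (hIP h2)).resolve_right fun h => ?_
      obtain ⟨j, -, hj⟩ := Ideal.IsPrime.prod_mem_iff.1 h
      exact hP j (hPp.mem_of_pow_mem _ hj)
    · rw [MvPolynomial.notMem_support_iff.1 hd]
      exact zero_mem _
  -- `A ⧸ I` need not be a domain; some prime of it contracts to zero in the polynomial ring.
  obtain ⟨Q, hQ, hQ0⟩ := Ideal.exists_comap_eq_of_mem_minimalPrimes_of_injective
    (f := (Φ : MvPolynomial (Fin n) (S ⧸ q) →+* (A ⧸ I))) hΦ ⊥ (by
      rw [IsDomain.minimalPrimes_eq_singleton_bot]; rfl)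
  let ψ : A →ₐ[K] ((A ⧸ I) ⧸ Q) := (Ideal.Quotient.mkₐ K Q).comp (Ideal.Quotient.mkₐ K I)
  have hψ : Function.Surjective ψ :=
    (Ideal.Quotient.mkₐ_surjective K Q).comp (Ideal.Quotient.mkₐ_surjective K I)
  refine ⟨RingHom.ker ψ, RingHom.ker_isPrime _, ?_⟩
  rw [(Ideal.quotientKerAlgEquivOfSurjective hψ).trdeg_eq]
  let Ψ : MvPolynomial (Fin n) (S ⧸ q) →ₐ[K] ((A ⧸ I) ⧸ Q) :=
    (Ideal.Quotient.mkₐ K Q).comp (Φ.restrictScalars K)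
  have hΨ : Function.Injective Ψ := by
    rw [injective_iff_map_eq_zero]
    intro p hp
    have h0 : Φ p ∈ Q := Ideal.Quotient.eq_zero_iff_mem.1 hp
    have : p ∈ Q.comap (Φ : MvPolynomial (Fin n) (S ⧸ q) →+* (A ⧸ I)) := h0
    rwa [hQ0] at this
  exact trdeg_add_le_of_injective Ψ hΨ

end QuotientDim

noncomputable section

variable {n g : ℕ} {K : Type u} [Field K]

/-! ### The dimension of the quotient -/

theorem exists_evalAt_of_isMaximal_U [IsAlgClosed K] (a : Fin n → Kˣ)
    (m : Ideal (coordRing (U g a : Set (SpTuple g n K)))) (hm : m.IsMaximal) :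
    ∃ X : (U g a : Set (SpTuple g n K)), m = RingHom.ker (evalAt X) := by
  have := exists_evalAt_of_isMaximal (g := g) a ⊥
  rw [UH_bot] at this
  exact this m hm

/-- There are functions of weights `2 eᵢ` and `-2 eᵢ` which do not vanish at a given point. -/
theorem exists_weight_functions {a : Fin n → Kˣ} (ha : IsGeneric a) (X : (U g a : Set (SpTuple g n K))) (i : Fin n) :
    ∃ f ∈ wtSpace (A := coordRing (U g a : Set (SpTuple g n K))) (torusChar n K) (Pi.single i 2),
      ∃ f' ∈ wtSpace (A := coordRing (U g a : Set (SpTuple g n K))) (torusChar n K)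
        (Pi.single i (-2)), evalAt X f ≠ 0 ∧ evalAt X f' ≠ 0 := by
  -- A path from `i` to its swap has weight `eᵢ - (-eᵢ) = 2 eᵢ`.
  have h := mem_ptWeights_of_edge (V := U g a) ha subset_rfl X (reach_swap ha X.2 (Sum.inl i))
  rw [wt_swap, sub_neg_eq_add, show wt (Sum.inl i) = Pi.single i 1 from rfl, ← Pi.single_add] at h
  obtain ⟨f, hf, f', hf', h1, h2⟩ := h
  rw [← Pi.single_neg] at hf'
  exact ⟨f, hf, f', hf', h1, h2⟩

theorem exists_dim (hg : 0 < g) : ∃ s : ℕ, s + n + n * (2 * n + 1) = 2 * g * (n * (2 * n + 1)) ∧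
    ((2 * g - 1) * n * (2 * n + 1) - n : ℤ) = s := by
  obtain ⟨k, rfl⟩ : ∃ k, g = k + 1 := ⟨g - 1, by omega⟩
  -- With `g = k + 1`: `(2k+1)n(2n+1) - n = 2kn(2n+1) + 2n²`.
  refine ⟨2 * k * (n * (2 * n + 1)) + 2 * n * n, by ring, ?_⟩
  push_cast
  ring

/-- Conjugation by `J` inverts the torus. -/
theorem commutator_diagSp_symJ (s : Fin n → Kˣ) :
    diagSp s * SymplecticGroup.symJ (Fin n) K * (diagSp s)⁻¹ * (SymplecticGroup.symJ (Fin n) K)⁻¹ =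
      diagSp (s ^ 2) := by
  rw [mul_inv_eq_iff_eq_mul, mul_inv_eq_iff_eq_mul]
  apply Subtype.ext
  change (diagSp s).1 * Matrix.J (Fin n) K = (diagSp (s ^ 2)).1 * Matrix.J (Fin n) K * (diagSp s).1
  rw [diagSp_val, diagSp_val]
  ext p q
  rw [Matrix.mul_diagonal, Matrix.diagonal_mul, Matrix.diagonal_mul]
  rcases p with p | p <;> rcases q with q | q <;>
    simp [Matrix.J, Matrix.one_apply, diagEntry] <;> split_ifs with h <;>
    first | rfl | (subst h; field_simp)

section Dimension

variable [IsAlgClosed K] {a : Fin n → Kˣ}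

theorem ringKrullDim_coordRing_le (hK : (2 : K) ≠ 0) (hg : 0 < g) (ha : IsGeneric a)
    (hsq : ∀ i, a i ^ 2 ≠ 1) {N : ℕ} (hN : N + n * (2 * n + 1) = 2 * g * (n * (2 * n + 1))) :
    ringKrullDim (coordRing (U g a : Set (SpTuple g n K))) ≤ N := by
  have := ringKrullDim_le_iff_isMaximal_height_le
    (R := coordRing (U g a : Set (SpTuple g n K))) (N : WithBot ℕ∞)
  refine this.2 fun m hm => ?_
  obtain ⟨X, rfl⟩ := exists_evalAt_of_isMaximal_U a m hm
  have h1 := height_ker_evalAt_add_le hK hg ha hsq subset_rfl X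
  rw [← hN, Nat.cast_add] at h1
  have h2 : (RingHom.ker (evalAt X)).height ≤ (N : ℕ∞) :=
    (ENat.add_le_add_iff_right (ENat.natCast_ne_top _)).1 h1
  exact_mod_cast h2

theorem trdeg_quotient_prime_le (hK : (2 : K) ≠ 0) (hg : 0 < g) (ha : IsGeneric a)
    (hsq : ∀ i, a i ^ 2 ≠ 1) {N : ℕ} (hN : N + n * (2 * n + 1) = 2 * g * (n * (2 * n + 1)))
    (P : Ideal (coordRing (U g a : Set (SpTuple g n K)))) [P.IsPrime] :
    Algebra.trdeg K (coordRing (U g a : Set (SpTuple g n K)) ⧸ P) ≤ N := by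
  obtain ⟨s, hs1, hs2⟩ := exists_ringKrullDim_eq_trdeg K
    (coordRing (U g a : Set (SpTuple g n K)) ⧸ P)
  rw [hs2]
  have h1 := (ringKrullDim_quotient_le P).trans (ringKrullDim_coordRing_le hK hg ha hsq hN)
  rw [hs1] at h1
  exact_mod_cast h1

theorem le_trdeg_quotient_minimalPrime (hK : (2 : K) ≠ 0) {N : ℕ}
    (hN : N + n * (2 * n + 1) = 2 * g * (n * (2 * n + 1)))
    (P : Ideal (coordRing (U g a : Set (SpTuple g n K)))) (hP : P ∈ minimalPrimes _) :
    (N : Cardinal) ≤ Algebra.trdeg K (coordRing (U g a : Set (SpTuple g n K)) ⧸ P) := by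
  have : P.IsPrime := hP.1.1
  obtain ⟨s, hs1, hs2⟩ := exists_ringKrullDim_eq_trdeg K
    (coordRing (U g a : Set (SpTuple g n K)) ⧸ P)
  have h1 := le_trdeg_of_mem_minimalPrimes hK hP hs2
  rw [hs2]
  have h2 : N ≤ s := by omega
  exact_mod_cast h2

theorem exists_prime_over (V : SubMulAction (torus n K) (SpTuple g n K)) (q : Ideal (invariants V))
    [hq : q.IsPrime] : ∃ P : Ideal (coordRing (V : Set (SpTuple g n K))), P.IsPrime ∧
      P.under (invariants V) = q := by
  obtain ⟨x, hx⟩ := (isGoodQuotient_quotMap V).surjective (⟨q, hq⟩ : PrimeSpectrum (invariants V))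
  exact ⟨PrimeSpectrum.asIdeal x, PrimeSpectrum.isPrime x, congrArg PrimeSpectrum.asIdeal hx⟩

set_option maxSynthPendingDepth 3 in
-- `U` has dimension `s + n` along every component. Adjoining `n` weight functions to the quotient
-- of the invariants by `q` accounts for a component of `U` over it, up to algebraic elements, and
-- conversely embeds in the quotient by some prime of the coordinate ring; so the dimension is
-- squeezed to `s`.
theorem ringKrullDim_invariants_quotient (hK : (2 : K) ≠ 0) (hg : 0 < g) (ha : IsGeneric a)
    (hsq : ∀ i, a i ^ 2 ≠ 1) {s : ℕ} (hs : s + n + n * (2 * n + 1) = 2 * g * (n * (2 * n + 1)))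
    (q : Ideal (invariants (U g a))) (hq : q ∈ minimalPrimes _) :
    ringKrullDim (invariants (U g a) ⧸ q) = s := by
  have hqp : q.IsPrime := hq.1.1
  obtain ⟨P₀, hP₀, rfl⟩ := exists_prime_over (U g a) q
  obtain ⟨P, hP, hPP₀⟩ := Ideal.exists_minimalPrimes_le (bot_le : ⊥ ≤ P₀)
  have hPp : P.IsPrime := hP.1.1
  -- A minimal prime below `P₀` still contracts to the minimal prime in question.
  have hPq : P.under (invariants (U g a)) = P₀.under (invariants (U g a)) :=
    le_antisymm (Ideal.comap_mono hPP₀) (hq.2 ⟨inferInstance, bot_le⟩ (Ideal.comap_mono hPP₀))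
  -- A closed point of the component supplies weight functions that are non-zero there, hence
  -- outside `P`.
  obtain ⟨m, hm, hle⟩ := Ideal.exists_le_maximal P hPp.ne_top
  obtain ⟨X, rfl⟩ := exists_evalAt_of_isMaximal_U a m hm
  choose f hf f' hf' h1 h2 using exists_weight_functions ha X
  have hff : ∀ i, f i * f' i ∉ P := fun i hi => by
    have := hle hi
    rw [RingHom.mem_ker, map_mul] at this
    exact mul_ne_zero (h1 i) (h2 i) this
  obtain ⟨t, ht1, ht2⟩ := exists_ringKrullDim_eq_trdeg K
    (invariants (U g a) ⧸ P₀.under (invariants (U g a)))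
  have hlow := (le_trdeg_quotient_minimalPrime hK hs P hP).trans (trdeg_quotient_le
    (χ := torusChar n K) (S := invariants (U g a)) (fun _ => Iff.rfl)
    (x := fun i : (Fin g ⊕ Fin g) × (Fin n ⊕ Fin n) × (Fin n ⊕ Fin n) =>
      coord (U g a : Set (SpTuple g n K)) i.1 i.2.1 i.2.2) (wt := fun i => wt i.2.1 - wt i.2.2)
    (fun i => coord_mem_wtSpace (U g a) i.1 i.2.1 i.2.2) (adjoin_coord _) hf hf' P hff)
  obtain ⟨P', hP', hup⟩ := exists_prime_le_trdeg (χ := torusChar n K) (S := invariants (U g a))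
    torusChar_injective (fun _ => Iff.rfl) hf P fun i hi => hff i (P.mul_mem_right _ hi)
  have hup' := hup.trans (trdeg_quotient_prime_le hK hg ha hsq hs P')
  rw [hPq, ht2] at hlow hup'
  have h3 : s + n ≤ t + n := by exact_mod_cast hlow
  have h4 : t + n ≤ s + n := by exact_mod_cast hup'
  rw [ht1, show t = s by omega]

/-- For `g = 0` the product is empty, and `ξ ≠ 1` as `n > 0`. -/
theorem pos_of_point (hn : 0 < n) (hsq : ∀ i, a i ^ 2 ≠ 1) (x : quot (U g a)) : 0 < g := by
  obtain ⟨y, -⟩ := (isGoodQuotient_quotMap (U g a)).surjective x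
  obtain ⟨m, hm, -⟩ := Ideal.exists_le_maximal _ y.isPrime.ne_top
  obtain ⟨X, -⟩ := exists_evalAt_of_isMaximal_U a m hm
  rcases Nat.eq_zero_or_pos g with rfl | hg
  · exfalso
    have h1 : diagSp a = 1 := X.2.symm
    have h2 := diagSp_injective (h1.trans (map_one diagSp).symm)
    exact hsq ⟨0, hn⟩ (by rw [h2]; simp)
  · exact hg

theorem U_nonempty (hg : 0 < g) (a : Fin n → Kˣ) : ∃ X : SpTuple g n K, X ∈ U g a := by
  obtain ⟨k, rfl⟩ : ∃ k, g = k + 1 := ⟨g - 1, by omega⟩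
  have hroot : ∀ i, ∃ u : Kˣ, u ^ 2 = a i := by
    intro i
    obtain ⟨z, hz⟩ := IsAlgClosed.exists_pow_nat_eq (a i : K) two_pos
    have hz0 : z ≠ 0 := by
      rintro rfl
      rw [zero_pow two_ne_zero] at hz
      exact (a i).ne_zero hz.symm
    exact ⟨Units.mk0 z hz0, Units.ext (by simpa using hz)⟩
  choose s hs using hroot
  -- With `s` a square root of `a`, the first pair is `(diagSp s, J)`, whose commutator is `ξ`; all
  -- other matrices are 1.
  refine ⟨⟨Fin.cons (diagSp s) 1, Fin.cons (SymplecticGroup.symJ (Fin n) K) 1⟩, ?_⟩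
  change commP _ _ = _
  rw [commP_succ]
  have h1 : commP (fun _ : Fin k => (1 : Sp n K)) (fun _ => 1) = 1 :=
    (map_commP (1 : Sp n K →* Sp n K) (fun _ : Fin k => 1) (fun _ => 1)).symm
  simp only [Fin.cons_zero, Fin.cons_succ, Pi.one_apply]
  rw [h1, mul_one, commutator_diagSp_symJ]
  exact congrArg diagSp (funext hs)

theorem invariants_nontrivial (hg : 0 < g) (a : Fin n → Kˣ) : Nontrivial (invariants (U g a)) := by
  obtain ⟨X, hX⟩ := U_nonempty hg a
  exact (evalAt (V := (U g a : Set (SpTuple g n K))) ⟨X, hX⟩ |>.comp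
    (invariants (U g a)).val : _ →ₐ[K] K).toRingHom.domain_nontrivial

theorem hasDim_quot_of_subset (hK : (2 : K) ≠ 0) (hn : 0 < n) (ha : IsGeneric a)
    (hsq : ∀ i, a i ^ 2 ≠ 1) {Y C : Set (quot (U g a))} (hC : C ∈ irreducibleComponents (quot (U g a)))
    (hCY : C ⊆ Y) : HasDim Y ((2 * g - 1) * n * (2 * n + 1) - n) := by
  obtain ⟨x, -⟩ := hC.1.1
  have hg := pos_of_point hn hsq x
  obtain ⟨s, hs, hs'⟩ := exists_dim (n := n) hg
  rw [hs']
  exact hasDim_of_subset s (ringKrullDim_invariants_quotient hK hg ha hsq hs) Y C hC hCY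

theorem hasDim_quot (hK : (2 : K) ≠ 0) (hg : 0 < g) (ha : IsGeneric a) (hsq : ∀ i, a i ^ 2 ≠ 1) :
    HasDim (quot (U g a)) ((2 * g - 1) * n * (2 * n + 1) - n) := by
  obtain ⟨s, hs, hs'⟩ := exists_dim (n := n) hg
  rw [hs']
  have := invariants_nontrivial hg a
  exact hasDim_primeSpectrum s (ringKrullDim_invariants_quotient hK hg ha hsq hs)

end Dimension

end

end SpCharVar

/-! ### The main theorem -/

theorem mainTheorem8 {K : Type u} [Field K] [IsAlgClosed K] (hK : (2 : K) ≠ 0)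
    (g n : ℕ) (hn : 0 < n) (m : ℕ) (hm : 0 < m) (φ : Kˣ) (hφ : IsPrimitiveRoot φ m)
    (e : Fin n → ℕ)
    (hJL : ∀ J L : Finset (Fin n), Disjoint J L → ¬ (J = ∅ ∧ L = ∅) →
      ∏ j ∈ J, φ ^ e j ≠ ∏ l ∈ L, φ ^ e l)
    (hsq : ∀ i, φ ^ (2 * e i) ≠ 1) :
    -- every stabiliser is contained in `μ₂ⁿ`
    (∀ X ∈ SpCharVar.U g (fun i => φ ^ e i),
      MulAction.stabilizer (SpCharVar.torus n K) X ≤ SpCharVar.mu2 n K) ∧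
    -- `M_{n,H}` is a geometric quotient of `U_{n,H}` by `T`
    (∀ H : Subgroup (SpCharVar.torus n K), SpCharVar.centre n K ≤ H → H ≤ SpCharVar.mu2 n K →
      SpCharVar.IsGeometricQuotient
        (SpCharVar.torusAction (SpCharVar.UH g (fun i => φ ^ e i) H))
        (SpCharVar.quotMap (SpCharVar.UH g (fun i => φ ^ e i) H))) ∧
    -- each connected and each irreducible component of `M_n` has the stated dimension
    (∀ x : SpCharVar.quot (SpCharVar.U g (fun i => φ ^ e i)),
      SpCharVar.HasDim (connectedComponent x)
        ((2 * g - 1) * n * (2 * n + 1) - n)) ∧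
    (∀ C ∈ irreducibleComponents (SpCharVar.quot (SpCharVar.U g (fun i => φ ^ e i))),
      SpCharVar.HasDim C ((2 * g - 1) * n * (2 * n + 1) - n)) ∧
    -- for `g ≥ 1`, `M_n` is non-empty of that dimension
    (0 < g → SpCharVar.HasDim (SpCharVar.quot (SpCharVar.U g (fun i => φ ^ e i)))
      ((2 * g - 1) * n * (2 * n + 1) - n)) := by
  have ha : SpCharVar.IsGeneric fun i => φ ^ e i := hJL
  have hsq' : ∀ i, (φ ^ e i) ^ 2 ≠ 1 := fun i => by rw [← pow_mul, mul_comm]; exact hsq i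
  exact ⟨fun X hX => SpCharVar.stabilizer_le_mu2 ha hX,
    fun H _ _ => SpCharVar.isGeometricQuotient_quotMap ha H,
    -- The connected component of `x` contains its irreducible component.
    fun x => SpCharVar.hasDim_quot_of_subset hK hn ha hsq'
      (irreducibleComponent_mem_irreducibleComponents x) irreducibleComponent_subset_connectedComponent,
    fun C hC => SpCharVar.hasDim_quot_of_subset hK hn ha hsq' hC subset_rfl,
    fun hg => SpCharVar.hasDim_quot hK hg ha hsq'⟩
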